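/- Let $X_1,X_2,\dots$ be i.i.d. with unknown density $f$ on $\mathbb R$ and let $\varepsilon_1,\varepsilon_2,\dots$ be i.i.d., independent of the $X_i$, with known density $g$. One observes $Y_i=X_i+\varepsilon_i$, $i=1,\dots,n$. Write $\Phi(u)=\int e^{ixu}f(x)\,dx$ and $\Phi^g(u)=\int e^{ixu}g(x)\,dx$. Assume that the noise is exponentially smooth: $\Phi^g(u)\neq 0$ for all $u\in\mathbb R$ and $|\Phi^g(u)|\sim\exp(-\gamma|u|^s)$ as $|u|\to\infty$ (the ratio tends to $1$), with $\gamma,s>0$. For $h>0$ let $K_n$ be the function with Fourier transform $\int e^{ixu}K_n(x)\,dx=\mathbf 1_{[|u|\le 1]}/\Phi^g(u/h)$, let $K_{n,h}(x)=h^{-1}K_n(x/h)$, and let $$d_n=\frac1{n(n-1)}\sum_{1\le k\ne j\le n}\int K_{n,h}(x-Y_k)K_{n,h}(x-Y_j)\,dx ,$$ an estimator of $d=d(f)=\int f^2$. For a class $\mathcal F$ of densities, an estimator $\tilde d_n$ *attains the rate* $\varphi_n$ over $\mathcal F$ if $\limsup_{n\to\infty}\sup_{f\in\mathcal F}\varphi_n^{-1}E_f|\tilde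 d_n-d(f)|\le C$ for some constant $0<C<\infty$; an attained rate $\varphi_n$ is *minimax* if moreover $\liminf_{n\to\infty}\inf_{\hat d_n}\sup_{f\in\mathcal F}\varphi_n^{-1}E_f|\hat d_n-d(f)|\ge c$ for some $c>0$, the infimum being over all estimators (measurable functions of $Y_1,\dots,Y_n$). Consider the following classes of square integrable probability densities, for $\beta,\alpha,r,L>0$: $$W(\beta,L)=\Big\{f\in\mathcal C^\beta:\int|\Phi(u)|^2|u|^{2\beta}du\le 2\pi L\Big\},\qquad S(\alpha,r,L)=\Big\{f\in\mathcal C^\infty:\int|\Phi(u)|^2e^{2\alpha|u|^r}du\le 2\pi L\Big\},$$ where $\mathcal C^\beta$ is the class of $\lfloor\beta\rfloor$ times continuously differentiable functions whose derivative of order $\lfloor\beta\rfloor$ is locally Hölder continuous of exponent $\beta-\lfloor\beta\rfloor$ (no further condition if $\beta$ is an integer). Say that Assumption (E) holds if $\Phi^g$ is continuously differentiable and there is $A\in\mathbb R$ with $|(\Phi^g)'(u)|\le O(1)|u|^{A}\exp(-\gamma|u|^s)$ for all large enough $|u|$. (1) For all $\beta,L>0$, the estimator $d_n$ with bandwidth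 $$h_*=\Big(\frac{\log n}{2\gamma}-\frac{2\beta+1}{2\gamma s}\log\frac{\log n}{2\gamma}\Big)^{-1/s}$$ attains the rate $\varphi_n=L\big(\frac{\log n}{2\gamma}\big)^{-2\beta/s}$ over $W(\beta,L)$; under Assumption (E) this rate is minimax. (2) Let $\alpha,r,L>0$ with $r<s$, or $r=s$ and $\alpha\le\gamma$. For all large $n$ the equation $$\frac{2\alpha}{h_*^r}+\frac{2\gamma}{h_*^s}=\log n-(\log\log n)^2$$ has a unique solution $h_*>0$, and the estimator $d_n$ with this bandwidth attains the rate $\varphi_n=L\exp(-2\alpha/h_*^r)$ over $S(\alpha,r,L)$; under Assumption (E) this rate is minimax when $r<s$. -/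

import Mathlib

open MeasureTheory Filter
open scoped Topology ENNReal NNReal ContDiff

noncomputable section

namespace Deconvolution

/-- `f` is a probability density on the real line. -/
structure IsDensity (f : ℝ → ℝ) : Prop where
  measurable : Measurable f
  nonneg : ∀ x, 0 ≤ f x
  integrable : Integrable f
  integral_eq_one : ∫ x, f x = 1

/-- The measure with Lebesgue density `f`. -/
def densityMeasure (f : ℝ → ℝ) : Measure ℝ :=
  volume.withDensity fun x => ENNReal.ofReal (f x)

/-- The characteristic function `u ↦ ∫ exp(i x u) f(x) dx`. -/
def cf (f : ℝ → ℝ) (u : ℝ) : ℂ :=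
  charFun (densityMeasure f) u

/-- The Hölder class of order `β`: `f` is `⌊β⌋` times continuously differentiable and its
derivative of order `⌊β⌋` is locally Hölder of exponent `β - ⌊β⌋` (for integer `β` the second
condition is automatic, and this is the usual class of `β` times continuously differentiable
functions). -/
def IsHolderClass (β : ℝ) (f : ℝ → ℝ) : Prop :=
  ContDiff ℝ ⌊β⌋₊ f ∧
    ∀ K : Set ℝ, IsCompact K →
      ∃ C : ℝ≥0, HolderOnWith C (β - ⌊β⌋₊).toNNReal (iteratedDeriv ⌊β⌋₊ f) K

/-- The Sobolev class `W(β, L)` of square integrable densities. -/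
def sobolevClass (β L : ℝ) : Set (ℝ → ℝ) :=
  {f | IsDensity f ∧ MemLp f 2 ∧ IsHolderClass β f ∧
    ∫⁻ u, ENNReal.ofReal (‖cf f u‖ ^ 2 * |u| ^ (2 * β)) ≤ ENNReal.ofReal (2 * Real.pi * L)}

/-- The class `S(α, r, L)` of supersmooth square integrable densities. -/
def supersmoothClass (α r L : ℝ) : Set (ℝ → ℝ) :=
  {f | IsDensity f ∧ MemLp f 2 ∧ ContDiff ℝ ∞ f ∧
    ∫⁻ u, ENNReal.ofReal (‖cf f u‖ ^ 2 * Real.exp (2 * α * |u| ^ r)) ≤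
      ENNReal.ofReal (2 * Real.pi * L)}

/-- Exponentially smooth noise: a density `g` with nowhere vanishing characteristic function,
whose modulus is asymptotically equivalent to `exp(-γ |u| ^ s)` as `|u| → ∞`. -/
structure IsExponentialNoise (g : ℝ → ℝ) (γ s : ℝ) : Prop where
  density : IsDensity g
  cf_ne_zero : ∀ u, cf g u ≠ 0
  cf_equiv : Asymptotics.IsEquivalent (cocompact ℝ)
    (fun u => ‖cf g u‖) (fun u => Real.exp (-γ * |u| ^ s))

/-- The regularity assumption on exponential noise under which lower bounds hold: the
characteristic function is continuously differentiable and its derivative is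
`O(|u| ^ A exp(-γ |u| ^ s))` for some real `A`. -/
def AssumptionE (g : ℝ → ℝ) (γ s : ℝ) : Prop :=
  ContDiff ℝ 1 (cf g) ∧
    ∃ A C M : ℝ, ∀ u : ℝ, M ≤ |u| →
      ‖deriv (cf g) u‖ ≤ C * (|u| ^ A * Real.exp (-γ * |u| ^ s))

/-- The joint law of the observations `Y_i = X_i + ε_i`, `i = 1, …, n`, where all the `X_i`
(with density `f`) and `ε_i` (with density `g`) are independent. -/
def sampleLaw (f g : ℝ → ℝ) (n : ℕ) : Measure (Fin n → ℝ) :=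
  Measure.pi fun _ => (densityMeasure f).conv (densityMeasure g)

/-- The quadratic functional `d = ∫ f²`. -/
def quadFunctional (f : ℝ → ℝ) : ℝ :=
  ∫ x, f x ^ 2

/-- The deconvolution kernel `K_n` with bandwidth `h`: the function whose Fourier transform
`∫ exp(i x u) K_n(x) dx` is `1_{|u| ≤ 1} / Φ^g(u / h)`, obtained by Fourier inversion. The
inversion integral is a real number, because `Φ^g(-u)` is the complex conjugate of `Φ^g(u)`. -/
def deconvKernel (g : ℝ → ℝ) (h x : ℝ) : ℝ :=
  ((2 * Real.pi : ℂ)⁻¹ *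
    ∫ u in (-1 : ℝ)..1, Complex.exp (-(x * u * Complex.I)) / cf g (u / h)).re

/-- The rescaled kernel `K_{n,h}(x) = K_n(x / h) / h`. -/
def scaledKernel (g : ℝ → ℝ) (h x : ℝ) : ℝ :=
  1 / h * deconvKernel g h (x / h)

/-- The estimator `d_n` of `∫ f²` with bandwidth `h`, a function of the observations `Y`. -/
def estimator (g : ℝ → ℝ) (h : ℝ) (n : ℕ) (Y : Fin n → ℝ) : ℝ :=
  1 / ((n : ℝ) * ((n : ℝ) - 1)) *
    ∑ k : Fin n, ∑ j : Fin n,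
      if k ≠ j then ∫ x, scaledKernel g h (x - Y k) * scaledKernel g h (x - Y j) else 0

/-- The normalized maximal risk `sup_{f ∈ F} φ⁻¹ E_f |T(Y_1, …, Y_n) - ∫ f²|` of an
estimator `T`. -/
def maxRisk (F : Set (ℝ → ℝ)) (g : ℝ → ℝ) (φ : ℝ) (n : ℕ) (T : (Fin n → ℝ) → ℝ) : ℝ≥0∞ :=
  ⨆ f ∈ F, ENNReal.ofReal φ⁻¹ *
    ∫⁻ Y, ENNReal.ofReal |T Y - quadFunctional f| ∂(sampleLaw f g n)

/-- The sequence of estimators `T` of `∫ f²` attains the rate `φ` over the class `F`. -/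
def AttainsRate (F : Set (ℝ → ℝ)) (g : ℝ → ℝ) (T : (n : ℕ) → (Fin n → ℝ) → ℝ)
    (φ : ℕ → ℝ) : Prop :=
  (∀ n, Measurable (T n)) ∧
    ∃ C : ℝ, 0 < C ∧
      limsup (fun n => maxRisk F g (φ n) n (T n)) atTop ≤ ENNReal.ofReal C

/-- The rate `φ` is minimax over the class `F`: it is attained, and no estimator is better
uniformly over the class. -/
def IsMinimaxRate (F : Set (ℝ → ℝ)) (g : ℝ → ℝ) (φ : ℕ → ℝ) : Prop :=
  (∃ T, AttainsRate F g T φ) ∧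
    ∃ c : ℝ, 0 < c ∧
      ENNReal.ofReal c ≤
        liminf (fun n => ⨅ (T : (Fin n → ℝ) → ℝ) (_ : Measurable T), maxRisk F g (φ n) n T) atTop

/-- The bandwidth for the Sobolev class. -/
def sobolevBandwidth (β γ s : ℝ) (n : ℕ) : ℝ :=
  (Real.log n / (2 * γ) -
    (2 * β + 1) / (2 * γ * s) * Real.log (Real.log n / (2 * γ))) ^ (-1 / s)

/-- The rate for the Sobolev class. -/
def sobolevRate (β L γ s : ℝ) (n : ℕ) : ℝ :=
  L * (Real.log n / (2 * γ)) ^ (-2 * β / s)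

/-- `h` is a positive solution of
`2α / h ^ r + 2γ / h ^ s = log n - (log log n)²`. -/
def SolvesBandwidthEq (α r γ s : ℝ) (n : ℕ) (h : ℝ) : Prop :=
  0 < h ∧ 2 * α / h ^ r + 2 * γ / h ^ s = Real.log n - Real.log (Real.log n) ^ 2

/-- The rate for the supersmooth class, in terms of the bandwidth `h`. -/
def supersmoothRate (α r L h : ℝ) : ℝ :=
  L * Real.exp (-2 * α / h ^ r)

end Deconvolution

end

open MeasureTheory Filter
open scoped Topology ENNReal NNReal ContDiff

noncomputable section

namespace Deconvolution

open scoped FourierTransform SchwartzMap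

/-! Upper bounds. Put S(u) = ∑ exp(iuY_k). By Plancherel the error of the estimator is (2π)⁻¹ times
an integral over frequencies: for |u| ≤ 1/h the integrand is (|S|² - n)/(n(n-1)) - |ΦΦ^g|², divided
by |Φ^g|², and beyond 1/h it is -|Φ|² (`estimator_sub_quadFunctional`). No variance of a U-statistic
is needed: the absolute value is taken under the integral, and at each frequency the mean absolute
deviation of the first numerator is at most 4|ΦΦ^g|/√n + 4/n (`integral_abs_centered_le`). If the
class bounds ∫|Φ|²ρ, the AM-GM inequality shares the 1/√n term between this budget and the noise,
and the risk is O(1/ρ(1/h) + h⁻¹ exp(2γ/h^s)/n), provided that exp(2γ|u|^s)/ρ(u) is maximal, up to a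
constant, at the cut-off u = 1/h (`attainsRate_of_weight`). For r = s this proviso is ensured by α ≤
γ. This crude bound suffices since the bandwidths make the stochastic term at most of the order of
1/ρ(1/h), which has the order of the rate.

Lower bounds. Two hypotheses are compared. The first, f₀, has tails of order x⁻² and a
characteristic function supported in [-w, w]; the second is f₁ = f₀(1 + a cos(Nx)), which adds two
bumps of height a/2 to the characteristic function, at ±N. For N ≥ 2w the bumps do not overlap the
centre, so ∫f₁² - ∫f₀² is exactly of order a²w (`quadFunctional_modulatedBase`). After convolution
with g the bumps are damped by exp(-γN^s). The density p₀ of an observation keeps a lower bound of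
order w/(1+x²) whatever g is, so the χ² divergence is controlled by ∫(1+x²)(p₁-p₀)², hence, on the
Fourier side, by the damped bumps and their increments; this is where Assumption (E) enters
(`lintegral_weighted_convDensity_sub_le`). If the divergence is at most 1/n, Le Cam's method
(`two_point_bound`) bounds the risk below by a multiple of a²w. Choosing a²w of order 1/ρ(N)
exhausts the budget of the class (`exists_liminf_lower_bound`).

It remains to find frequencies m at which n exp(-2γm^s) times any power of m is below ρ(m), while
1/ρ(m) still has the order of the rate. In the Sobolev case a constant multiple of the optimal
frequency is allowed. In the supersmooth case only m^r = h⁻ʳ + O(1) is; when r < s, this already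
increases m^s by a power of 1/h, which beats (log log n)² and every polynomial factor. -/

/-! ### Plancherel's theorem for integrable square integrable functions. -/

/-- Both sides give the same integrals against smooth compactly supported functions, because the
transform can be moved onto the test function in the distributional sense as well as in the L¹
sense. -/
theorem fourier_toLp_ae_eq {F : ℝ → ℂ} (h1 : Integrable F) (h2 : MemLp F 2) :
    (𝓕 (h2.toLp F) : Lp ℂ 2 (volume : Measure ℝ)) =ᵐ[volume] 𝓕 F := by
  have hcont : Continuous (𝓕 F) :=
    VectorFourier.fourierIntegral_continuous Real.continuous_fourierChar
      (by exact continuous_inner) h1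
  refine ae_eq_of_integral_contDiff_smul_eq ((Lp.memLp _).locallyIntegrable (by norm_num))
    hcont.locallyIntegrable fun φ φ_smooth φ_cpt => ?_
  have hs1 : HasCompactSupport (Complex.ofRealCLM ∘ φ) := φ_cpt.comp_left rfl
  have hs2 : ContDiff ℝ ∞ (Complex.ofRealCLM ∘ φ) := by fun_prop
  set ψ : 𝓢(ℝ, ℂ) := hs1.toSchwartzMap hs2 with hψ
  have hψc : ∀ x, ψ x = (φ x : ℂ) := fun x => by simp [hψ]
  have key := congrArg (fun T => T ψ) (Lp.fourier_toTemperedDistribution_eq (h2.toLp F))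
  simp only [TemperedDistribution.fourier_apply, Lp.toTemperedDistribution_apply] at key
  calc ∫ x, φ x • (𝓕 (h2.toLp F) : Lp ℂ 2 (volume : Measure ℝ)) x
      = ∫ x, ψ x • (𝓕 (h2.toLp F) : Lp ℂ 2 (volume : Measure ℝ)) x := by
        refine integral_congr_ae (Eventually.of_forall fun x => ?_)
        simp [hψc]
    _ = ∫ x, (𝓕 ψ) x • (h2.toLp F) x := key.symm
    _ = ∫ x, (𝓕 ψ) x • F x := by
        refine integral_congr_ae ?_
        filter_upwards [h2.coeFn_toLp] with x hx
        rw [hx]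
    _ = ∫ x, ψ x • (𝓕 F) x := by
        rw [SchwartzMap.fourier_coe]
        have h := VectorFourier.integral_fourierIntegral_smul_eq_flip (L := innerₗ ℝ)
          Real.continuous_fourierChar continuous_inner (ψ.integrable (μ := volume)) h1
        rw [flip_innerₗ] at h
        exact h
    _ = _ := by
        refine integral_congr_ae (Eventually.of_forall fun x => ?_)
        simp [hψc]

theorem memLp_fourier {F : ℝ → ℂ} (h1 : Integrable F) (h2 : MemLp F 2) :
    MemLp (𝓕 F) 2 :=
  (memLp_congr_ae (fourier_toLp_ae_eq h1 h2)).1 (Lp.memLp _)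

theorem integral_norm_fourier_sq {F : ℝ → ℂ} (h1 : Integrable F) (h2 : MemLp F 2) :
    ∫ u, ‖𝓕 F u‖ ^ 2 = ∫ x, ‖F x‖ ^ 2 := by
  have e : ∀ f : Lp ℂ 2 (volume : Measure ℝ), ∫ x, ‖f x‖ ^ 2 = ‖f‖ ^ 2 := by
    intro f
    have h := L2.inner_def (𝕜 := ℂ) f f
    have h' : (inner ℂ f f : ℂ) = ((‖f‖ ^ 2 : ℝ) : ℂ) := by
      rw [inner_self_eq_norm_sq_to_K]; norm_cast
    rw [h'] at h
    have h3 : ∫ a, inner ℂ (f a) (f a) = ((∫ a, ‖f a‖ ^ 2 : ℝ) : ℂ) := by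
      rw [← integral_complex_ofReal]
      refine integral_congr_ae (Eventually.of_forall fun x => ?_)
      simp only
      rw [inner_self_eq_norm_sq_to_K]; norm_cast
    rw [h3] at h
    exact_mod_cast h.symm
  have a1 : ∫ u, ‖𝓕 F u‖ ^ 2 = ∫ u, ‖(𝓕 (h2.toLp F) : Lp ℂ 2 (volume : Measure ℝ)) u‖ ^ 2 := by
    refine integral_congr_ae ?_
    filter_upwards [fourier_toLp_ae_eq h1 h2] with x hx
    rw [hx]
  have a2 : ∫ x, ‖F x‖ ^ 2 = ∫ x, ‖(h2.toLp F) x‖ ^ 2 := by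
    refine integral_congr_ae ?_
    filter_upwards [h2.coeFn_toLp] with x hx
    rw [hx]
  rw [a1, a2, e, e, Lp.norm_fourier_eq]

/-- The Fourier transform with the probabilistic normalization, `u ↦ ∫ exp(i x u) F(x) dx`. -/
def ft (F : ℝ → ℂ) (u : ℝ) : ℂ := ∫ x : ℝ, Complex.exp (x * u * Complex.I) * F x

theorem ft_eq_fourier (F : ℝ → ℂ) (u : ℝ) : ft F u = 𝓕 F (-(2 * Real.pi)⁻¹ * u) := by
  rw [ft, Real.fourier_real_eq_integral_exp_smul]
  refine integral_congr_ae (Eventually.of_forall fun x => ?_)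
  have : (Real.pi : ℂ) ≠ 0 := by exact_mod_cast Real.pi_ne_zero
  simp only [smul_eq_mul]
  congr 2
  push_cast
  field_simp

theorem continuous_ft {F : ℝ → ℂ} (h1 : Integrable F) : Continuous (ft F) := by
  have hcont : Continuous (𝓕 F) :=
    VectorFourier.fourierIntegral_continuous Real.continuous_fourierChar
      (by exact continuous_inner) h1
  have : ft F = fun u => 𝓕 F (-(2 * Real.pi)⁻¹ * u) := funext (ft_eq_fourier F)
  rw [this]
  fun_prop

theorem memLp_ft {F : ℝ → ℂ} (h1 : Integrable F) (h2 : MemLp F 2) : MemLp (ft F) 2 := by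
  rw [memLp_two_iff_integrable_sq_norm (continuous_ft h1).aestronglyMeasurable]
  have h := (memLp_two_iff_integrable_sq_norm (memLp_fourier h1 h2).aestronglyMeasurable).1
    (memLp_fourier h1 h2)
  have := h.comp_mul_left' (R := -(2 * Real.pi)⁻¹) (by
    simp [Real.pi_ne_zero])
  simpa only [ft_eq_fourier] using this

/-- **Plancherel's theorem**. -/
theorem integral_norm_ft_sq {F : ℝ → ℂ} (h1 : Integrable F) (h2 : MemLp F 2) :
    ∫ u, ‖ft F u‖ ^ 2 = 2 * Real.pi * ∫ x, ‖F x‖ ^ 2 := by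
  simp only [ft_eq_fourier]
  rw [Measure.integral_comp_mul_left (fun y => ‖𝓕 F y‖ ^ 2), integral_norm_fourier_sq h1 h2]
  simp [abs_of_pos Real.pi_pos]

theorem integrable_norm_ft_sq {F : ℝ → ℂ} (h1 : Integrable F) (h2 : MemLp F 2) :
    Integrable fun u => ‖ft F u‖ ^ 2 :=
  (memLp_two_iff_integrable_sq_norm (continuous_ft h1).aestronglyMeasurable).1 (memLp_ft h1 h2)

theorem lintegral_norm_ft_sq {F : ℝ → ℂ} (h1 : Integrable F) (h2 : MemLp F 2) :
    ∫⁻ u, ENNReal.ofReal (‖ft F u‖ ^ 2) = ENNReal.ofReal (2 * Real.pi * ∫ x, ‖F x‖ ^ 2) := by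
  rw [← integral_norm_ft_sq h1 h2, ofReal_integral_eq_lintegral_ofReal
    (integrable_norm_ft_sq h1 h2) (Eventually.of_forall fun u => by positivity)]

/-! ### Densities and their characteristic functions. -/

theorem integrable_ofReal {f : ℝ → ℝ} (hf : Integrable f) : Integrable fun x => (f x : ℂ) :=
  hf.ofReal

theorem memLp_ofReal {f : ℝ → ℝ} (hf : MemLp f 2) : MemLp (fun x => (f x : ℂ)) 2 :=
  hf.ofReal

theorem IsDensity.lintegral_eq_one {f : ℝ → ℝ} (hf : IsDensity f) :
    ∫⁻ x, ENNReal.ofReal (f x) = 1 := by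
  rw [← ofReal_integral_eq_lintegral_ofReal hf.integrable (Eventually.of_forall hf.nonneg),
    hf.integral_eq_one, ENNReal.ofReal_one]

theorem IsDensity.isProbabilityMeasure {f : ℝ → ℝ} (hf : IsDensity f) :
    IsProbabilityMeasure (densityMeasure f) :=
  ⟨by rw [densityMeasure, withDensity_apply _ MeasurableSet.univ, Measure.restrict_univ,
    hf.lintegral_eq_one]⟩

theorem integral_densityMeasure {E : Type*} [NormedAddCommGroup E] [NormedSpace ℝ E] {f : ℝ → ℝ}
    (hf : Measurable f) (hf0 : ∀ x, 0 ≤ f x) (G : ℝ → E) :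
    ∫ x, G x ∂(densityMeasure f) = ∫ x, f x • G x := by
  rw [densityMeasure, integral_withDensity_eq_integral_toReal_smul (by fun_prop)
    (Eventually.of_forall fun x => ENNReal.ofReal_lt_top)]
  refine integral_congr_ae (Eventually.of_forall fun x => ?_)
  simp only [ENNReal.toReal_ofReal (hf0 x)]

theorem cf_eq_ft {f : ℝ → ℝ} (hf : Measurable f) (hf0 : ∀ x, 0 ≤ f x) (u : ℝ) :
    cf f u = ft (fun x => (f x : ℂ)) u := by
  rw [cf, charFun_apply_real, integral_densityMeasure hf hf0, ft]
  refine integral_congr_ae (Eventually.of_forall fun x => ?_)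
  simp only [Complex.real_smul]
  rw [mul_comm, mul_comm (u : ℂ)]

theorem IsDensity.cf_eq_ft {f : ℝ → ℝ} (hf : IsDensity f) : cf f = ft (fun x => (f x : ℂ)) :=
  funext fun u => Deconvolution.cf_eq_ft hf.measurable hf.nonneg u

theorem IsDensity.continuous_cf {f : ℝ → ℝ} (hf : IsDensity f) : Continuous (cf f) := by
  rw [hf.cf_eq_ft]
  exact continuous_ft (integrable_ofReal hf.integrable)

theorem IsDensity.norm_cf_le_one {f : ℝ → ℝ} (hf : IsDensity f) (u : ℝ) : ‖cf f u‖ ≤ 1 := by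
  have := hf.isProbabilityMeasure
  exact norm_charFun_le_one u

theorem cf_neg (f : ℝ → ℝ) (u : ℝ) : cf f (-u) = (starRingEnd ℂ) (cf f u) := charFun_neg u

theorem IsDensity.integrable_norm_cf_sq {f : ℝ → ℝ} (hf : IsDensity f) (h2 : MemLp f 2) :
    Integrable fun u => ‖cf f u‖ ^ 2 := by
  rw [hf.cf_eq_ft]
  exact integrable_norm_ft_sq (integrable_ofReal hf.integrable) (memLp_ofReal h2)

theorem IsDensity.integral_norm_cf_sq {f : ℝ → ℝ} (hf : IsDensity f) (h2 : MemLp f 2) :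
    ∫ u, ‖cf f u‖ ^ 2 = 2 * Real.pi * quadFunctional f := by
  rw [hf.cf_eq_ft, integral_norm_ft_sq (integrable_ofReal hf.integrable) (memLp_ofReal h2)]
  simp [quadFunctional]

/-! ### The estimator in the frequency domain. -/

/-- The Fourier transform `1_{|u| ≤ M} / Φ^g(u)` of the rescaled deconvolution kernel. -/
def truncInv (g : ℝ → ℝ) (M : ℝ) : ℝ → ℂ :=
  Set.indicator (Set.Icc (-M) M) fun u => (cf g u)⁻¹

/-- The trigonometric sum `∑ exp(i u Y_k)`. -/
def trigSum {n : ℕ} (Y : Fin n → ℝ) (u : ℝ) : ℂ :=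
  ∑ k : Fin n, Complex.exp (u * Y k * Complex.I)

theorem ft_mul_exp (q : ℝ → ℂ) (x y : ℝ) :
    ft (fun u => Complex.exp (u * y * Complex.I) * q u) x = ft q (x + y) := by
  rw [ft, ft]
  refine integral_congr_ae (Eventually.of_forall fun u => ?_)
  simp only
  rw [← mul_assoc, ← Complex.exp_add]
  congr 2
  push_cast
  ring

theorem integrable_exp_mul {q : ℝ → ℂ} (hq : Integrable q) (y : ℝ) :
    Integrable fun u : ℝ => Complex.exp (u * y * Complex.I) * q u := by
  refine hq.bdd_mul (c := 1) (by fun_prop) (Eventually.of_forall fun u => ?_)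
  rw [← Complex.ofReal_mul, Complex.norm_exp_ofReal_mul_I]

theorem continuous_trigSum {n : ℕ} (Y : Fin n → ℝ) : Continuous (trigSum Y) := by
  unfold trigSum
  fun_prop

theorem norm_trigSum_le {n : ℕ} (Y : Fin n → ℝ) (u : ℝ) : ‖trigSum Y u‖ ≤ n := by
  refine (norm_sum_le _ _).trans ?_
  have : ∀ k : Fin n, ‖Complex.exp (u * Y k * Complex.I)‖ = 1 := fun k => by
    rw [← Complex.ofReal_mul, Complex.norm_exp_ofReal_mul_I]
  simp [this]

theorem memLp_two_of_bounded_of_integrable {F : ℝ → ℂ} (hF : Integrable F) {C : ℝ}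
    (hC : ∀ x, ‖F x‖ ≤ C) : MemLp F 2 := by
  rw [memLp_two_iff_integrable_sq_norm hF.aestronglyMeasurable]
  have := hF.norm.bdd_mul (c := C) (f := fun x => ‖F x‖) hF.norm.aestronglyMeasurable
    (Eventually.of_forall fun x => by simpa using hC x)
  simpa [sq] using this

theorem measurable_cf {g : ℝ → ℝ} (hg : IsDensity g) : Measurable (cf g) :=
  hg.continuous_cf.measurable

theorem exists_norm_inv_cf_le {g : ℝ → ℝ} (hg : IsDensity g) (h0 : ∀ u, cf g u ≠ 0) (M : ℝ) :
    ∃ C, ∀ u ∈ Set.Icc (-M) M, ‖(cf g u)⁻¹‖ ≤ C :=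
  isCompact_Icc.exists_bound_of_continuousOn (hg.continuous_cf.inv₀ h0).continuousOn

theorem exists_norm_truncInv_le {g : ℝ → ℝ} (hg : IsDensity g) (h0 : ∀ u, cf g u ≠ 0) (M : ℝ) :
    ∃ C, ∀ u, ‖truncInv g M u‖ ≤ C := by
  obtain ⟨C, hC⟩ := exists_norm_inv_cf_le hg h0 M
  refine ⟨max C 0, fun u => ?_⟩
  by_cases hu : u ∈ Set.Icc (-M) M
  · rw [truncInv, Set.indicator_of_mem hu]
    exact (hC u hu).trans (le_max_left _ _)
  · rw [truncInv, Set.indicator_of_notMem hu]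
    simp

theorem measurable_truncInv {g : ℝ → ℝ} (hg : IsDensity g) (M : ℝ) :
    Measurable (truncInv g M) :=
  (measurable_cf hg).inv.indicator measurableSet_Icc

theorem integrable_truncInv {g : ℝ → ℝ} (hg : IsDensity g) (h0 : ∀ u, cf g u ≠ 0) (M : ℝ) :
    Integrable (truncInv g M) := by
  rw [truncInv, integrable_indicator_iff measurableSet_Icc]
  exact (hg.continuous_cf.inv₀ h0).continuousOn.integrableOn_Icc

theorem truncInv_neg (g : ℝ → ℝ) (M u : ℝ) :
    truncInv g M (-u) = (starRingEnd ℂ) (truncInv g M u) := by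
  by_cases hu : u ∈ Set.Icc (-M) M
  · have hu' : -u ∈ Set.Icc (-M) M := ⟨neg_le_neg hu.2, neg_le.1 hu.1⟩
    rw [truncInv, Set.indicator_of_mem hu, Set.indicator_of_mem hu', cf_neg, map_inv₀]
  · have hu' : -u ∉ Set.Icc (-M) M := fun h =>
      hu ⟨by linarith [h.2], by linarith [h.1]⟩
    rw [truncInv, Set.indicator_of_notMem hu, Set.indicator_of_notMem hu', map_zero]

/-- The substitution u ↦ -u turns the integrand into its conjugate. -/
theorem im_ft_eq_zero {q : ℝ → ℂ} (hq : ∀ u, q (-u) = (starRingEnd ℂ) (q u)) (x : ℝ) :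
    ((ft q x).re : ℂ) = ft q x := by
  rw [← Complex.conj_eq_iff_re, ft, ← integral_conj,
    ← integral_neg_eq_self (fun u : ℝ => Complex.exp (u * x * Complex.I) * q u)]
  refine integral_congr_ae (Eventually.of_forall fun u => ?_)
  simp only [map_mul, hq, ← Complex.exp_conj, Complex.conj_ofReal, Complex.conj_I]
  push_cast
  ring_nf

/-- The substitution v = u/h moves the cut-off from 1 to 1/h and absorbs both rescalings; by
Hermitian symmetry the real part in the definition of the kernel discards nothing. -/
theorem ofReal_scaledKernel (g : ℝ → ℝ) {h : ℝ} (hh : 0 < h) (x : ℝ) :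
    (scaledKernel g h x : ℂ) = (2 * Real.pi : ℂ)⁻¹ * ft (truncInv g h⁻¹) (-x) := by
  have hI : ft (truncInv g h⁻¹) (-x)
      = ∫ v in (-h⁻¹)..h⁻¹, Complex.exp (-(x * v * Complex.I)) / cf g v := by
    rw [intervalIntegral.integral_of_le (by linarith [inv_pos.2 hh]),
      ← integral_Icc_eq_integral_Ioc, ← integral_indicator measurableSet_Icc, ft]
    refine integral_congr_ae (Eventually.of_forall fun v => ?_)
    simp only [truncInv, Set.indicator_apply]
    split_ifs
    · rw [div_eq_mul_inv]; congr 2; push_cast; ring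
    · simp
  have hS : ∫ u in (-1 : ℝ)..1, Complex.exp (-((x / h : ℝ) * u * Complex.I)) / cf g (u / h)
      = h * ft (truncInv g h⁻¹) (-x) := by
    have := intervalIntegral.integral_comp_div (a := -1) (b := 1)
      (fun v : ℝ => Complex.exp (-(x * v * Complex.I)) / cf g v) hh.ne'
    rw [hI]
    rw [show -1 / h = -h⁻¹ by ring, one_div, Complex.real_smul] at this
    rw [← this]
    refine intervalIntegral.integral_congr fun u _ => ?_
    congr 3
    push_cast
    ring
  have him : ((((2 * Real.pi : ℂ)⁻¹ * ft (truncInv g h⁻¹) (-x)).re : ℝ) : ℂ)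
      = (2 * Real.pi : ℂ)⁻¹ * ft (truncInv g h⁻¹) (-x) := by
    rw [← im_ft_eq_zero (truncInv_neg g h⁻¹) (-x)]
    norm_cast
  have hd : deconvKernel g h (x / h) = h * ((2 * Real.pi : ℂ)⁻¹ * ft (truncInv g h⁻¹) (-x)).re := by
    rw [deconvKernel, hS, mul_left_comm, Complex.re_ofReal_mul]
  rw [scaledKernel, hd, one_div, inv_mul_cancel_left₀ hh.ne']
  exact him

theorem scaledKernel_sum {g : ℝ → ℝ} (hg : IsDensity g) (h0 : ∀ u, cf g u ≠ 0) {h : ℝ}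
    (hh : 0 < h) {n : ℕ} (Y : Fin n → ℝ) (x : ℝ) :
    ((∑ k, scaledKernel g h (x - Y k) : ℝ) : ℂ)
      = (2 * Real.pi : ℂ)⁻¹ * ft (fun u => trigSum Y u * truncInv g h⁻¹ u) (-x) := by
  have : ft (fun u => trigSum Y u * truncInv g h⁻¹ u) (-x)
      = ∑ k, ft (truncInv g h⁻¹) (-(x - Y k)) := by
    have e : ∀ k, ft (truncInv g h⁻¹) (-(x - Y k))
        = ft (fun u => Complex.exp (u * Y k * Complex.I) * truncInv g h⁻¹ u) (-x) := fun k => by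
      rw [ft_mul_exp]; congr 1; ring
    rw [Finset.sum_congr rfl fun k _ => e k]
    simp only [ft]
    rw [← integral_finsetSum]
    · refine integral_congr_ae (Eventually.of_forall fun u => ?_)
      simp only [trigSum, Finset.sum_mul, Finset.mul_sum]
    · intro k _
      have := integrable_exp_mul (integrable_exp_mul (integrable_truncInv hg h0 h⁻¹) (Y k)) (-x)
      exact this
  rw [this, Finset.mul_sum]
  push_cast
  exact Finset.sum_congr rfl fun k _ => ofReal_scaledKernel g hh _

theorem memLp_trigSum_mul {g : ℝ → ℝ} (hg : IsDensity g) (h0 : ∀ u, cf g u ≠ 0) (M : ℝ)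
    {n : ℕ} (Y : Fin n → ℝ) :
    Integrable (fun u => trigSum Y u * truncInv g M u) ∧
      MemLp (fun u => trigSum Y u * truncInv g M u) 2 := by
  have hi : Integrable (fun u => trigSum Y u * truncInv g M u) :=
    (integrable_truncInv hg h0 M).bdd_mul (c := n) (continuous_trigSum Y).aestronglyMeasurable
      (Eventually.of_forall (norm_trigSum_le Y))
  obtain ⟨C, hC⟩ := exists_norm_truncInv_le hg h0 M
  refine ⟨hi, memLp_two_of_bounded_of_integrable hi (C := n * C) fun u => ?_⟩
  rw [norm_mul]
  exact mul_le_mul (norm_trigSum_le Y u) (hC u) (norm_nonneg _) (Nat.cast_nonneg _)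

theorem integrable_integral_sq_sum_scaledKernel {g : ℝ → ℝ} (hg : IsDensity g)
    (h0 : ∀ u, cf g u ≠ 0) {h : ℝ} (hh : 0 < h) {n : ℕ} (Y : Fin n → ℝ) :
    Integrable (fun x => (∑ k, scaledKernel g h (x - Y k)) ^ 2) ∧
    ∫ x, (∑ k, scaledKernel g h (x - Y k)) ^ 2
      = (2 * Real.pi)⁻¹ * ∫ u, ‖trigSum Y u‖ ^ 2 * ‖truncInv g h⁻¹ u‖ ^ 2 := by
  obtain ⟨h1, h2⟩ := memLp_trigSum_mul hg h0 h⁻¹ Y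
  have e : (fun x => (∑ k, scaledKernel g h (x - Y k)) ^ 2) = fun x => (2 * Real.pi)⁻¹ ^ 2 *
      ‖ft (fun u => trigSum Y u * truncInv g h⁻¹ u) (-x)‖ ^ 2 := by
    funext x
    have := congrArg (fun z => ‖z‖ ^ 2) (scaledKernel_sum hg h0 hh Y x)
    simp only [Complex.norm_real, norm_mul, mul_pow, Real.norm_eq_abs, sq_abs, norm_inv,
      Complex.norm_ofNat, abs_of_pos Real.pi_pos] at this
    rw [this]
  rw [e]
  refine ⟨((integrable_norm_ft_sq h1 h2).comp_neg).const_mul _, ?_⟩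
  rw [integral_const_mul, integral_neg_eq_self
    (fun x => ‖ft (fun u => trigSum Y u * truncInv g h⁻¹ u) x‖ ^ 2), integral_norm_ft_sq h1 h2]
  simp only [norm_mul, mul_pow]
  field_simp

theorem integrable_integral_sq_scaledKernel {g : ℝ → ℝ} (hg : IsDensity g)
    (h0 : ∀ u, cf g u ≠ 0) {h : ℝ} (hh : 0 < h) (y : ℝ) :
    Integrable (fun x => scaledKernel g h (x - y) ^ 2) ∧
    ∫ x, scaledKernel g h (x - y) ^ 2 = (2 * Real.pi)⁻¹ * ∫ u, ‖truncInv g h⁻¹ u‖ ^ 2 := by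
  have := integrable_integral_sq_sum_scaledKernel hg h0 hh (n := 1) (fun _ => y)
  have e : ∀ u, ‖trigSum (n := 1) (fun _ => y) u‖ = 1 := fun u => by
    simp only [trigSum, Finset.univ_unique, Finset.sum_singleton]
    rw [← Complex.ofReal_mul, Complex.norm_exp_ofReal_mul_I]
  simpa [e] using this

theorem measurable_deconvKernel {g : ℝ → ℝ} (hg : IsDensity g) (h : ℝ) :
    Measurable (deconvKernel g h) := by
  have hm := measurable_cf hg
  have : Measurable fun x : ℝ =>
      ∫ u in (-1 : ℝ)..1, Complex.exp (-(x * u * Complex.I)) / cf g (u / h) := by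
    simp only [intervalIntegral.integral_of_le (show (-1 : ℝ) ≤ 1 by norm_num)]
    refine StronglyMeasurable.measurable ?_
    refine StronglyMeasurable.integral_prod_right
      (f := fun x u : ℝ => Complex.exp (-(x * u * Complex.I)) / cf g (u / h)) ?_
    refine Measurable.stronglyMeasurable ?_
    unfold Function.uncurry
    fun_prop
  unfold deconvKernel
  fun_prop

theorem measurable_scaledKernel {g : ℝ → ℝ} (hg : IsDensity g) (h : ℝ) :
    Measurable (scaledKernel g h) := by
  have := measurable_deconvKernel hg h
  unfold scaledKernel
  fun_prop

theorem measurable_estimator {g : ℝ → ℝ} (hg : IsDensity g) (h : ℝ) (n : ℕ) :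
    Measurable (estimator g h n) := by
  have hm := measurable_scaledKernel hg h
  unfold estimator
  refine Measurable.const_mul (Finset.measurable_fun_sum _ fun k _ =>
    Finset.measurable_fun_sum _ fun j _ => ?_) _
  split_ifs
  · refine StronglyMeasurable.measurable ?_
    refine StronglyMeasurable.integral_prod_right (f := fun (Y : Fin n → ℝ) (x : ℝ) =>
      scaledKernel g h (x - Y k) * scaledKernel g h (x - Y j)) ?_
    refine Measurable.stronglyMeasurable ?_
    unfold Function.uncurry
    fun_prop
  · exact measurable_const

/-- The sum over k ≠ j is the square of the full sum minus the diagonal. Plancherel applies to the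
full sum at once, and each diagonal term contributes the same integral since translation changes
only the phase of the transform. -/
theorem estimator_eq {g : ℝ → ℝ} (hg : IsDensity g) (h0 : ∀ u, cf g u ≠ 0) {h : ℝ}
    (hh : 0 < h) {n : ℕ} (Y : Fin n → ℝ) :
    estimator g h n Y = 1 / ((n : ℝ) * ((n : ℝ) - 1)) * ((2 * Real.pi)⁻¹ *
      ∫ u, (‖trigSum Y u‖ ^ 2 - n) * ‖truncInv g h⁻¹ u‖ ^ 2) := by
  have hK2 : ∀ k, MemLp (fun x => scaledKernel g h (x - Y k)) 2 := fun k =>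
    (memLp_two_iff_integrable_sq (by
      have := measurable_scaledKernel hg h
      exact Measurable.aestronglyMeasurable (by fun_prop))).2
      (integrable_integral_sq_scaledKernel hg h0 hh (Y k)).1
  have hprod : ∀ k j, Integrable fun x => scaledKernel g h (x - Y k) * scaledKernel g h (x - Y j) :=
    fun k j => (hK2 k).integrable_mul (hK2 j)
  have hsum : ∑ k : Fin n, ∑ j : Fin n,
      (if k ≠ j then ∫ x, scaledKernel g h (x - Y k) * scaledKernel g h (x - Y j) else 0)
      = (∫ x, (∑ k, scaledKernel g h (x - Y k)) ^ 2)
        - ∑ k, ∫ x, scaledKernel g h (x - Y k) ^ 2 := by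
    have e1 : ∫ x, (∑ k, scaledKernel g h (x - Y k)) ^ 2
        = ∑ k, ∑ j, ∫ x, scaledKernel g h (x - Y k) * scaledKernel g h (x - Y j) := by
      simp only [sq, Finset.sum_mul_sum]
      rw [integral_finsetSum _ fun k _ => integrable_finsetSum _ fun j _ => hprod k j]
      exact Finset.sum_congr rfl fun k _ => integral_finsetSum _ fun j _ => hprod k j
    rw [e1, ← Finset.sum_sub_distrib]
    refine Finset.sum_congr rfl fun k _ => ?_
    rw [eq_sub_iff_add_eq, ← Finset.sum_erase_add _ _ (Finset.mem_univ k),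
      ← Finset.sum_erase_add Finset.univ (fun j =>
        ∫ x, scaledKernel g h (x - Y k) * scaledKernel g h (x - Y j)) (Finset.mem_univ k)]
    simp only [ne_eq, not_true_eq_false, if_false, add_zero, sq]
    congr 1
    refine Finset.sum_congr rfl fun j hj => ?_
    rw [if_pos (Finset.ne_of_mem_erase hj).symm]
  have hi1 : Integrable fun u => ‖trigSum Y u‖ ^ 2 * ‖truncInv g h⁻¹ u‖ ^ 2 := by
    obtain ⟨h1, h2⟩ := memLp_trigSum_mul hg h0 h⁻¹ Y
    simpa only [norm_mul, mul_pow] using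
      (memLp_two_iff_integrable_sq_norm h1.aestronglyMeasurable).1 h2
  have hi2 : Integrable fun u => ‖truncInv g h⁻¹ u‖ ^ 2 := by
    obtain ⟨C, hC⟩ := exists_norm_truncInv_le hg h0 h⁻¹
    have := integrable_truncInv hg h0 h⁻¹
    exact (memLp_two_iff_integrable_sq_norm this.aestronglyMeasurable).1
      (memLp_two_of_bounded_of_integrable this hC)
  rw [estimator, hsum, (integrable_integral_sq_sum_scaledKernel hg h0 hh Y).2]
  simp only [(integrable_integral_sq_scaledKernel hg h0 hh _).2, sub_mul]
  rw [integral_sub hi1 (hi2.const_mul _), integral_const_mul]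
  simp only [Finset.sum_const, Finset.card_univ, Fintype.card_fin, nsmul_eq_mul]
  ring

/-! ### Deviations of the empirical characteristic function. -/

open ProbabilityTheory

theorem trigSum_eq {n : ℕ} (Y : Fin n → ℝ) (u : ℝ) :
    trigSum Y u = (∑ k, Real.cos (u * Y k) : ℝ) + (∑ k, Real.sin (u * Y k) : ℝ) * Complex.I := by
  simp only [trigSum]
  push_cast
  rw [Finset.sum_mul, ← Finset.sum_add_distrib]
  refine Finset.sum_congr rfl fun k _ => ?_
  rw [Complex.exp_mul_I]

theorem charFun_eq_cos_add_sin (μ : Measure ℝ) [IsProbabilityMeasure μ] (u : ℝ) :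
    charFun μ u = (∫ y, Real.cos (u * y) ∂μ : ℝ) + (∫ y, Real.sin (u * y) ∂μ : ℝ) * Complex.I := by
  rw [charFun_apply_real, ← integral_complex_ofReal, ← integral_complex_ofReal,
    ← integral_mul_const, ← integral_add]
  · refine integral_congr_ae (Eventually.of_forall fun y => ?_)
    simp only
    rw [Complex.exp_mul_I]
    push_cast
    ring
  · refine Integrable.of_bound (C := 1) (by fun_prop) (Eventually.of_forall fun y => ?_)
    simpa [-Complex.ofReal_cos] using Real.abs_cos_le_one _
  · refine Integrable.mul_const (Integrable.of_bound (C := 1) (by fun_prop)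
      (Eventually.of_forall fun y => ?_)) _
    simpa [-Complex.ofReal_sin] using Real.abs_sin_le_one _

theorem integral_sq_sum_sub_le (μ : Measure ℝ) [IsProbabilityMeasure μ] {n : ℕ} {c : ℝ → ℝ}
    (hc : Measurable c) (hc1 : ∀ y, |c y| ≤ 1) :
    ∫ Y, (∑ k, c (Y k) - n * ∫ y, c y ∂μ) ^ 2 ∂(Measure.pi fun _ : Fin n => μ)
      ≤ n * ∫ y, c y ^ 2 ∂μ := by
  have hm : ∀ _ : Fin n, MemLp c 2 μ := fun _ => MemLp.of_bound hc.aestronglyMeasurable 1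
    (Eventually.of_forall fun y => by simpa using hc1 y)
  have hE : ∫ Y, ∑ k, c (Y k) ∂(Measure.pi fun _ : Fin n => μ) = n * ∫ y, c y ∂μ := by
    rw [integral_finsetSum]
    · have : ∀ k : Fin n, ∫ Y, c (Y k) ∂(Measure.pi fun _ : Fin n => μ) = ∫ y, c y ∂μ :=
        fun k => integral_comp_eval (μ := fun _ : Fin n => μ) hc.aestronglyMeasurable
      simp [this]
    · intro k _
      exact Integrable.of_bound (C := 1)
        (hc.comp (measurable_pi_apply k)).aestronglyMeasurable (Eventually.of_forall fun Y => by
        simpa using hc1 (Y k))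
  have hv := variance_sum_pi (μ := fun _ : Fin n => μ) hm
  rw [variance_eq_integral (by fun_prop)] at hv
  simp only [Finset.sum_apply, hE] at hv
  rw [hv]
  simp only [Finset.sum_const, Finset.card_univ, Fintype.card_fin, nsmul_eq_mul]
  exact mul_le_mul_of_nonneg_left (variance_le_expectation_sq hc.aestronglyMeasurable)
    (Nat.cast_nonneg _)

/-- Real and imaginary parts are centred sums of n independent terms, with variances at most n E
cos² and n E sin², and cos² + sin² = 1. -/
theorem integral_norm_trigSum_sub_sq_le (μ : Measure ℝ) [IsProbabilityMeasure μ] {n : ℕ} (u : ℝ) :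
    ∫ Y, ‖trigSum Y u - n * charFun μ u‖ ^ 2 ∂(Measure.pi fun _ : Fin n => μ) ≤ n := by
  have hn : ∀ Y : Fin n → ℝ, ‖trigSum Y u - n * charFun μ u‖ ^ 2
      = (∑ k, Real.cos (u * Y k) - n * ∫ y, Real.cos (u * y) ∂μ) ^ 2
        + (∑ k, Real.sin (u * Y k) - n * ∫ y, Real.sin (u * y) ∂μ) ^ 2 := fun Y => by
    rw [trigSum_eq, charFun_eq_cos_add_sin, ← Complex.normSq_eq_norm_sq, ← Complex.normSq_add_mul_I]
    congr 1
    push_cast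
    ring
  have hint : ∀ c : ℝ → ℝ, Measurable c → (∀ y, |c y| ≤ 1) → Integrable (fun Y : Fin n → ℝ =>
      (∑ k, c (Y k) - n * ∫ y, c y ∂μ) ^ 2) (Measure.pi fun _ : Fin n => μ) := fun c hc hc1 => by
    refine Integrable.of_bound (C := (n + |n * ∫ y, c y ∂μ|) ^ 2)
      (Measurable.aestronglyMeasurable (by fun_prop)) (Eventually.of_forall fun Y => ?_)
    rw [norm_pow, Real.norm_eq_abs]
    gcongr
    refine (abs_sub _ _).trans (add_le_add_left ?_ _)
    refine (Finset.abs_sum_le_sum_abs _ _).trans ?_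
    calc ∑ k, |c (Y k)| ≤ ∑ k : Fin n, (1 : ℝ) := Finset.sum_le_sum fun k _ => hc1 _
      _ = n := by simp
  have hcos : Measurable fun y => Real.cos (u * y) := by fun_prop
  have hsin : Measurable fun y => Real.sin (u * y) := by fun_prop
  have hcos1 : ∀ y, |Real.cos (u * y)| ≤ 1 := fun y => Real.abs_cos_le_one _
  have hsin1 : ∀ y, |Real.sin (u * y)| ≤ 1 := fun y => Real.abs_sin_le_one _
  simp only [hn]
  rw [integral_add (hint _ hcos hcos1) (hint _ hsin hsin1)]
  refine (add_le_add (integral_sq_sum_sub_le μ hcos hcos1)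
    (integral_sq_sum_sub_le μ hsin hsin1)).trans ?_
  rw [← mul_add, ← integral_add]
  · simp
  · refine Integrable.of_bound (C := 1) (by fun_prop) (Eventually.of_forall fun y => ?_)
    rw [norm_pow]
    exact pow_le_one₀ (norm_nonneg _) (hcos1 y)
  · refine Integrable.of_bound (C := 1) (by fun_prop) (Eventually.of_forall fun y => ?_)
    rw [norm_pow]
    exact pow_le_one₀ (norm_nonneg _) (hsin1 y)

/-- Factor |S|² - n²|Φ|² as a difference of squares: one factor is at most X = |S - nΦ|, the other
at most X + 2n|Φ|. Replacing n(n-1) by n² and removing the diagonal cost the 2/n; n ≥ 2 gives n(n-1)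
≥ n²/2. -/
theorem abs_centered_norm_sq_le {n : ℝ} (hn : 2 ≤ n) {S Φ : ℂ} (hΦ : ‖Φ‖ ≤ 1) :
    |(‖S‖ ^ 2 - n) / (n * (n - 1)) - ‖Φ‖ ^ 2|
      ≤ 4 * ‖Φ‖ * (‖S - n * Φ‖ / n) + 2 * (‖S - n * Φ‖ ^ 2 / n ^ 2) + 2 / n := by
  have hn0 : 0 < n := by linarith
  have hn1 : 0 < n - 1 := by linarith
  set X := ‖S - n * Φ‖ with hX
  have hX0 : 0 ≤ X := norm_nonneg _
  have hΦ0 : 0 ≤ ‖Φ‖ := norm_nonneg _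
  have hnΦ : ‖(n : ℂ) * Φ‖ = n * ‖Φ‖ := by rw [norm_mul, Complex.norm_real, Real.norm_of_nonneg hn0.le]
  have hd : |‖S‖ - n * ‖Φ‖| ≤ X := by rw [← hnΦ]; exact abs_norm_sub_norm_le _ _
  obtain ⟨hd1, hd2⟩ := abs_le.1 hd
  have hS0 : 0 ≤ ‖S‖ := norm_nonneg _
  have hsq : |‖S‖ ^ 2 - n ^ 2 * ‖Φ‖ ^ 2| ≤ 2 * n * ‖Φ‖ * X + X ^ 2 := by
    have : ‖S‖ ^ 2 - n ^ 2 * ‖Φ‖ ^ 2 = (‖S‖ - n * ‖Φ‖) * (‖S‖ + n * ‖Φ‖) := by ring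
    have hp : 0 ≤ ‖S‖ + n * ‖Φ‖ := by positivity
    rw [this, abs_mul, abs_of_nonneg hp]
    calc |‖S‖ - n * ‖Φ‖| * (‖S‖ + n * ‖Φ‖) ≤ X * (X + 2 * (n * ‖Φ‖)) :=
          mul_le_mul hd (by linarith) hp hX0
      _ = _ := by ring
  have e : (‖S‖ ^ 2 - n) / (n * (n - 1)) - ‖Φ‖ ^ 2
      = (‖S‖ ^ 2 - n ^ 2 * ‖Φ‖ ^ 2) / (n * (n - 1)) + (‖Φ‖ ^ 2 - 1) / (n - 1) := by
    field_simp
    ring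
  have hle : n ^ 2 / 2 ≤ n * (n - 1) := by nlinarith
  have hle' : n / 2 ≤ n - 1 := by linarith
  have hΦsq : ‖Φ‖ ^ 2 ≤ 1 := pow_le_one₀ hΦ0 hΦ
  rw [e]
  refine (abs_add_le _ _).trans ?_
  refine add_le_add ?_ ?_
  · rw [abs_div, abs_of_pos (show 0 < n * (n - 1) by positivity)]
    calc |‖S‖ ^ 2 - n ^ 2 * ‖Φ‖ ^ 2| / (n * (n - 1))
        ≤ (2 * n * ‖Φ‖ * X + X ^ 2) / (n ^ 2 / 2) := by gcongr
      _ = _ := by field_simp; ring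
  · rw [abs_div, abs_of_pos hn1]
    calc |‖Φ‖ ^ 2 - 1| / (n - 1) ≤ 1 / (n / 2) := by
          gcongr
          rw [abs_le]
          constructor <;> nlinarith [sq_nonneg ‖Φ‖]
      _ = 2 / n := by field_simp

theorem integral_abs_centered_le (μ : Measure ℝ) [IsProbabilityMeasure μ] {n : ℕ} (hn : 2 ≤ n)
    (u : ℝ) :
    ∫⁻ Y, ENNReal.ofReal |(‖trigSum Y u‖ ^ 2 - n) / ((n : ℝ) * (n - 1)) - ‖charFun μ u‖ ^ 2|
        ∂(Measure.pi fun _ : Fin n => μ)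
      ≤ ENNReal.ofReal (4 * ‖charFun μ u‖ / √n + 4 / n) := by
  set P := Measure.pi fun _ : Fin n => μ with hP
  set X : (Fin n → ℝ) → ℝ := fun Y => ‖trigSum Y u - n * charFun μ u‖ with hX
  have hn2 : (2 : ℝ) ≤ n := by exact_mod_cast hn
  have hn0 : (0 : ℝ) < n := by linarith
  have hcont : Continuous X := by
    simp only [hX, trigSum]
    fun_prop
  have hmem : MemLp X 2 P := MemLp.of_bound hcont.aestronglyMeasurable (n + n * 1)
    (Eventually.of_forall fun Y => by
      simp only [hX, norm_norm]
      refine (norm_sub_le _ _).trans (add_le_add (norm_trigSum_le Y u) ?_)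
      rw [norm_mul, Complex.norm_natCast]
      gcongr
      exact norm_charFun_le_one u)
  have hXint : Integrable X P := hmem.integrable (by norm_num)
  have hX2int : Integrable (fun Y => X Y ^ 2) P := hmem.integrable_sq
  have hX2 : ∫ Y, X Y ^ 2 ∂P ≤ n := integral_norm_trigSum_sub_sq_le μ u
  -- Nonnegativity of the variance of X gives (E X)² ≤ E X² ≤ n.
  have hX1 : ∫ Y, X Y ∂P ≤ √n := by
    refine Real.le_sqrt_of_sq_le (le_trans ?_ hX2)
    have h1 := variance_nonneg X P
    rw [variance_eq_sub hmem] at h1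
    have : ∫ Y, X Y ^ 2 ∂P = P[X ^ 2] := rfl
    linarith
  have hb : ∀ Y : Fin n → ℝ,
      |(‖trigSum Y u‖ ^ 2 - n) / ((n : ℝ) * (n - 1)) - ‖charFun μ u‖ ^ 2|
        ≤ 4 * ‖charFun μ u‖ * (X Y / n) + 2 * (X Y ^ 2 / n ^ 2) + 2 / n := fun Y => by
    have := abs_centered_norm_sq_le hn2 (S := trigSum Y u) (norm_charFun_le_one (μ := μ) u)
    simpa only [Complex.ofReal_natCast] using this
  have i1 : Integrable (fun Y => 4 * ‖charFun μ u‖ * (X Y / n)) P := (hXint.div_const _).const_mul _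
  have i2 : Integrable (fun Y => 2 * (X Y ^ 2 / (n : ℝ) ^ 2)) P := (hX2int.div_const _).const_mul _
  have i3 : Integrable (fun _ : Fin n → ℝ => 2 / (n : ℝ)) P := integrable_const _
  have i12 : Integrable (fun Y => 4 * ‖charFun μ u‖ * (X Y / n) + 2 * (X Y ^ 2 / (n : ℝ) ^ 2)) P :=
    i1.add i2
  have i123 : Integrable (fun Y =>
      4 * ‖charFun μ u‖ * (X Y / n) + 2 * (X Y ^ 2 / (n : ℝ) ^ 2) + 2 / n) P := i12.add i3
  calc _ ≤ ∫⁻ Y, ENNReal.ofReal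
        (4 * ‖charFun μ u‖ * (X Y / n) + 2 * (X Y ^ 2 / n ^ 2) + 2 / n) ∂P :=
        lintegral_mono fun Y => ENNReal.ofReal_le_ofReal (hb Y)
    _ = ENNReal.ofReal (∫ Y, (4 * ‖charFun μ u‖ * (X Y / n) + 2 * (X Y ^ 2 / n ^ 2) + 2 / n) ∂P) := by
        rw [ofReal_integral_eq_lintegral_ofReal i123
          (Eventually.of_forall fun Y => (abs_nonneg _).trans (hb Y))]
    _ ≤ _ := by
        refine ENNReal.ofReal_le_ofReal ?_
        rw [integral_add i12 i3, integral_add i1 i2, integral_const_mul, integral_const_mul,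
          integral_div, integral_div, integral_const]
        simp only [probReal_univ, one_smul]
        have hs : √(n : ℝ) / n = 1 / √n := Real.sqrt_div_self'
        have t1 : 4 * ‖charFun μ u‖ * ((∫ Y, X Y ∂P) / n) ≤ 4 * ‖charFun μ u‖ / √n := by
          calc _ ≤ 4 * ‖charFun μ u‖ * (√n / n) := by gcongr
            _ = _ := by rw [hs]; ring
        have t2 : 2 * ((∫ Y, X Y ^ 2 ∂P) / (n : ℝ) ^ 2) ≤ 2 / n := by
          calc _ ≤ 2 * ((n : ℝ) / n ^ 2) := by gcongr
            _ = _ := by field_simp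
        have : 4 / (n : ℝ) = 2 / n + 2 / n := by ring
        linarith

/-! ### Risk bound over a class defined by a weight. -/

theorem integrable_norm_truncInv_sq {g : ℝ → ℝ} (hg : IsDensity g) (h0 : ∀ u, cf g u ≠ 0) (M : ℝ) :
    Integrable fun u => ‖truncInv g M u‖ ^ 2 := by
  obtain ⟨C, hC⟩ := exists_norm_truncInv_le hg h0 M
  have := integrable_truncInv hg h0 M
  exact (memLp_two_iff_integrable_sq_norm this.aestronglyMeasurable).1
    (memLp_two_of_bounded_of_integrable this hC)

theorem estimator_sub_quadFunctional {f g : ℝ → ℝ} (hf : IsDensity f) (hf2 : MemLp f 2)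
    (hg : IsDensity g) (h0 : ∀ u, cf g u ≠ 0) {h : ℝ} (hh : 0 < h) {n : ℕ} (Y : Fin n → ℝ) :
    estimator g h n Y - quadFunctional f = (2 * Real.pi)⁻¹ *
      ∫ u, (((‖trigSum Y u‖ ^ 2 - n) / ((n : ℝ) * (n - 1)) - ‖cf f u * cf g u‖ ^ 2)
        * ‖truncInv g h⁻¹ u‖ ^ 2 - (Set.Icc (-h⁻¹) h⁻¹)ᶜ.indicator (fun u => ‖cf f u‖ ^ 2) u) := by
  have hd : quadFunctional f = (2 * Real.pi)⁻¹ * ∫ u, ‖cf f u‖ ^ 2 := by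
    rw [hf.integral_norm_cf_sq hf2, inv_mul_cancel_left₀ (by positivity)]
  have hi : Integrable fun u => (‖trigSum Y u‖ ^ 2 - n) * ‖truncInv g h⁻¹ u‖ ^ 2 := by
    have hc := continuous_trigSum Y
    refine (integrable_norm_truncInv_sq hg h0 h⁻¹).bdd_mul (c := (n : ℝ) ^ 2 + n)
      (Continuous.aestronglyMeasurable (by fun_prop)) (Eventually.of_forall fun u => ?_)
    rw [Real.norm_eq_abs]
    refine (abs_sub _ _).trans ?_
    rw [abs_of_nonneg (by positivity), abs_of_nonneg (Nat.cast_nonneg n)]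
    gcongr
    exact norm_trigSum_le Y u
  rw [estimator_eq hg h0 hh, hd, mul_left_comm, ← mul_sub, ← integral_const_mul,
    ← integral_sub (hi.const_mul _) (hf.integrable_norm_cf_sq hf2)]
  congr 1
  refine integral_congr_ae (Eventually.of_forall fun u => ?_)
  simp only
  by_cases hu : u ∈ Set.Icc (-h⁻¹) h⁻¹
  · rw [Set.indicator_of_notMem (by simpa using hu), truncInv, Set.indicator_of_mem hu, norm_mul,
      norm_inv]
    have : ‖cf g u‖ ≠ 0 := norm_ne_zero_iff.2 (h0 u)
    field_simp
    ring
  · rw [Set.indicator_of_mem (by simpa using hu), truncInv, Set.indicator_of_notMem hu]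
    simp

/-- Here a = |Φ|, c = |Φ^g|, b = 1/c, r = ρ(u) and W = ρ(1/h). After b²c = b, the AM-GM inequality
with ratio r/W splits ab/√n into a²r/W, which integrates to the budget of the class over W, and
b²W/(rn), at most E/n. -/
theorem weighted_pointwise_bound {a b c r W E n : ℝ} (hn : 0 < n) (hbc : b * c = 1) (hr : 0 < r)
    (hW : 0 < W) (h1 : b ^ 2 ≤ E) (h2 : b ^ 2 * W ≤ E * r) :
    b ^ 2 * (4 * (a * c) / √n + 4 / n) ≤ 2 / W * (a ^ 2 * r) + 6 * E / n := by
  have e1 : b ^ 2 * (4 * (a * c) / √n + 4 / n) = 4 * (a * (b / √n)) + 4 * b ^ 2 / n := by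
    calc _ = 4 * a * b * (b * c) / √n + 4 * b ^ 2 / n := by ring
      _ = _ := by rw [hbc]; ring
  have hsq : (b / √n) ^ 2 = b ^ 2 / n := by rw [div_pow, Real.sq_sqrt hn.le]
  have amgm : 4 * (a * (b / √n)) ≤ 2 * (a ^ 2 * (r / W) + b ^ 2 / n * (W / r)) := by
    have hr : 0 < r / W := by positivity
    have h3 : 0 ≤ (a * (r / W) - b / √n) ^ 2 / (r / W) := by positivity
    have h4 : (a * (r / W) - b / √n) ^ 2 / (r / W)
        = a ^ 2 * (r / W) + b ^ 2 / n * (W / r) - 2 * (a * (b / √n)) := by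
      rw [← hsq]
      field_simp
      ring
    linarith
  have t1 : b ^ 2 / n * (W / r) ≤ E / n := by
    rw [div_mul_div_comm, div_le_div_iff₀ (by positivity) hn]
    nlinarith
  have t2 : 4 * b ^ 2 / n ≤ 4 * E / n := by gcongr
  rw [e1]
  calc _ ≤ 2 * (a ^ 2 * (r / W) + E / n) + 4 * E / n := by linarith
    _ = _ := by ring

/-- Taking absolute values under the frequency integral and exchanging it with the expectation
reduces the claim to a bound at each u. Beyond the cut-off, the bias |Φ|² is at most |Φ|²ρ/W. -/
theorem lintegral_risk_le {f g : ℝ → ℝ} (hf : IsDensity f) (hf2 : MemLp f 2)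
    (hg : IsDensity g) (h0 : ∀ u, cf g u ≠ 0) {h : ℝ} (hh : 0 < h) {n : ℕ} (hn : 2 ≤ n)
    {ρ : ℝ → ℝ} {A W E : ℝ} (hρ : ∀ u, 0 < ρ u) (hW : 0 < W) (hA0 : 0 ≤ A) (hE : 0 ≤ E)
    (hA : ∫⁻ u, ENNReal.ofReal (‖cf f u‖ ^ 2 * ρ u) ≤ ENNReal.ofReal A)
    (hWρ : ∀ u, h⁻¹ < |u| → W ≤ ρ u)
    (hE1 : ∀ u, |u| ≤ h⁻¹ → ‖(cf g u)⁻¹‖ ^ 2 ≤ E)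
    (hE2 : ∀ u, |u| ≤ h⁻¹ → ‖(cf g u)⁻¹‖ ^ 2 * W ≤ E * ρ u) :
    ∫⁻ Y, ENNReal.ofReal |estimator g h n Y - quadFunctional f| ∂(sampleLaw f g n)
      ≤ ENNReal.ofReal (2 * A / W + 12 * h⁻¹ * E / n) := by
  have := hf.isProbabilityMeasure
  have := hg.isProbabilityMeasure
  have hn0 : (0 : ℝ) < n := by positivity
  set μ := (densityMeasure f).conv (densityMeasure g) with hμ
  have hcf : ∀ u, charFun μ u = cf f u * cf g u := fun u => charFun_conv u
  set q := truncInv g h⁻¹ with hq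
  set D : (Fin n → ℝ) → ℝ → ℝ := fun Y u =>
    |(‖trigSum Y u‖ ^ 2 - n) / ((n : ℝ) * (n - 1)) - ‖charFun μ u‖ ^ 2| with hD
  set B : ℝ → ℝ := (Set.Icc (-h⁻¹) h⁻¹)ᶜ.indicator fun u => ‖cf f u‖ ^ 2 with hB
  have hB0 : ∀ u, 0 ≤ B u := fun u => Set.indicator_nonneg (fun _ _ => by positivity) u
  have hBm : Measurable B :=
    ((measurable_cf hf).norm.pow_const 2).indicator measurableSet_Icc.compl
  have hqm : Measurable q := measurable_truncInv hg _
  have hDm : Measurable (Function.uncurry D) := by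
    have : Continuous fun p : (Fin n → ℝ) × ℝ => trigSum p.1 p.2 := by
      unfold trigSum
      fun_prop
    have h3 : Measurable fun p : (Fin n → ℝ) × ℝ => trigSum p.1 p.2 := this.measurable
    have h4 : Measurable (charFun μ) := measurable_charFun
    simp only [hD, Function.uncurry_def]
    have h5 : Measurable fun p : (Fin n → ℝ) × ℝ => charFun μ p.2 := h4.comp measurable_snd
    have h6 : Measurable fun p : (Fin n → ℝ) × ℝ =>
        (‖trigSum p.1 p.2‖ ^ 2 - n) / ((n : ℝ) * (n - 1)) - ‖charFun μ p.2‖ ^ 2 := by fun_prop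
    exact h6.abs
  have step1 : ∀ Y, ENNReal.ofReal |estimator g h n Y - quadFunctional f|
      ≤ ∫⁻ u, (ENNReal.ofReal (D Y u) * ENNReal.ofReal (‖q u‖ ^ 2) + ENNReal.ofReal (B u)) := by
    intro Y
    rw [estimator_sub_quadFunctional hf hf2 hg h0 hh Y, abs_mul,
      ENNReal.ofReal_mul (abs_nonneg _)]
    have hpi : |(2 * Real.pi)⁻¹| ≤ 1 := by
      rw [abs_of_pos (by positivity)]
      exact inv_le_one_of_one_le₀ (by linarith [Real.pi_gt_three])
    refine (mul_le_mul_left (ENNReal.ofReal_le_ofReal hpi) _).trans ?_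
    rw [ENNReal.ofReal_one, one_mul, ← Real.norm_eq_abs, ofReal_norm]
    refine (enorm_integral_le_lintegral_enorm _).trans (lintegral_mono fun u => ?_)
    rw [← ofReal_norm, ← ENNReal.ofReal_mul (abs_nonneg _),
      ← ENNReal.ofReal_add (by positivity) (hB0 u)]
    refine ENNReal.ofReal_le_ofReal ((norm_sub_le _ _).trans ?_)
    rw [norm_mul, Real.norm_of_nonneg (hB0 u), norm_pow, norm_norm, ← hcf]
    exact le_rfl
  have step2 : ∀ u, ENNReal.ofReal (‖q u‖ ^ 2) * ENNReal.ofReal (4 * ‖charFun μ u‖ / √n + 4 / n)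
      + ENNReal.ofReal (B u) ≤ ENNReal.ofReal (2 / W) * ENNReal.ofReal (‖cf f u‖ ^ 2 * ρ u)
        + (Set.Icc (-h⁻¹) h⁻¹).indicator (fun _ => ENNReal.ofReal (6 * E / n)) u := by
    intro u
    rw [← ENNReal.ofReal_mul (by positivity), ← ENNReal.ofReal_add (by positivity) (hB0 u),
      ← ENNReal.ofReal_mul (by positivity)]
    by_cases hu : u ∈ Set.Icc (-h⁻¹) h⁻¹
    · have hu' : |u| ≤ h⁻¹ := abs_le.2 hu
      have h1 := hE1 u hu'
      have h2 := hE2 u hu'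
      have hρ' := hρ u
      have hgpos : 0 < ‖cf g u‖ := norm_pos_iff.2 (h0 u)
      rw [Set.indicator_of_mem hu, ← ENNReal.ofReal_add (by positivity) (by positivity)]
      refine ENNReal.ofReal_le_ofReal ?_
      rw [hB, Set.indicator_of_notMem (by simpa using hu), hq, truncInv, Set.indicator_of_mem hu,
        hcf, norm_mul, add_zero]
      set b := ‖(cf g u)⁻¹‖ with hb
      have hbg : b * ‖cf g u‖ = 1 := by rw [hb, norm_inv, inv_mul_cancel₀ hgpos.ne']
      have hb0 : 0 ≤ b := norm_nonneg _
      set a := ‖cf f u‖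
      have ha0 : 0 ≤ a := norm_nonneg _
      exact weighted_pointwise_bound hn0 hbg (hρ u) hW h1 h2
    · have hu' : h⁻¹ < |u| := by
        by_contra hcon
        exact hu (abs_le.1 (not_lt.1 hcon))
      rw [Set.indicator_of_notMem hu, add_zero]
      refine ENNReal.ofReal_le_ofReal ?_
      rw [hB, Set.indicator_of_mem (by simpa using hu), hq, truncInv, Set.indicator_of_notMem hu]
      have h1 := hWρ u hu'
      have h2 : 1 ≤ ρ u / W := (one_le_div hW).2 h1
      have h3 : 0 ≤ ‖cf f u‖ ^ 2 := by positivity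
      calc _ = ‖cf f u‖ ^ 2 := by simp
        _ ≤ 2 * (‖cf f u‖ ^ 2 * (ρ u / W)) := by nlinarith
        _ = _ := by ring
  calc ∫⁻ Y, ENNReal.ofReal |estimator g h n Y - quadFunctional f| ∂(sampleLaw f g n)
      ≤ ∫⁻ Y, (∫⁻ u, (ENNReal.ofReal (D Y u) * ENNReal.ofReal (‖q u‖ ^ 2) + ENNReal.ofReal (B u)))
          ∂(sampleLaw f g n) := lintegral_mono step1
    _ = ∫⁻ u : ℝ, ∫⁻ Y : Fin n → ℝ, (ENNReal.ofReal (D Y u) * ENNReal.ofReal (‖q u‖ ^ 2) + ENNReal.ofReal (B u))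
          ∂(sampleLaw f g n) := by
        have : IsProbabilityMeasure (sampleLaw f g n) := by unfold sampleLaw; infer_instance
        refine lintegral_lintegral_swap (Measurable.aemeasurable ?_)
        have hDm' : Measurable fun p : (Fin n → ℝ) × ℝ => D p.1 p.2 := hDm
        unfold Function.uncurry
        fun_prop
    _ ≤ ∫⁻ u, (ENNReal.ofReal (‖q u‖ ^ 2) * ENNReal.ofReal (4 * ‖charFun μ u‖ / √n + 4 / n)
          + ENNReal.ofReal (B u)) := by
        refine lintegral_mono fun u => ?_
        have : IsProbabilityMeasure (sampleLaw f g n) := by unfold sampleLaw; infer_instance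
        have hDu : Measurable fun Y => D Y u := hDm.of_uncurry_right
        simp only
        rw [lintegral_add_right _ measurable_const, lintegral_const, measure_univ, mul_one,
          lintegral_mul_const _ (by fun_prop), mul_comm]
        gcongr
        exact integral_abs_centered_le μ hn u
    _ ≤ ∫⁻ u, (ENNReal.ofReal (2 / W) * ENNReal.ofReal (‖cf f u‖ ^ 2 * ρ u)
        + (Set.Icc (-h⁻¹) h⁻¹).indicator (fun _ => ENNReal.ofReal (6 * E / n)) u) :=
        lintegral_mono step2
    _ = ENNReal.ofReal (2 / W) * (∫⁻ u, ENNReal.ofReal (‖cf f u‖ ^ 2 * ρ u))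
        + ENNReal.ofReal (6 * E / n) * ENNReal.ofReal (2 * h⁻¹) := by
        rw [lintegral_add_right _ (measurable_const.indicator measurableSet_Icc),
          lintegral_const_mul' _ _ ENNReal.ofReal_ne_top, lintegral_indicator measurableSet_Icc,
          setLIntegral_const, Real.volume_Icc]
        congr 3
        ring
    _ ≤ ENNReal.ofReal (2 / W) * ENNReal.ofReal A
        + ENNReal.ofReal (6 * E / n) * ENNReal.ofReal (2 * h⁻¹) := by gcongr
    _ = _ := by
        rw [← ENNReal.ofReal_mul (by positivity), ← ENNReal.ofReal_mul (by positivity),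
          ← ENNReal.ofReal_add (by positivity) (by positivity)]
        congr 1
        ring

/-! ### Exponential noise and a criterion for attaining a rate. -/

theorem exists_forall_le_of_tendsto_cocompact {F : ℝ → ℝ} (hF : Continuous F) {l : ℝ}
    (hl : Tendsto F (cocompact ℝ) (𝓝 l)) : ∃ C, 0 < C ∧ ∀ u, F u ≤ C := by
  have h1 : ∀ᶠ u in cocompact ℝ, F u ≤ l + 1 := hl.eventually (eventually_le_nhds (lt_add_one l))
  obtain ⟨K, hK, hK'⟩ := mem_cocompact.1 h1
  obtain ⟨B, hB⟩ := hK.exists_bound_of_continuousOn hF.continuousOn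
  refine ⟨max (max B (l + 1)) 1, by positivity, fun u => ?_⟩
  by_cases hu : u ∈ K
  · exact ((le_abs_self _).trans (hB u hu)).trans ((le_max_left _ _).trans (le_max_left _ _))
  · exact (hK' hu : F u ≤ l + 1).trans ((le_max_right _ _).trans (le_max_left _ _))

theorem IsExponentialNoise.tendsto_ratio {g : ℝ → ℝ} {γ s : ℝ} (hg : IsExponentialNoise g γ s) :
    Tendsto (fun u => ‖cf g u‖ / Real.exp (-γ * |u| ^ s)) (cocompact ℝ) (𝓝 1) :=
  (Asymptotics.isEquivalent_iff_tendsto_one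
    (Eventually.of_forall fun _ => (Real.exp_pos _).ne')).1 hg.cf_equiv

theorem IsExponentialNoise.continuous_ratio {g : ℝ → ℝ} {γ s : ℝ} (hs : 0 < s)
    (hg : IsExponentialNoise g γ s) :
    Continuous fun u => ‖cf g u‖ / Real.exp (-γ * |u| ^ s) := by
  have h1 := hg.density.continuous_cf
  have h2 : Continuous fun u : ℝ => |u| ^ s := continuous_abs.rpow_const fun _ => Or.inr hs.le
  exact h1.norm.div (by fun_prop) fun _ => (Real.exp_pos _).ne'

theorem IsExponentialNoise.exists_norm_cf_le {g : ℝ → ℝ} {γ s : ℝ} (hs : 0 < s)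
    (hg : IsExponentialNoise g γ s) :
    ∃ C, 0 < C ∧ ∀ u, ‖cf g u‖ ≤ C * Real.exp (-γ * |u| ^ s) := by
  obtain ⟨C, hC, h⟩ := exists_forall_le_of_tendsto_cocompact (hg.continuous_ratio hs)
    hg.tendsto_ratio
  exact ⟨C, hC, fun u => (div_le_iff₀ (Real.exp_pos _)).1 (h u)⟩

theorem IsExponentialNoise.exists_norm_inv_cf_sq_le {g : ℝ → ℝ} {γ s : ℝ} (hs : 0 < s)
    (hg : IsExponentialNoise g γ s) :
    ∃ C, 0 < C ∧ ∀ u, ‖(cf g u)⁻¹‖ ^ 2 ≤ C * Real.exp (2 * γ * |u| ^ s) := by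
  have hpos : ∀ u, 0 < ‖cf g u‖ := fun u => norm_pos_iff.2 (hg.cf_ne_zero u)
  obtain ⟨C, hC, h⟩ := exists_forall_le_of_tendsto_cocompact
    ((hg.continuous_ratio hs).inv₀ fun u => (div_pos (hpos u) (Real.exp_pos _)).ne')
    (hg.tendsto_ratio.inv₀ one_ne_zero)
  refine ⟨C ^ 2, by positivity, fun u => ?_⟩
  have h1 : ‖(cf g u)⁻¹‖ ≤ C * Real.exp (γ * |u| ^ s) := by
    have h2 : (‖cf g u‖ / Real.exp (-γ * |u| ^ s))⁻¹ ≤ C := h u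
    rw [inv_div, div_le_iff₀ (hpos u)] at h2
    rw [norm_inv, inv_le_iff_one_le_mul₀ (hpos u)]
    have h3 : Real.exp (-γ * |u| ^ s) * Real.exp (γ * |u| ^ s) = 1 := by
      rw [← Real.exp_add, neg_mul, neg_add_cancel, Real.exp_zero]
    rw [← h3]
    nlinarith [Real.exp_pos (γ * |u| ^ s)]
  calc _ ≤ (C * Real.exp (γ * |u| ^ s)) ^ 2 := by gcongr
    _ = _ := by
      rw [mul_pow, ← Real.exp_nat_mul]
      congr 2
      push_cast
      ring

/-- The two requirements in `hφ` are the squared bias at the cut-off and the stochastic term. `hsup`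
says that exp(2γ|u|^s)/ρ(u) is worst at the cut-off, so that E can be taken of order exp(2γ/h^s). -/
theorem attainsRate_of_weight {g : ℝ → ℝ} {γ s : ℝ} (hγ : 0 < γ) (hs : 0 < s)
    (hg : IsExponentialNoise g γ s) {F : Set (ℝ → ℝ)} {ρ : ℝ → ℝ} {A : ℝ} (hA0 : 0 ≤ A)
    (hρ : ∀ u, 0 < ρ u) (hmono : ∀ u v, |u| ≤ |v| → ρ u ≤ ρ v)
    (hF : ∀ f ∈ F, IsDensity f ∧ MemLp f 2 ∧
      ∫⁻ u, ENNReal.ofReal (‖cf f u‖ ^ 2 * ρ u) ≤ ENNReal.ofReal A)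
    (hsup : ∃ C, ∀ᶠ M : ℝ in atTop, ∀ u, |u| ≤ M →
      Real.exp (2 * γ * |u| ^ s) * ρ M ≤ C * (Real.exp (2 * γ * M ^ s) * ρ u))
    {h φ : ℕ → ℝ} (hpos : ∀ᶠ n in atTop, 0 < h n) (hlim : Tendsto (fun n => (h n)⁻¹) atTop atTop)
    (hφ : ∃ C, ∀ᶠ n : ℕ in atTop, 0 < φ n ∧ 1 / ρ (h n)⁻¹ ≤ C * φ n ∧
      (h n)⁻¹ * Real.exp (2 * γ * (h n)⁻¹ ^ s) / n ≤ C * φ n) :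
    AttainsRate F g (fun n => estimator g (h n) n) φ := by
  refine ⟨fun n => measurable_estimator hg.density _ n, ?_⟩
  obtain ⟨Cg, hCg, hcg⟩ := hg.exists_norm_inv_cf_sq_le hs
  obtain ⟨C₁, hC₁⟩ := hsup
  obtain ⟨C₂, hC₂⟩ := hφ
  -- The 1 serves the unweighted bound on 1/|Φ^g|², and C₁ the weighted one.
  set K := Cg * max 1 C₁ with hK
  have hK0 : 0 < K := by positivity
  refine ⟨max 1 (2 * A * C₂ + 12 * K * C₂), by positivity, ?_⟩
  refine limsup_le_of_le (by isBoundedDefault) ?_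
  filter_upwards [hpos, hlim.eventually hC₁, hC₂, eventually_ge_atTop 2] with n hn hn1 hn2 hnge
  obtain ⟨hφ0, hφ1, hφ2⟩ := hn2
  have hM : 0 < (h n)⁻¹ := inv_pos.2 hn
  refine iSup₂_le fun f hf => ?_
  obtain ⟨hfd, hf2, hfA⟩ := hF f hf
  have hn0 : (0 : ℝ) < n := by positivity
  have hrisk := lintegral_risk_le hfd hf2 hg.density hg.cf_ne_zero hn hnge hρ
    (hρ (h n)⁻¹) hA0 (E := K * Real.exp (2 * γ * (h n)⁻¹ ^ s)) (by positivity) hfA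
    (fun u hu => hmono _ _ (by rw [abs_of_pos hM]; exact hu.le))
    (fun u hu => ?_) (fun u hu => ?_)
  · refine (mul_le_mul_right hrisk _).trans ?_
    rw [← ENNReal.ofReal_mul (by positivity)]
    refine ENNReal.ofReal_le_ofReal (le_max_of_le_right ?_)
    rw [inv_mul_le_iff₀ hφ0]
    calc _ = 2 * A * (1 / ρ (h n)⁻¹)
          + 12 * K * ((h n)⁻¹ * Real.exp (2 * γ * (h n)⁻¹ ^ s) / n) := by ring
      _ ≤ 2 * A * (C₂ * φ n) + 12 * K * (C₂ * φ n) := by gcongr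
      _ = _ := by ring
  · calc _ ≤ Cg * Real.exp (2 * γ * |u| ^ s) := hcg u
      _ ≤ Cg * Real.exp (2 * γ * (h n)⁻¹ ^ s) := by gcongr
      _ ≤ _ := by
        rw [hK]
        gcongr
        exact le_mul_of_one_le_right hCg.le (le_max_left _ _)
  · calc _ ≤ Cg * Real.exp (2 * γ * |u| ^ s) * ρ (h n)⁻¹ := by
          gcongr
          · exact (hρ _).le
          · exact hcg u
      _ = Cg * (Real.exp (2 * γ * |u| ^ s) * ρ (h n)⁻¹) := by ring
      _ ≤ Cg * (max 1 C₁ * (Real.exp (2 * γ * (h n)⁻¹ ^ s) * ρ u)) := by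
          refine mul_le_mul_of_nonneg_left ((hn1 u hu).trans ?_) hCg.le
          have := hρ u
          gcongr
          exact le_max_right _ _
      _ = _ := by ring

/-! ### Upper bound over Sobolev classes. -/

theorem eventually_rpow_le_exp_rpow (p : ℝ) {c s : ℝ} (hc : 0 < c) (hs : 0 < s) :
    ∀ᶠ M : ℝ in atTop, M ^ p ≤ Real.exp (c * M ^ s) := by
  have h1 := (isLittleO_rpow_exp_pos_mul_atTop (p / s) hc).bound one_pos
  filter_upwards [(tendsto_rpow_atTop hs).eventually h1, eventually_gt_atTop 0] with M hM hM0
  rw [← Real.rpow_mul hM0.le, mul_div_cancel₀ _ hs.ne', one_mul, Real.norm_of_nonneg (by positivity),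
    Real.norm_of_nonneg (by positivity)] at hM
  exact hM

/-- For |u| ≥ M/2 the two weights differ by a factor at most 2^(2β); for |u| ≤ M/2 the exponential
gains exp(2γ(1 - 2⁻ˢ)M^s), which absorbs M^(2β). -/
theorem exists_sup_sobolev_weight {β γ s : ℝ} (hβ : 0 < β) (hγ : 0 < γ) (hs : 0 < s) :
    ∃ C, ∀ᶠ M : ℝ in atTop, ∀ u, |u| ≤ M → Real.exp (2 * γ * |u| ^ s) * max 1 (|M| ^ (2 * β))
      ≤ C * (Real.exp (2 * γ * M ^ s) * max 1 (|u| ^ (2 * β))) := by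
  refine ⟨2 ^ (2 * β), ?_⟩
  have hc : 0 < 2 * γ * (1 - (1 / 2) ^ s) := by
    have : (1 / 2 : ℝ) ^ s < 1 := Real.rpow_lt_one (by norm_num) (by norm_num) hs
    have : 0 < 1 - (1 / 2 : ℝ) ^ s := by linarith
    positivity
  have h2 : (1 : ℝ) ≤ 2 ^ (2 * β) := Real.one_le_rpow (by norm_num) (by positivity)
  filter_upwards [eventually_rpow_le_exp_rpow (2 * β) hc hs, eventually_ge_atTop 1]
    with M hM hM1 u hu
  have hM0 : 0 < M := by linarith
  have hMβ : max 1 (|M| ^ (2 * β)) = M ^ (2 * β) := by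
    rw [abs_of_pos hM0]
    exact max_eq_right (Real.one_le_rpow hM1 (by positivity))
  rw [hMβ]
  rcases le_total (M / 2) |u| with h | h
  · have h3 : M ^ (2 * β) ≤ 2 ^ (2 * β) * |u| ^ (2 * β) := by
      rw [← Real.mul_rpow (by norm_num) (abs_nonneg _)]
      exact Real.rpow_le_rpow hM0.le (by linarith) (by positivity)
    calc Real.exp (2 * γ * |u| ^ s) * M ^ (2 * β)
        ≤ Real.exp (2 * γ * M ^ s) * (2 ^ (2 * β) * |u| ^ (2 * β)) := by gcongr
      _ ≤ Real.exp (2 * γ * M ^ s) * (2 ^ (2 * β) * max 1 (|u| ^ (2 * β))) := by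
          gcongr
          exact le_max_right _ _
      _ = _ := by ring
  · calc Real.exp (2 * γ * |u| ^ s) * M ^ (2 * β)
        ≤ Real.exp (2 * γ * ((1 / 2) ^ s * M ^ s))
            * Real.exp (2 * γ * (1 - (1 / 2) ^ s) * M ^ s) := by
          gcongr
          rw [← Real.mul_rpow (by norm_num) hM0.le]
          exact Real.rpow_le_rpow (abs_nonneg _) (by linarith) hs.le
      _ = 1 * (Real.exp (2 * γ * M ^ s) * 1) := by
          rw [← Real.exp_add, one_mul, mul_one]
          congr 1
          ring
      _ ≤ _ := by
          gcongr
          exact le_max_left _ _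

/-- The risk bound divides by the weight, which must therefore not vanish at 0. Raising it to 1 on
[-1, 1] costs at most 2, because |Φ| ≤ 1 there. -/
theorem lintegral_sobolev_weight_le {f : ℝ → ℝ} (hf : IsDensity f) {β L : ℝ} (hβ : 0 < β)
    (hL : 0 < L)
    (h : ∫⁻ u, ENNReal.ofReal (‖cf f u‖ ^ 2 * |u| ^ (2 * β)) ≤ ENNReal.ofReal (2 * Real.pi * L)) :
    ∫⁻ u, ENNReal.ofReal (‖cf f u‖ ^ 2 * max 1 (|u| ^ (2 * β)))
      ≤ ENNReal.ofReal (2 + 2 * Real.pi * L) := by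
  calc ∫⁻ u, ENNReal.ofReal (‖cf f u‖ ^ 2 * max 1 (|u| ^ (2 * β)))
      ≤ ∫⁻ u, ((Set.Icc (-1 : ℝ) 1).indicator (fun _ => (1 : ℝ≥0∞)) u
          + ENNReal.ofReal (‖cf f u‖ ^ 2 * |u| ^ (2 * β))) := by
        refine lintegral_mono fun u => ?_
        simp only
        by_cases hu : u ∈ Set.Icc (-1 : ℝ) 1
        · rw [Set.indicator_of_mem hu]
          have h1 : |u| ^ (2 * β) ≤ 1 :=
            Real.rpow_le_one (abs_nonneg _) (abs_le.2 hu) (by positivity)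
          rw [max_eq_left h1, mul_one]
          refine le_trans ?_ (self_le_add_right _ _)
          rw [← ENNReal.ofReal_one]
          exact ENNReal.ofReal_le_ofReal (pow_le_one₀ (norm_nonneg _) (hf.norm_cf_le_one u))
        · rw [Set.indicator_of_notMem hu, zero_add]
          have h1 : 1 ≤ |u| ^ (2 * β) := by
            refine Real.one_le_rpow ?_ (by positivity)
            by_contra hcon
            exact hu (abs_le.1 (not_le.1 hcon).le)
          rw [max_eq_right h1]
    _ = 2 + ∫⁻ u, ENNReal.ofReal (‖cf f u‖ ^ 2 * |u| ^ (2 * β)) := by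
        rw [lintegral_add_left (measurable_const.indicator measurableSet_Icc),
          lintegral_indicator measurableSet_Icc, setLIntegral_const, Real.volume_Icc]
        norm_num
    _ ≤ 2 + ENNReal.ofReal (2 * Real.pi * L) := by gcongr
    _ = _ := by
        rw [ENNReal.ofReal_add (by norm_num) (by positivity)]
        norm_num

theorem tendsto_log_natCast : Tendsto (fun n : ℕ => Real.log n) atTop atTop :=
  Real.tendsto_log_atTop.comp tendsto_natCast_atTop_atTop

theorem attainsRate_sobolev {g : ℝ → ℝ} {γ s : ℝ} (hγ : 0 < γ) (hs : 0 < s)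
    (hg : IsExponentialNoise g γ s) {β L : ℝ} (hβ : 0 < β) (hL : 0 < L) :
    AttainsRate (sobolevClass β L) g (fun n => estimator g (sobolevBandwidth β γ s n) n)
      (sobolevRate β L γ s) := by
  set κ := (2 * β + 1) / (2 * γ * s) with hκ
  have hκ0 : 0 < κ := by positivity
  have hlogle : ∀ᶠ l : ℝ in atTop, κ * Real.log l ≤ l / 2 := by
    have := (Real.isLittleO_log_id_atTop.bound (show 0 < (2 * κ)⁻¹ by positivity))
    filter_upwards [this, eventually_ge_atTop 1] with l hl hl1
    rw [Real.norm_of_nonneg (Real.log_nonneg hl1), id, Real.norm_of_nonneg (by linarith)] at hl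
    calc κ * Real.log l ≤ κ * ((2 * κ)⁻¹ * l) := by gcongr
      _ = _ := by field_simp
  have hℓ : Tendsto (fun n : ℕ => Real.log n / (2 * γ)) atTop atTop :=
    tendsto_log_natCast.atTop_div_const (by positivity)
  -- The quantity X = h⁻ˢ lies between ℓ/2 and ℓ, where ℓ = log n/(2γ), so the correction changes
  -- the bias only by a constant factor.
  have hX : ∀ᶠ n : ℕ in atTop, 1 ≤ Real.log n / (2 * γ) ∧
      Real.log n / (2 * γ) / 2 ≤
        Real.log n / (2 * γ) - κ * Real.log (Real.log n / (2 * γ)) ∧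
      Real.log n / (2 * γ) - κ * Real.log (Real.log n / (2 * γ)) ≤ Real.log n / (2 * γ) ∧
      (sobolevBandwidth β γ s n)⁻¹ =
        (Real.log n / (2 * γ) - κ * Real.log (Real.log n / (2 * γ))) ^ (1 / s) := by
    filter_upwards [hℓ.eventually hlogle, hℓ.eventually_ge_atTop 1] with n h1 h2
    have h3 := Real.log_nonneg h2
    refine ⟨h2, by linarith, by nlinarith, ?_⟩
    rw [sobolevBandwidth, ← Real.rpow_neg (by linarith)]
    congr 1
    ring
  refine attainsRate_of_weight hγ hs hg (ρ := fun u => max 1 (|u| ^ (2 * β)))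
    (A := 2 + 2 * Real.pi * L) (by positivity) (fun u => by positivity) (fun u v huv => ?_)
    (fun f hf => ⟨hf.1, hf.2.1, lintegral_sobolev_weight_le hf.1 hβ hL hf.2.2.2⟩)
    (exists_sup_sobolev_weight hβ hγ hs) ?_ ?_ ?_
  · have : |u| ^ (2 * β) ≤ |v| ^ (2 * β) := Real.rpow_le_rpow (abs_nonneg _) huv (by positivity)
    exact max_le_max le_rfl this
  · filter_upwards [hX] with n ⟨h1, h2, h3, h4⟩
    rw [← inv_pos, h4]
    exact Real.rpow_pos_of_pos (by linarith) _
  · have : Tendsto (fun n : ℕ => (Real.log n / (2 * γ) / 2) ^ (1 / s)) atTop atTop :=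
      (tendsto_rpow_atTop (by positivity)).comp (hℓ.atTop_div_const (by norm_num))
    refine tendsto_atTop_mono' _ ?_ this
    filter_upwards [hX] with n ⟨h1, h2, h3, h4⟩
    rw [h4]
    exact Real.rpow_le_rpow (by linarith) h2 (by positivity)
  · refine ⟨max (2 ^ (2 * β / s)) 1 / L, ?_⟩
    filter_upwards [hX, eventually_gt_atTop 0] with n ⟨h1, h2, h3, h4⟩ hn
    rw [h4]
    set ℓ := Real.log n / (2 * γ) with hℓdef
    set X := ℓ - κ * Real.log ℓ with hXdef
    have hℓ0 : 0 < ℓ := by linarith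
    have hX0 : 0 < X := by linarith
    have hn0 : (0 : ℝ) < n := by exact_mod_cast hn
    have hφ : max (2 ^ (2 * β / s)) 1 / L * sobolevRate β L γ s n
        = max (2 ^ (2 * β / s)) 1 * ℓ ^ (-2 * β / s) := by
      rw [sobolevRate, ← hℓdef]
      field_simp
    rw [hφ]
    have hmax0 : (0 : ℝ) < max (2 ^ (2 * β / s)) 1 := by positivity
    refine ⟨by rw [sobolevRate]; positivity, ?_, ?_⟩
    · have hXs : |X ^ (1 / s)| ^ (2 * β) = X ^ (2 * β / s) := by
        rw [abs_of_pos (by positivity), ← Real.rpow_mul hX0.le]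
        congr 1
        ring
      rw [hXs]
      calc 1 / max 1 (X ^ (2 * β / s)) ≤ 1 / X ^ (2 * β / s) := by
            gcongr
            exact le_max_right _ _
        _ ≤ 1 / (ℓ / 2) ^ (2 * β / s) := by gcongr
        _ = 2 ^ (2 * β / s) * ℓ ^ (-2 * β / s) := by
            rw [Real.div_rpow hℓ0.le (by norm_num), show -2 * β / s = -(2 * β / s) by ring,
              Real.rpow_neg hℓ0.le]
            field_simp
        _ ≤ _ := by
            gcongr
            exact le_max_left _ _
    · have hXs : (X ^ (1 / s)) ^ s = X := by
        rw [← Real.rpow_mul hX0.le, one_div_mul_cancel hs.ne', Real.rpow_one]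
      -- The logarithmic correction in the bandwidth gains ℓ^(-(2β+1)/s): the part 2β/s is the rate,
      -- and the remaining 1/s cancels the factor h⁻¹.
      have hexp : Real.exp (2 * γ * X) = n * ℓ ^ (-(2 * β + 1) / s) := by
        rw [Real.rpow_def_of_pos hℓ0]
        nth_rw 1 [← Real.exp_log hn0]
        rw [← Real.exp_add]
        congr 1
        rw [hXdef, hκ, hℓdef]
        field_simp
        ring
      rw [hXs, hexp]
      calc X ^ (1 / s) * (n * ℓ ^ (-(2 * β + 1) / s)) / n
          = X ^ (1 / s) * ℓ ^ (-(2 * β + 1) / s) := by field_simp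
        _ ≤ ℓ ^ (1 / s) * ℓ ^ (-(2 * β + 1) / s) := by gcongr
        _ = 1 * ℓ ^ (-2 * β / s) := by
            rw [← Real.rpow_add hℓ0, one_mul]
            congr 1
            ring
        _ ≤ _ := by
            gcongr
            exact le_max_right _ _

/-! ### The bandwidth equation and the upper bound over supersmooth classes. -/

/-- The exponent of the bandwidth equation in terms of the cut-off frequency `m = 1 / h`. -/
def bandwidthExponent (α r γ s m : ℝ) : ℝ := 2 * α * m ^ r + 2 * γ * m ^ s

theorem bandwidthExponent_strictMonoOn {α r γ s : ℝ} (hα : 0 < α) (hr : 0 < r) (hγ : 0 < γ)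
    (hs : 0 < s) : StrictMonoOn (bandwidthExponent α r γ s) (Set.Ici 0) := by
  intro a ha b hb hab
  have h1 : a ^ r < b ^ r := Real.rpow_lt_rpow ha hab hr
  have h2 : a ^ s < b ^ s := Real.rpow_lt_rpow ha hab hs
  unfold bandwidthExponent
  nlinarith

theorem solvesBandwidthEq_iff {α r γ s : ℝ} {n : ℕ} {h : ℝ} :
    SolvesBandwidthEq α r γ s n h ↔ 0 < h ∧
      bandwidthExponent α r γ s h⁻¹ = Real.log n - Real.log (Real.log n) ^ 2 := by
  unfold SolvesBandwidthEq
  refine and_congr_right fun hh => ?_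
  rw [bandwidthExponent, Real.inv_rpow hh.le, Real.inv_rpow hh.le, div_eq_mul_inv, div_eq_mul_inv]

theorem eventually_log_sq_le (p : ℝ) (hp : 0 < p) : ∀ᶠ x : ℝ in atTop, Real.log x ^ 2 ≤ p * x := by
  filter_upwards [(Real.isLittleO_pow_log_id_atTop (n := 2)).bound hp, eventually_ge_atTop 0] with x hx h0
  rwa [Real.norm_of_nonneg (by positivity), id, Real.norm_of_nonneg h0] at hx

theorem eventually_half_log_le :
    ∀ᶠ n : ℕ in atTop, Real.log n / 2 ≤ Real.log n - Real.log (Real.log n) ^ 2 := by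
  filter_upwards [tendsto_log_natCast.eventually (eventually_log_sq_le (1 / 2) (by norm_num))]
    with n hn
  linarith

theorem eventually_existsUnique_bandwidth {α r γ s : ℝ} (hα : 0 < α) (hr : 0 < r) (hγ : 0 < γ)
    (hs : 0 < s) : ∀ᶠ n : ℕ in atTop, ∃! h : ℝ, SolvesBandwidthEq α r γ s n h := by
  filter_upwards [eventually_half_log_le, tendsto_log_natCast.eventually_gt_atTop 0] with n h1 h2
  set y := Real.log n - Real.log (Real.log n) ^ 2 with hy
  have hy0 : 0 < y := by linarith
  have hcont : Continuous (bandwidthExponent α r γ s) := by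
    have h1 : Continuous fun m : ℝ => m ^ r := Real.continuous_rpow_const hr.le
    have h2 : Continuous fun m : ℝ => m ^ s := Real.continuous_rpow_const hs.le
    unfold bandwidthExponent
    fun_prop
  have hzero : bandwidthExponent α r γ s 0 = 0 := by
    rw [bandwidthExponent, Real.zero_rpow hr.ne', Real.zero_rpow hs.ne']
    ring
  -- At the right endpoint the term 2γm^s alone equals y, so the intermediate value theorem applies
  -- from 0 on.
  obtain ⟨m, ⟨hm0, -⟩, hm⟩ : ∃ m ∈ Set.Icc (0 : ℝ) ((y / (2 * γ)) ^ (1 / s)),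
      bandwidthExponent α r γ s m = y := by
    refine intermediate_value_Icc (by positivity) hcont.continuousOn ⟨hzero.trans_le hy0.le, ?_⟩
    rw [bandwidthExponent, ← Real.rpow_mul (by positivity) _ s, one_div_mul_cancel hs.ne',
      Real.rpow_one]
    have : 0 ≤ 2 * α * ((y / (2 * γ)) ^ (1 / s)) ^ r := by positivity
    have e : 2 * γ * (y / (2 * γ)) = y := by field_simp
    linarith
  have hmpos : 0 < m := by
    rcases hm0.eq_or_lt with h | h
    · rw [← h, hzero] at hm
      exact absurd hm hy0.ne
    · exact h
  refine ⟨m⁻¹, solvesBandwidthEq_iff.2 ⟨inv_pos.2 hmpos, by rw [inv_inv, hm]⟩, fun h hh => ?_⟩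
  obtain ⟨hh0, hh1⟩ := solvesBandwidthEq_iff.1 hh
  have := (bandwidthExponent_strictMonoOn hα hr hγ hs).injOn (Set.mem_Ici.2 (inv_pos.2 hh0).le)
    (Set.mem_Ici.2 hmpos.le) (hh1.trans hm.symm)
  rw [← this, inv_inv]

theorem tendsto_inv_bandwidth {α r γ s : ℝ} (hα : 0 < α) (hr : 0 < r) (hγ : 0 < γ) (hs : 0 < s)
    {h : ℕ → ℝ} (hh : ∀ᶠ n : ℕ in atTop, SolvesBandwidthEq α r γ s n (h n)) :
    Tendsto (fun n => (h n)⁻¹) atTop atTop := by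
  refine tendsto_atTop.2 fun B => ?_
  filter_upwards [hh, eventually_half_log_le,
    tendsto_log_natCast.eventually_gt_atTop (2 * bandwidthExponent α r γ s (max B 0))] with n h1 h2 h3
  obtain ⟨hpos, heq⟩ := solvesBandwidthEq_iff.1 h1
  by_contra hcon
  have := (bandwidthExponent_strictMonoOn hα hr hγ hs).monotoneOn
    (Set.mem_Ici.2 (inv_pos.2 hpos).le) (Set.mem_Ici.2 (le_max_right B 0))
    ((not_le.1 hcon).le.trans (le_max_left _ _))
  linarith

/-- With a = |u|/M in [0, 1], the exponents compare as αM^r(1 - a^r) ≤ γM^s(1 - a^r) ≤ γM^s(1 -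
a^s). The first step needs αM^r ≤ γM^s: true for large M if r < s, and equivalent to α ≤ γ if r = s.
-/
theorem exists_sup_supersmooth_weight {α r γ s : ℝ} (hr : 0 < r) (hγ : 0 < γ)
    (hrs : r < s ∨ r = s ∧ α ≤ γ) :
    ∃ C, ∀ᶠ M : ℝ in atTop, ∀ u, |u| ≤ M → Real.exp (2 * γ * |u| ^ s) * Real.exp (2 * α * |M| ^ r)
      ≤ C * (Real.exp (2 * γ * M ^ s) * Real.exp (2 * α * |u| ^ r)) := by
  have hle : r ≤ s := hrs.elim le_of_lt fun h => h.1.le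
  have hM : ∀ᶠ M : ℝ in atTop, α * M ^ r ≤ γ * M ^ s := by
    rcases hrs with h | ⟨rfl, h⟩
    · have := (tendsto_rpow_atTop (sub_pos.2 h)).eventually_ge_atTop (α / γ)
      filter_upwards [this, eventually_gt_atTop 0] with M h1 h0
      rw [Real.rpow_sub h0, div_le_div_iff₀ hγ (by positivity)] at h1
      linarith
    · filter_upwards [eventually_gt_atTop 0] with M h0
      gcongr
  refine ⟨1, ?_⟩
  filter_upwards [hM, eventually_gt_atTop 0] with M h1 h0 u hu
  rw [one_mul, ← Real.exp_add, ← Real.exp_add, Real.exp_le_exp, abs_of_pos h0]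
  set a := |u| / M with ha
  have ha0 : 0 ≤ a := by positivity
  have ha1 : a ≤ 1 := (div_le_one h0).2 hu
  have hua : |u| = a * M := by rw [ha]; field_simp
  have h3 : a ^ s ≤ a ^ r := by
    rcases ha0.eq_or_lt with h | h
    · rw [← h, Real.zero_rpow hr.ne', Real.zero_rpow (by linarith)]
    · exact Real.rpow_le_rpow_of_exponent_ge h ha1 hle
  have h4 : a ^ r ≤ 1 := Real.rpow_le_one ha0 ha1 hr.le
  have h5 : 0 < M ^ s := by positivity
  rw [hua, Real.mul_rpow ha0 h0.le, Real.mul_rpow ha0 h0.le]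
  nlinarith [mul_le_mul_of_nonneg_left h3 (mul_pos hγ h5).le,
    mul_le_mul_of_nonneg_left h1 (sub_nonneg.2 h4)]

theorem attainsRate_supersmooth {g : ℝ → ℝ} {γ s : ℝ} (hγ : 0 < γ) (hs : 0 < s)
    (hg : IsExponentialNoise g γ s) {α r L : ℝ} (hα : 0 < α) (hr : 0 < r) (hL : 0 < L)
    (hrs : r < s ∨ r = s ∧ α ≤ γ) {h : ℕ → ℝ}
    (hh : ∀ᶠ n : ℕ in atTop, SolvesBandwidthEq α r γ s n (h n)) :
    AttainsRate (supersmoothClass α r L) g (fun n => estimator g (h n) n)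
      (fun n => supersmoothRate α r L (h n)) := by
  refine attainsRate_of_weight hγ hs hg (ρ := fun u => Real.exp (2 * α * |u| ^ r))
    (A := 2 * Real.pi * L) (by positivity) (fun u => Real.exp_pos _) (fun u v huv => ?_)
    (fun f hf => ⟨hf.1, hf.2.1, hf.2.2.2⟩)
    (exists_sup_supersmooth_weight hr hγ hrs) (hh.mono fun n h => h.1)
    (tendsto_inv_bandwidth hα hr hγ hs hh) ?_
  · have : |u| ^ r ≤ |v| ^ r := Real.rpow_le_rpow (abs_nonneg _) huv hr.le
    gcongr
  -- Used at x = log n: the term (log log n)² of the bandwidth equation is there to absorb h⁻¹ ≤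
  -- (log n/(2γ))^(1/s).
  have hlog : ∀ᶠ x : ℝ in atTop, (x / (2 * γ)) ^ (1 / s) * Real.exp (-(Real.log x) ^ 2) ≤ 1 := by
    filter_upwards [Real.tendsto_log_atTop.eventually_ge_atTop
      (1 + 1 / s + |Real.log (2 * γ)| / s), eventually_gt_atTop 0] with x hx hx0
    have hs' : 0 < 1 / s := by positivity
    have hb : 0 ≤ |Real.log (2 * γ)| / s := by positivity
    rw [Real.rpow_def_of_pos (by positivity), Real.log_div hx0.ne' (by positivity), ← Real.exp_add,
      Real.exp_le_one_iff]
    have h1 : -Real.log (2 * γ) * (1 / s) ≤ |Real.log (2 * γ)| / s := by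
      rw [mul_one_div]
      gcongr
      exact neg_le_abs _
    nlinarith
  refine ⟨1 / L, ?_⟩
  filter_upwards [hh, tendsto_log_natCast.eventually hlog, eventually_gt_atTop 0] with n h1 h2 hn
  obtain ⟨hpos, heq⟩ := solvesBandwidthEq_iff.1 h1
  have hn0 : (0 : ℝ) < n := by exact_mod_cast hn
  set m := (h n)⁻¹ with hm
  have hm0 : 0 < m := inv_pos.2 hpos
  have hφ : 1 / L * supersmoothRate α r L (h n) = Real.exp (-(2 * α * m ^ r)) := by
    rw [supersmoothRate, hm, Real.inv_rpow hpos.le]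
    field_simp
  rw [hφ]
  refine ⟨by rw [supersmoothRate]; positivity, ?_, ?_⟩
  · rw [abs_of_pos hm0, one_div, ← Real.exp_neg]
  · have hmle : m ≤ (Real.log n / (2 * γ)) ^ (1 / s) := by
      have h3 : m ^ s ≤ Real.log n / (2 * γ) := by
        rw [le_div_iff₀ (by positivity)]
        have : 0 ≤ 2 * α * m ^ r := by positivity
        unfold bandwidthExponent at heq
        nlinarith [sq_nonneg (Real.log (Real.log n))]
      calc m = (m ^ s) ^ (1 / s) := by
            rw [← Real.rpow_mul hm0.le, mul_one_div_cancel hs.ne', Real.rpow_one]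
        _ ≤ _ := Real.rpow_le_rpow (by positivity) h3 (by positivity)
    have hexp : Real.exp (2 * γ * m ^ s)
        = n * Real.exp (-(Real.log (Real.log n)) ^ 2) * Real.exp (-(2 * α * m ^ r)) := by
      nth_rw 1 [← Real.exp_log hn0]
      rw [← Real.exp_add, ← Real.exp_add]
      congr 1
      unfold bandwidthExponent at heq
      linarith
    rw [hexp]
    calc m * (n * Real.exp (-(Real.log (Real.log n)) ^ 2) * Real.exp (-(2 * α * m ^ r))) / n
        = (m * Real.exp (-(Real.log (Real.log n)) ^ 2)) * Real.exp (-(2 * α * m ^ r)) := by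
          field_simp
      _ ≤ 1 * Real.exp (-(2 * α * m ^ r)) := by
          gcongr
          exact le_trans (by gcongr) h2
      _ = _ := one_mul _

/-! ### A positive band-limited density with tails of order x⁻². -/

/-- The triangle function, the characteristic function of the Fejér density. -/
def triangle (u : ℝ) : ℝ := max (1 - |u|) 0

theorem continuous_triangle : Continuous triangle := by
  unfold triangle
  fun_prop

theorem triangle_nonneg (u : ℝ) : 0 ≤ triangle u := le_max_right _ _

theorem triangle_le_one (u : ℝ) : triangle u ≤ 1 :=
  max_le (by linarith [abs_nonneg u]) zero_le_one

theorem triangle_eq_zero {u : ℝ} (hu : 1 ≤ |u|) : triangle u = 0 := max_eq_right (by linarith)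

theorem triangle_neg (u : ℝ) : triangle (-u) = triangle u := by rw [triangle, triangle, abs_neg]

theorem abs_triangle_sub_le (u v : ℝ) : |triangle u - triangle v| ≤ |u - v| := by
  refine (abs_max_sub_max_le_abs _ _ _).trans ?_
  rw [show 1 - |u| - (1 - |v|) = |v| - |u| by ring, abs_sub_comm u v]
  exact abs_abs_sub_abs_le _ _

theorem hasCompactSupport_triangle : HasCompactSupport triangle :=
  HasCompactSupport.intro (isCompact_Icc (a := -1) (b := 1)) fun u hu => triangle_eq_zero (by
    by_contra hcon
    exact hu (abs_le.1 (not_le.1 hcon).le))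

theorem integrable_triangle : Integrable triangle :=
  continuous_triangle.integrable_of_hasCompactSupport hasCompactSupport_triangle

/-- The Fejér density `(1 - cos x) / (π x²)`, as an inverse Fourier transform. -/
def fejer (x : ℝ) : ℝ := (2 * Real.pi)⁻¹ * ∫ u, triangle u * Real.cos (u * x)

theorem integral_triangle_mul_cos (x : ℝ) :
    ∫ u, triangle u * Real.cos (u * x) = 2 * ∫ u in (0 : ℝ)..1, (1 - u) * Real.cos (u * x) := by
  have heven : ∀ u, triangle |u| * Real.cos (|u| * x) = triangle u * Real.cos (u * x) := fun u => by
    rcases abs_choice u with h | h <;> rw [h]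
    rw [triangle_neg, neg_mul, Real.cos_neg]
  have h1 := integral_comp_abs (f := fun u => triangle u * Real.cos (u * x))
  simp only [heven] at h1
  rw [h1, intervalIntegral.integral_of_le zero_le_one]
  congr 1
  rw [setIntegral_eq_of_subset_of_forall_sdiff_eq_zero measurableSet_Ioi Set.Ioc_subset_Ioi_self
    (f := fun u => triangle u * Real.cos (u * x))]
  · refine setIntegral_congr_fun measurableSet_Ioc fun u hu => ?_
    rw [triangle, abs_of_pos hu.1, max_eq_left (by linarith [hu.2])]
  · intro u hu
    have : 1 < u := by
      by_contra hcon
      exact hu.2 ⟨hu.1, not_lt.1 hcon⟩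
    rw [triangle_eq_zero (this.le.trans (le_abs_self u)), zero_mul]

/-- An explicit primitive of x²(1-u)cos(ux), from integration by parts. Multiplying by x² avoids the
division at x = 0. -/
theorem sq_mul_fejer (x : ℝ) : x ^ 2 * fejer x = (1 - Real.cos x) / Real.pi := by
  have hder : ∀ u ∈ Set.uIcc (0 : ℝ) 1,
      HasDerivAt (fun u => (1 - u) * (x * Real.sin (u * x)) - Real.cos (u * x))
        (x ^ 2 * ((1 - u) * Real.cos (u * x))) u := fun u _ => by
    have h1 : HasDerivAt (fun u : ℝ => u * x) x u := by simpa using (hasDerivAt_id u).mul_const x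
    have h2 : HasDerivAt (fun u : ℝ => 1 - u) (-1) u := by simpa using (hasDerivAt_id u).const_sub 1
    have h3 := (h2.mul (h1.sin.const_mul x)).sub h1.cos
    convert! h3 using 1
    ring
  have hint := intervalIntegral.integral_eq_sub_of_hasDerivAt hder
    (Continuous.intervalIntegrable (by fun_prop) _ _)
  rw [intervalIntegral.integral_const_mul] at hint
  simp only [sub_self, zero_mul, one_mul, zero_sub, Real.sin_zero, mul_zero, Real.cos_zero] at hint
  rw [fejer, integral_triangle_mul_cos]
  calc _ = Real.pi⁻¹ * (x ^ 2 * ∫ u in (0 : ℝ)..1, (1 - u) * Real.cos (u * x)) := by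
        field_simp
    _ = _ := by
        rw [hint]
        field_simp
        ring

theorem fejer_nonneg (x : ℝ) : 0 ≤ fejer x := by
  rcases eq_or_ne x 0 with rfl | hx
  · refine mul_nonneg (by positivity) (integral_nonneg fun u => ?_)
    simpa using triangle_nonneg u
  · have h1 := sq_mul_fejer x
    have h2 : 0 ≤ (1 - Real.cos x) / Real.pi :=
      div_nonneg (by linarith [Real.cos_le_one x]) Real.pi_pos.le
    rw [← h1] at h2
    exact nonneg_of_mul_nonneg_right h2 (by positivity)

theorem fejer_le_one (x : ℝ) : fejer x ≤ 1 := by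
  have hi : ∫ u, triangle u * Real.cos (u * x) ≤ 2 := by
    rw [integral_triangle_mul_cos]
    have : ∫ u in (0 : ℝ)..1, (1 - u) * Real.cos (u * x) ≤ ∫ u in (0 : ℝ)..1, (1 : ℝ) := by
      refine intervalIntegral.integral_mono_on zero_le_one
        (Continuous.intervalIntegrable (by fun_prop) _ _) (by simp) fun u hu => ?_
      nlinarith [Real.cos_le_one (u * x), hu.1, hu.2]
    simp at this
    linarith
  rw [fejer, inv_mul_le_iff₀ (by positivity)]
  linarith [Real.pi_gt_three]

theorem ofReal_fejer (x : ℝ) :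
    (fejer x : ℂ) = (2 * Real.pi : ℂ)⁻¹ * ft (fun u => (triangle u : ℂ)) x := by
  have h : ((ft (fun u => (triangle u : ℂ)) x).re : ℂ) = ft (fun u => (triangle u : ℂ)) x :=
    im_ft_eq_zero (fun u => by rw [triangle_neg, Complex.conj_ofReal]) x
  rw [← h, fejer]
  push_cast
  congr 2
  have hi : Integrable fun u : ℝ => Complex.exp (u * x * Complex.I) * (triangle u : ℂ) :=
    integrable_exp_mul (integrable_ofReal integrable_triangle) x
  have := integral_re (𝕜 := ℂ) hi
  simp only [RCLike.re_to_complex] at this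
  rw [ft, ← this]
  refine integral_congr_ae (Eventually.of_forall fun u => ?_)
  simp only
  rw [mul_comm (triangle u), Complex.re_mul_ofReal, ← Complex.ofReal_mul,
    Complex.exp_ofReal_mul_I_re]

open scoped FourierTransform in
theorem contDiff_fejer : ContDiff ℝ ∞ fejer := by
  have h1 : ContDiff ℝ ∞ (𝓕 fun u : ℝ => (triangle u : ℂ)) := by
    refine Real.contDiff_fourier (N := ⊤) fun n _ => ?_
    refine Continuous.integrable_of_hasCompactSupport ?_ ?_
    · have := continuous_triangle
      fun_prop
    · refine HasCompactSupport.mul_left ?_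
      exact (hasCompactSupport_triangle.comp_left (g := fun y : ℝ => ‖(y : ℂ)‖) (by simp))
  have h2 : fejer = fun x => (2 * Real.pi)⁻¹ *
      (𝓕 (fun u : ℝ => (triangle u : ℂ)) (-(2 * Real.pi)⁻¹ * x)).re := by
    funext x
    have := congrArg Complex.re (ofReal_fejer x)
    rw [Complex.ofReal_re, ft_eq_fourier] at this
    rw [this, show (2 * Real.pi : ℂ)⁻¹ = ((2 * Real.pi)⁻¹ : ℝ) by push_cast; ring,
      Complex.re_ofReal_mul]
  rw [h2]
  have h3 : ContDiff ℝ ∞ fun x : ℝ => 𝓕 (fun u : ℝ => (triangle u : ℂ)) (-(2 * Real.pi)⁻¹ * x) :=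
    h1.comp (contDiff_const.mul contDiff_id)
  exact contDiff_const.mul (Complex.reCLM.contDiff.comp h3)

theorem integrable_of_decay {f : ℝ → ℝ} (hf : Continuous f) {C : ℝ}
    (h : ∀ x, (1 + x ^ 2) * |f x| ≤ C) : Integrable f := by
  refine (integrable_inv_one_add_sq.const_mul C).mono' hf.aestronglyMeasurable
    (Eventually.of_forall fun x => ?_)
  have : 0 < 1 + x ^ 2 := by positivity
  rw [← div_eq_mul_inv, le_div_iff₀ this, mul_comm]
  exact h x

theorem integrable_fejer : Integrable fejer := by
  refine integrable_of_decay contDiff_fejer.continuous (C := 2) fun x => ?_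
  rw [abs_of_nonneg (fejer_nonneg x), add_mul, sq_mul_fejer, one_mul]
  have : (1 - Real.cos x) / Real.pi ≤ 1 := by
    rw [div_le_one Real.pi_pos]
    linarith [Real.neg_one_le_cos x, Real.pi_gt_three]
  linarith [fejer_le_one x]

open scoped FourierTransform in
-- Fourier inversion in the probabilistic normalization; both transforms carry the sign +i, hence
-- the reflection.
theorem ft_ft {F : ℝ → ℂ} (hF : Continuous F) (h1 : Integrable F) (h2 : Integrable (ft F)) (u : ℝ) :
    ft (fun x => (2 * Real.pi : ℂ)⁻¹ * ft F x) u = F (-u) := by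
  have hpi : (2 * Real.pi) ≠ 0 := by positivity
  have h3 : Integrable (𝓕 F) := by
    have := h2.comp_mul_left' (R := -(2 * Real.pi)) (by simp)
    refine this.congr (Eventually.of_forall fun x => ?_)
    simp only [ft_eq_fourier]
    field_simp
  have h4 : 𝓕⁻ (𝓕 F) (-u) = F (-u) := h1.fourierInv_fourier_eq h3 hF.continuousAt
  rw [← h4, Real.fourierInv_eq_fourier_neg, neg_neg, Real.fourier_real_eq_integral_exp_smul, ft]
  have := Measure.integral_comp_mul_left (fun v : ℝ =>
    Complex.exp (((-2 * Real.pi * v * u : ℝ) : ℂ) * Complex.I) • 𝓕 F v) (-(2 * Real.pi)⁻¹)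
  have e : |(-(2 * Real.pi)⁻¹)⁻¹| = 2 * Real.pi := by
    rw [inv_neg, inv_inv, abs_neg, abs_of_pos (by positivity)]
  rw [e, ← inv_smul_eq_iff₀ hpi, ← integral_smul] at this
  rw [← this]
  refine integral_congr_ae (Eventually.of_forall fun x => ?_)
  simp only [ft_eq_fourier, Complex.real_smul, smul_eq_mul]
  push_cast
  rw [mul_left_comm]
  congr 3
  have : (Real.pi : ℂ) ≠ 0 := by exact_mod_cast Real.pi_ne_zero
  field_simp

theorem ft_fejer (u : ℝ) : ft (fun x => (fejer x : ℂ)) u = triangle u := by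
  have h := ft_ft (F := fun u => (triangle u : ℂ))
    (Complex.continuous_ofReal.comp continuous_triangle) (integrable_ofReal integrable_triangle) ?_ u
  · rw [triangle_neg] at h
    rw [← h]
    simp only [ofReal_fejer]
  · have h1 := (integrable_ofReal integrable_fejer).const_mul (2 * Real.pi : ℂ)
    refine h1.congr (Eventually.of_forall fun x => ?_)
    simp only
    have : (Real.pi : ℂ) ≠ 0 := by exact_mod_cast Real.pi_ne_zero
    rw [ofReal_fejer]
    field_simp

theorem ft_comp_sub (F : ℝ → ℂ) (c u : ℝ) :
    ft (fun x => F (x - c)) u = Complex.exp (c * u * Complex.I) * ft F u := by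
  rw [ft, ← integral_add_right_eq_self _ c, ft, ← integral_const_mul]
  refine integral_congr_ae (Eventually.of_forall fun x => ?_)
  simp only [add_sub_cancel_right]
  rw [← mul_assoc, ← Complex.exp_add]
  congr 2
  push_cast
  ring

theorem ft_add {F G : ℝ → ℂ} (hF : Integrable F) (hG : Integrable G) (u : ℝ) :
    ft (fun x => F x + G x) u = ft F u + ft G u := by
  simp only [ft, mul_add]
  refine integral_add ?_ ?_
  · simpa only [mul_comm, mul_left_comm] using integrable_exp_mul hF u
  · simpa only [mul_comm, mul_left_comm] using integrable_exp_mul hG u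

theorem ft_const_mul (F : ℝ → ℂ) (c : ℂ) (u : ℝ) : ft (fun x => c * F x) u = c * ft F u := by
  simp only [ft, ← integral_const_mul]
  refine integral_congr_ae (Eventually.of_forall fun x => ?_)
  simp only
  ring

/-- A smooth density with tails of order `x⁻²`, whose characteristic function is supported
in `[-1, 1]`. -/
def baseDensity (x : ℝ) : ℝ := (fejer x + fejer (x - Real.pi)) / 2

theorem contDiff_baseDensity : ContDiff ℝ ∞ baseDensity :=
  (contDiff_fejer.add (contDiff_fejer.comp (contDiff_id.sub contDiff_const))).div_const 2

theorem continuous_baseDensity : Continuous baseDensity := contDiff_baseDensity.continuous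

theorem baseDensity_nonneg (x : ℝ) : 0 ≤ baseDensity x :=
  div_nonneg (add_nonneg (fejer_nonneg _) (fejer_nonneg _)) zero_le_two

theorem baseDensity_le_one (x : ℝ) : baseDensity x ≤ 1 := by
  have h1 := fejer_le_one x
  have h2 := fejer_le_one (x - Real.pi)
  unfold baseDensity
  linarith

theorem integrable_baseDensity : Integrable baseDensity :=
  (integrable_fejer.add (integrable_fejer.comp_sub_right Real.pi)).div_const 2

/-- The Fejér density vanishes at the nonzero multiples of 2π; a shift by π changes the sign of the
cosine, and (1 - cos x) + (1 + cos x) = 2 leaves no zeros. -/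
theorem le_sq_mul_baseDensity (x : ℝ) : 1 / Real.pi ≤ (|x| + Real.pi) ^ 2 * baseDensity x := by
  have h1 : x ^ 2 * fejer x ≤ (|x| + Real.pi) ^ 2 * fejer x := by
    refine mul_le_mul_of_nonneg_right ?_ (fejer_nonneg x)
    rw [← sq_abs x]
    gcongr
    linarith [Real.pi_pos]
  have h2 : (x - Real.pi) ^ 2 * fejer (x - Real.pi) ≤ (|x| + Real.pi) ^ 2 * fejer (x - Real.pi) := by
    refine mul_le_mul_of_nonneg_right ?_ (fejer_nonneg _)
    rw [← sq_abs (x - Real.pi)]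
    gcongr
    exact (abs_sub _ _).trans (by rw [abs_of_pos Real.pi_pos])
  rw [sq_mul_fejer] at h1 h2
  rw [Real.cos_sub_pi] at h2
  have h3 : (1 - Real.cos x) / Real.pi + (1 - -Real.cos x) / Real.pi = 2 / Real.pi := by ring
  have h4 : 2 / Real.pi = 2 * (1 / Real.pi) := by ring
  unfold baseDensity
  linarith

theorem baseDensity_pos (x : ℝ) : 0 < baseDensity x := by
  have h1 := le_sq_mul_baseDensity x
  have h2 : 0 < 1 / Real.pi := by positivity
  exact pos_of_mul_pos_right (h2.trans_le h1) (by positivity)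

theorem ft_baseDensity (u : ℝ) : ft (fun x => (baseDensity x : ℂ)) u
    = triangle u * ((1 + Complex.exp (Real.pi * u * Complex.I)) / 2) := by
  have e : (fun x => (baseDensity x : ℂ))
      = fun x => (2 : ℂ)⁻¹ * ((fejer x : ℂ) + (fejer (x - Real.pi) : ℂ)) := by
    funext x
    unfold baseDensity
    push_cast
    ring
  have h1 := integrable_ofReal integrable_fejer
  have h2 : Integrable fun x => (fejer (x - Real.pi) : ℂ) := h1.comp_sub_right Real.pi
  rw [e, ft_const_mul, ft_add h1 h2, ft_comp_sub (fun x => (fejer x : ℂ)), ft_fejer]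
  ring

theorem isDensity_baseDensity : IsDensity baseDensity := by
  refine ⟨continuous_baseDensity.measurable, baseDensity_nonneg, integrable_baseDensity, ?_⟩
  have h := ft_baseDensity 0
  simp only [ft, Complex.ofReal_zero, mul_zero, zero_mul, Complex.exp_zero, one_mul, triangle,
    abs_zero, sub_zero, zero_le_one, sup_of_le_left] at h
  rw [integral_complex_ofReal] at h
  norm_num at h
  exact_mod_cast h

theorem cf_baseDensity (u : ℝ) : cf baseDensity u
    = triangle u * ((1 + Complex.exp (Real.pi * u * Complex.I)) / 2) := by
  rw [isDensity_baseDensity.cf_eq_ft, ft_baseDensity]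

theorem cf_baseDensity_eq_zero {u : ℝ} (hu : 1 ≤ |u|) : cf baseDensity u = 0 := by
  rw [cf_baseDensity, triangle_eq_zero hu, Complex.ofReal_zero, zero_mul]

theorem norm_exp_sub_exp_le (x y : ℝ) :
    ‖Complex.exp (x * Complex.I) - Complex.exp (y * Complex.I)‖ ≤ |x - y| := by
  have : Complex.exp (x * Complex.I) - Complex.exp (y * Complex.I)
      = Complex.exp (y * Complex.I) * (Complex.exp (Complex.I * ((x - y : ℝ) : ℂ)) - 1) := by
    rw [mul_sub, ← Complex.exp_add, mul_one]
    congr 2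
    push_cast
    ring
  rw [this, norm_mul, Complex.norm_exp_ofReal_mul_I, one_mul]
  exact Real.norm_exp_I_mul_ofReal_sub_one_le

/-- The triangle has corners, so a Lipschitz bound replaces differentiability. The constant 5 is not
sharp. -/
theorem norm_cf_baseDensity_sub_le (u v : ℝ) :
    ‖cf baseDensity u - cf baseDensity v‖ ≤ 5 * |u - v| := by
  have hexp : ∀ u : ℝ, ‖Complex.exp (Real.pi * u * Complex.I)‖ = 1 := fun u => by
    rw [← Complex.ofReal_mul, Complex.norm_exp_ofReal_mul_I]
  have hd : cf baseDensity u - cf baseDensity v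
      = ((triangle u - triangle v : ℝ) : ℂ) * ((1 + Complex.exp (Real.pi * u * Complex.I)) / 2)
        + triangle v * ((Complex.exp (Real.pi * u * Complex.I)
          - Complex.exp (Real.pi * v * Complex.I)) / 2) := by
    rw [cf_baseDensity, cf_baseDensity]
    push_cast
    ring
  have h1 : ‖(1 + Complex.exp (Real.pi * u * Complex.I)) / 2‖ ≤ 1 := by
    rw [norm_div, Complex.norm_ofNat, div_le_one two_pos]
    refine (norm_add_le _ _).trans ?_
    rw [hexp, norm_one]
    norm_num
  have h2 : ‖(Complex.exp (Real.pi * u * Complex.I) - Complex.exp (Real.pi * v * Complex.I)) / 2‖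
      ≤ 2 * |u - v| := by
    rw [norm_div, Complex.norm_ofNat]
    have := norm_exp_sub_exp_le (Real.pi * u) (Real.pi * v)
    rw [← mul_sub, abs_mul, abs_of_pos Real.pi_pos] at this
    push_cast at this
    have h4 : Real.pi * |u - v| ≤ 4 * |u - v| := by gcongr; exact Real.pi_le_four
    linarith
  rw [hd]
  refine (norm_add_le _ _).trans ?_
  rw [norm_mul, norm_mul, Complex.norm_real, Complex.norm_real, Real.norm_eq_abs, Real.norm_eq_abs,
    abs_of_nonneg (triangle_nonneg v)]
  have h3 := abs_triangle_sub_le u v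
  have h5 := triangle_le_one v
  have h6 := triangle_nonneg v
  have h7 := abs_nonneg (u - v)
  calc _ ≤ |u - v| * 1 + 1 * (2 * |u - v|) := by gcongr
    _ ≤ _ := by linarith

/-! ### The two hypotheses: a rescaled density and its modulation. -/

theorem memLp_two_of_bounded {f : ℝ → ℝ} (hf : Integrable f) {C : ℝ} (hC : ∀ x, |f x| ≤ C) :
    MemLp f 2 := by
  have := memLp_two_of_bounded_of_integrable (integrable_ofReal hf) (C := C) (by simpa using hC)
  simpa using this.norm.mono hf.aestronglyMeasurable (Eventually.of_forall fun x => by simp)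

/-- The rescaled base density, with characteristic function supported in `[-w, w]`. -/
def scaledBase (w x : ℝ) : ℝ := w * baseDensity (w * x)

/-- The rescaled base density modulated by a small oscillation of frequency `N`. -/
def modulatedBase (w a N x : ℝ) : ℝ := scaledBase w x * (1 + a * Real.cos (N * x))

theorem contDiff_scaledBase (w : ℝ) : ContDiff ℝ ∞ (scaledBase w) :=
  contDiff_const.mul (contDiff_baseDensity.comp (contDiff_const.mul contDiff_id))

theorem contDiff_modulatedBase (w a N : ℝ) : ContDiff ℝ ∞ (modulatedBase w a N) :=
  (contDiff_scaledBase w).mul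
    (contDiff_const.add (contDiff_const.mul (Real.contDiff_cos.comp (contDiff_const.mul contDiff_id))))

theorem integrable_scaledBase {w : ℝ} (hw : 0 < w) : Integrable (scaledBase w) :=
  (integrable_baseDensity.comp_mul_left' hw.ne').const_mul w

theorem isDensity_scaledBase {w : ℝ} (hw : 0 < w) : IsDensity (scaledBase w) := by
  refine ⟨(contDiff_scaledBase w).continuous.measurable,
    fun x => mul_nonneg hw.le (baseDensity_nonneg _), integrable_scaledBase hw, ?_⟩
  unfold scaledBase
  rw [integral_const_mul, Measure.integral_comp_mul_left baseDensity,
    isDensity_baseDensity.integral_eq_one, abs_of_pos (inv_pos.2 hw), smul_eq_mul, mul_one,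
    mul_inv_cancel₀ hw.ne']

theorem scaledBase_le {w : ℝ} (hw : 0 < w) (x : ℝ) : scaledBase w x ≤ w :=
  mul_le_of_le_one_right hw.le (baseDensity_le_one _)

theorem memLp_scaledBase {w : ℝ} (hw : 0 < w) : MemLp (scaledBase w) 2 :=
  memLp_two_of_bounded (integrable_scaledBase hw) (C := w) fun x => by
    rw [abs_of_nonneg ((isDensity_scaledBase hw).nonneg x)]
    exact scaledBase_le hw x

theorem cf_scaledBase {w : ℝ} (hw : 0 < w) (u : ℝ) :
    cf (scaledBase w) u = cf baseDensity (u / w) := by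
  rw [(isDensity_scaledBase hw).cf_eq_ft, isDensity_baseDensity.cf_eq_ft, ft, ft]
  have := Measure.integral_comp_mul_left (fun x : ℝ =>
    Complex.exp (x * (u / w : ℝ) * Complex.I) * (baseDensity x : ℂ)) w
  rw [abs_of_pos (inv_pos.2 hw), eq_inv_smul_iff₀ hw.ne', ← integral_smul] at this
  rw [← this]
  refine integral_congr_ae (Eventually.of_forall fun x => ?_)
  simp only [scaledBase, Complex.real_smul]
  push_cast
  have : (w : ℂ) ≠ 0 := by exact_mod_cast hw.ne'
  rw [mul_left_comm]
  congr 3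
  field_simp

theorem cf_scaledBase_eq_zero {w : ℝ} (hw : 0 < w) {u : ℝ} (hu : w ≤ |u|) :
    cf (scaledBase w) u = 0 := by
  rw [cf_scaledBase hw, cf_baseDensity_eq_zero]
  rwa [abs_div, abs_of_pos hw, one_le_div hw]

theorem norm_cf_scaledBase_sub_le {w : ℝ} (hw : 0 < w) (u v : ℝ) :
    ‖cf (scaledBase w) u - cf (scaledBase w) v‖ ≤ 5 / w * |u - v| := by
  rw [cf_scaledBase hw, cf_scaledBase hw]
  refine (norm_cf_baseDensity_sub_le _ _).trans_eq ?_
  rw [← sub_div, abs_div, abs_of_pos hw]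
  ring

theorem quadFunctional_scaledBase {w : ℝ} (hw : 0 < w) :
    quadFunctional (scaledBase w) = w * quadFunctional baseDensity := by
  have := Measure.integral_comp_mul_left (fun x => baseDensity x ^ 2) w
  rw [abs_of_pos (inv_pos.2 hw), smul_eq_mul] at this
  simp only [quadFunctional, scaledBase, mul_pow]
  rw [integral_const_mul, this]
  field_simp

theorem quadFunctional_baseDensity_pos : 0 < quadFunctional baseDensity := by
  have hi : Integrable fun x => baseDensity x ^ 2 :=
    (memLp_two_of_bounded integrable_baseDensity (C := 1) fun x => by
      rw [abs_of_nonneg (baseDensity_nonneg x)]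
      exact baseDensity_le_one x).integrable_sq
  rw [quadFunctional, integral_pos_iff_support_of_nonneg (fun x => sq_nonneg _) hi]
  have : Function.support (fun x => baseDensity x ^ 2) = Set.univ := by
    ext x
    simpa using (baseDensity_pos x).ne'
  rw [this]
  simp

theorem ft_mul_cos {f : ℝ → ℝ} (hf : Integrable f) (N u : ℝ) :
    ft (fun x => ((f x * Real.cos (N * x) : ℝ) : ℂ)) u
      = (ft (fun x => (f x : ℂ)) (u + N) + ft (fun x => (f x : ℂ)) (u - N)) / 2 := by
  have h1 := integrable_exp_mul (integrable_ofReal hf) (u + N)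
  have h2 := integrable_exp_mul (integrable_ofReal hf) (u - N)
  rw [ft, ft, ft, ← integral_add h1 h2, ← integral_div]
  refine integral_congr_ae (Eventually.of_forall fun x => ?_)
  have e1 : Complex.exp (x * ((u + N : ℝ) : ℂ) * Complex.I)
      = Complex.exp (x * u * Complex.I) * Complex.exp (N * x * Complex.I) := by
    rw [← Complex.exp_add]
    congr 1
    push_cast
    ring
  have e2 : Complex.exp (x * ((u - N : ℝ) : ℂ) * Complex.I)
      = Complex.exp (x * u * Complex.I) * Complex.exp (-(N * x) * Complex.I) := by
    rw [← Complex.exp_add]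
    congr 1
    push_cast
    ring
  simp only
  rw [e1, e2]
  push_cast
  rw [Complex.cos]
  ring

theorem integrable_scaledBase_mul_cos {w : ℝ} (hw : 0 < w) (N : ℝ) :
    Integrable fun x => scaledBase w x * Real.cos (N * x) :=
  (integrable_scaledBase hw).mul_bdd (c := 1) (by fun_prop)
    (Eventually.of_forall fun x => Real.abs_cos_le_one _)

theorem modulatedBase_eq (w a N x : ℝ) :
    modulatedBase w a N x = scaledBase w x + a * (scaledBase w x * Real.cos (N * x)) := by
  unfold modulatedBase
  ring

theorem integrable_modulatedBase {w : ℝ} (hw : 0 < w) (a N : ℝ) :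
    Integrable (modulatedBase w a N) := by
  refine ((integrable_scaledBase hw).add ((integrable_scaledBase_mul_cos hw N).const_mul a)).congr
    (Eventually.of_forall fun x => ?_)
  rw [modulatedBase_eq]
  rfl

theorem abs_mul_cos_le {a : ℝ} (ha : |a| ≤ 1) (x : ℝ) : |a * Real.cos x| ≤ 1 := by
  rw [abs_mul]
  exact mul_le_one₀ ha (abs_nonneg _) (Real.abs_cos_le_one _)

theorem modulatedBase_nonneg {w a : ℝ} (hw : 0 < w) (ha : |a| ≤ 1) (N x : ℝ) :
    0 ≤ modulatedBase w a N x :=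
  mul_nonneg ((isDensity_scaledBase hw).nonneg x)
    (by linarith [(abs_le.1 (abs_mul_cos_le ha (N * x))).1])

theorem modulatedBase_le {w a : ℝ} (hw : 0 < w) (ha : |a| ≤ 1) (N x : ℝ) :
    modulatedBase w a N x ≤ 2 * w := by
  rw [mul_comm]
  exact mul_le_mul (scaledBase_le hw x) (by linarith [(abs_le.1 (abs_mul_cos_le ha (N * x))).2])
    (by linarith [(abs_le.1 (abs_mul_cos_le ha (N * x))).1]) hw.le

theorem ft_modulatedBase {w : ℝ} (hw : 0 < w) (a N u : ℝ) :
    ft (fun x => (modulatedBase w a N x : ℂ)) u = cf (scaledBase w) u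
      + a / 2 * (cf (scaledBase w) (u + N) + cf (scaledBase w) (u - N)) := by
  have e : (fun x => (modulatedBase w a N x : ℂ)) = fun x => (scaledBase w x : ℂ)
      + (a : ℂ) * ((scaledBase w x * Real.cos (N * x) : ℝ) : ℂ) := by
    funext x
    rw [modulatedBase_eq]
    push_cast
    ring
  rw [e, ft_add (integrable_ofReal (integrable_scaledBase hw))
    ((integrable_ofReal (integrable_scaledBase_mul_cos hw N)).const_mul _), ft_const_mul,
    ft_mul_cos (integrable_scaledBase hw), (isDensity_scaledBase hw).cf_eq_ft]
  ring

theorem isDensity_modulatedBase {w a N : ℝ} (hw : 0 < w) (ha : |a| ≤ 1) (hN : w ≤ N) :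
    IsDensity (modulatedBase w a N) := by
  refine ⟨(contDiff_modulatedBase w a N).continuous.measurable, modulatedBase_nonneg hw ha N,
    integrable_modulatedBase hw a N, ?_⟩
  have hN' : w ≤ |N| := hN.trans (le_abs_self N)
  have h := ft_modulatedBase hw a N 0
  rw [zero_add, zero_sub, cf_neg, cf_scaledBase_eq_zero hw hN', map_zero, add_zero, mul_zero,
    add_zero, (isDensity_scaledBase hw).cf_eq_ft] at h
  simp only [ft, Complex.ofReal_zero, mul_zero, zero_mul, Complex.exp_zero, one_mul] at h
  rw [integral_complex_ofReal, integral_complex_ofReal,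
    (isDensity_scaledBase hw).integral_eq_one] at h
  exact_mod_cast h

theorem memLp_modulatedBase {w a : ℝ} (hw : 0 < w) (ha : |a| ≤ 1) (N : ℝ) :
    MemLp (modulatedBase w a N) 2 :=
  memLp_two_of_bounded (integrable_modulatedBase hw a N) (C := 2 * w) fun x => by
    rw [abs_of_nonneg (modulatedBase_nonneg hw ha N x)]
    exact modulatedBase_le hw ha N x

theorem cf_modulatedBase {w a N : ℝ} (hw : 0 < w) (ha : |a| ≤ 1) (hN : w ≤ N) (u : ℝ) :
    cf (modulatedBase w a N) u = cf (scaledBase w) u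
      + a / 2 * (cf (scaledBase w) (u + N) + cf (scaledBase w) (u - N)) := by
  rw [(isDensity_modulatedBase hw ha hN).cf_eq_ft, ft_modulatedBase hw]

/-- Since N ≥ 2w, at most one of the three translates of the characteristic function is nonzero at a
given u, so there are no cross terms. -/
theorem norm_cf_modulatedBase_sq {w a N : ℝ} (hw : 0 < w) (ha : |a| ≤ 1) (hN : 2 * w ≤ N) (u : ℝ) :
    ‖cf (modulatedBase w a N) u‖ ^ 2 = ‖cf (scaledBase w) u‖ ^ 2
      + a ^ 2 / 4 * (‖cf (scaledBase w) (u + N)‖ ^ 2 + ‖cf (scaledBase w) (u - N)‖ ^ 2) := by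
  rw [cf_modulatedBase hw ha (by linarith)]
  have hna : ‖(a : ℂ) / 2‖ ^ 2 = a ^ 2 / 4 := by
    rw [norm_div, Complex.norm_real, div_pow, Real.norm_eq_abs, sq_abs, Complex.norm_ofNat]
    norm_num
  by_cases h1 : w ≤ |u|
  · rw [cf_scaledBase_eq_zero hw h1]
    by_cases h2 : w ≤ |u + N|
    · rw [cf_scaledBase_eq_zero hw h2]
      simp only [zero_add, norm_mul, mul_pow, hna, norm_zero]
      ring
    · have h3 : w ≤ |u - N| := by
        rw [not_le, abs_lt] at h2
        rw [le_abs]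
        right
        linarith
      rw [cf_scaledBase_eq_zero hw h3]
      simp only [zero_add, add_zero, norm_mul, mul_pow, hna, norm_zero]
      ring
  · rw [not_le, abs_lt] at h1
    have h2 : w ≤ |u + N| := by rw [le_abs]; left; linarith
    have h3 : w ≤ |u - N| := by rw [le_abs]; right; linarith
    rw [cf_scaledBase_eq_zero hw h2, cf_scaledBase_eq_zero hw h3]
    simp

theorem quadFunctional_modulatedBase {w a N : ℝ} (hw : 0 < w) (ha : |a| ≤ 1) (hN : 2 * w ≤ N) :
    quadFunctional (modulatedBase w a N)
      = quadFunctional (scaledBase w) + a ^ 2 / 2 * quadFunctional (scaledBase w) := by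
  have hi := (isDensity_scaledBase hw).integrable_norm_cf_sq (memLp_scaledBase hw)
  have h1 := (isDensity_modulatedBase hw ha (by linarith : w ≤ N)).integral_norm_cf_sq
    (memLp_modulatedBase hw ha N)
  have h0 := (isDensity_scaledBase hw).integral_norm_cf_sq (memLp_scaledBase hw)
  simp only [norm_cf_modulatedBase_sq hw ha hN] at h1
  have ip : Integrable fun u => ‖cf (scaledBase w) (u + N)‖ ^ 2 := hi.comp_add_right N
  have im : Integrable fun u => ‖cf (scaledBase w) (u - N)‖ ^ 2 := hi.comp_sub_right N
  have ipm : Integrable fun u =>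
      ‖cf (scaledBase w) (u + N)‖ ^ 2 + ‖cf (scaledBase w) (u - N)‖ ^ 2 := ip.add im
  rw [integral_add hi (ipm.const_mul _), integral_const_mul, integral_add ip im,
    integral_add_right_eq_self (fun u => ‖cf (scaledBase w) u‖ ^ 2),
    integral_sub_right_eq_self (fun u => ‖cf (scaledBase w) u‖ ^ 2), h0] at h1
  have hpi : (2 * Real.pi) ≠ 0 := by positivity
  refine mul_left_cancel₀ hpi (h1.symm.trans ?_)
  ring

/-! ### Likelihood ratios of product measures and Le Cam's bound. -/

theorem lintegral_pi_prod {Ω : Type*} [MeasurableSpace Ω] (μ : Measure Ω) [IsProbabilityMeasure μ]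
    {n : ℕ} {F : Fin n → Ω → ℝ≥0∞} (hF : ∀ i, Measurable (F i)) :
    ∫⁻ Y, ∏ i, F i (Y i) ∂(Measure.pi fun _ : Fin n => μ) = ∏ i, ∫⁻ y, F i y ∂μ := by
  have hind := ProbabilityTheory.iIndepFun_pi (μ := fun _ : Fin n => μ) (X := F)
    fun i => (hF i).aemeasurable
  rw [ProbabilityTheory.lintegral_prod_eq_prod_lintegral_of_indepFun Finset.univ _ hind
    fun i => (hF i).comp (measurable_pi_apply i)]
  refine Finset.prod_congr rfl fun i _ => ?_
  exact (measurePreserving_eval (fun _ : Fin n => μ) i).lintegral_comp (hF i)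

theorem pi_withDensity {Ω : Type*} [MeasurableSpace Ω] (μ : Measure Ω) [IsProbabilityMeasure μ]
    {l : Ω → ℝ≥0∞} (hl : Measurable l) [IsProbabilityMeasure (μ.withDensity l)] (n : ℕ) :
    Measure.pi (fun _ : Fin n => μ.withDensity l)
      = (Measure.pi fun _ : Fin n => μ).withDensity fun Y => ∏ i, l (Y i) := by
  refine Measure.pi_eq fun A hA => ?_
  rw [withDensity_apply _ (MeasurableSet.univ_pi hA),
    ← lintegral_indicator (MeasurableSet.univ_pi hA)]
  have e : ∀ Y : Fin n → Ω, (Set.univ.pi A).indicator (fun Y => ∏ i, l (Y i)) Y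
      = ∏ i, (A i).indicator l (Y i) := fun Y => by
    by_cases hY : Y ∈ Set.univ.pi A
    · rw [Set.indicator_of_mem hY]
      exact Finset.prod_congr rfl fun i _ => (Set.indicator_of_mem (hY i trivial) l).symm
    · rw [Set.indicator_of_notMem hY]
      simp only [Set.mem_pi, Set.mem_univ, true_implies, not_forall] at hY
      obtain ⟨i, hi⟩ := hY
      exact (Finset.prod_eq_zero (Finset.mem_univ i) (Set.indicator_of_notMem hi l)).symm
  simp only [e]
  rw [lintegral_pi_prod μ fun i => hl.indicator (hA i)]
  refine Finset.prod_congr rfl fun i _ => ?_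
  rw [lintegral_indicator (hA i), withDensity_apply _ (hA i)]

/-- When x ≥ 1 this is (x/2 - 1)² ≥ 0. With x a likelihood ratio, a second moment bound gives a
lower bound for the integral of min(1, x), the overlap of the two laws. -/
theorem le_min_one_add_sq (x : ℝ≥0∞) : x ≤ min 1 x + ENNReal.ofReal (1 / 4) * x ^ 2 := by
  induction x with
  | top =>
    have : ENNReal.ofReal (1 / 4) * (⊤ : ℝ≥0∞) ^ 2 = ⊤ := by
      rw [ENNReal.top_pow two_ne_zero, ENNReal.mul_top]
      simp
    rw [this]
    simp
  | coe x =>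
    rcases le_total (x : ℝ≥0∞) 1 with h | h
    · rw [min_eq_right h]
      exact self_le_add_right _ _
    · rw [min_eq_left h]
      have h1 : (x : ℝ≥0∞) = ENNReal.ofReal x := (ENNReal.ofReal_coe_nnreal).symm
      rw [h1, ← ENNReal.ofReal_pow x.coe_nonneg, ← ENNReal.ofReal_mul (by norm_num), ← ENNReal.ofReal_one,
        ← ENNReal.ofReal_add zero_le_one (by positivity)]
      refine ENNReal.ofReal_le_ofReal ?_
      nlinarith [sq_nonneg ((x : ℝ) / 2 - 1)]

/-- **Le Cam's two point bound** under a bound on the `χ²` divergence of the marginals. -/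
theorem two_point_bound {Ω : Type*} [MeasurableSpace Ω] (μ : Measure Ω) [IsProbabilityMeasure μ]
    {l : Ω → ℝ≥0∞} (hl : Measurable l) [hl1 : IsProbabilityMeasure (μ.withDensity l)]
    {n : ℕ} (hn : 0 < n) (hl2 : ∫⁻ y, l y ^ 2 ∂μ ≤ ENNReal.ofReal (1 + 1 / n))
    {T : (Fin n → Ω) → ℝ} (hT : Measurable T) (d₀ d₁ : ℝ) :
    ENNReal.ofReal (|d₁ - d₀| / 4) ≤ ∫⁻ Y, ENNReal.ofReal |T Y - d₀| ∂(Measure.pi fun _ => μ)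
      + ∫⁻ Y, ENNReal.ofReal |T Y - d₁| ∂(Measure.pi fun _ => μ.withDensity l) := by
  set P := Measure.pi fun _ : Fin n => μ with hP
  set Λ : (Fin n → Ω) → ℝ≥0∞ := fun Y => ∏ i, l (Y i) with hΛ
  have hΛm : Measurable Λ :=
    Finset.measurable_fun_prod _ fun i _ => hl.comp (measurable_pi_apply i)
  have hn0 : (0 : ℝ) < n := by exact_mod_cast hn
  have hl1' : ∫⁻ y, l y ∂μ = 1 := by
    have := hl1.measure_univ
    rwa [withDensity_apply _ MeasurableSet.univ, Measure.restrict_univ] at this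
  have hΛ1 : ∫⁻ Y, Λ Y ∂P = 1 := by
    rw [hΛ, hP, lintegral_pi_prod μ fun _ => hl]
    simp [hl1']
  -- By independence the second moment is at most (1 + 1/n)ⁿ ≤ e ≤ 3, which leaves an overlap of at
  -- least 1 - 3/4.
  have hΛ2 : ∫⁻ Y, Λ Y ^ 2 ∂P ≤ ENNReal.ofReal 3 := by
    have e : ∀ Y, Λ Y ^ 2 = ∏ i, l (Y i) ^ 2 := fun Y => (Finset.prod_pow _ _ _).symm
    simp only [e]
    rw [hP, lintegral_pi_prod μ fun _ => hl.pow_const 2, Finset.prod_const, Finset.card_univ,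
      Fintype.card_fin]
    refine (pow_le_pow_left' hl2 n).trans ?_
    rw [← ENNReal.ofReal_pow (by positivity)]
    refine ENNReal.ofReal_le_ofReal ?_
    calc (1 + 1 / (n : ℝ)) ^ n ≤ Real.exp (1 / n) ^ n := by
          gcongr
          linarith [Real.add_one_le_exp (1 / (n : ℝ))]
      _ = Real.exp 1 := by
          rw [← Real.exp_nat_mul]
          congr 1
          field_simp
      _ ≤ 3 := Real.exp_one_lt_three.le
  set Δ := ENNReal.ofReal |d₁ - d₀| with hΔ
  -- The triangle inequality through T Y is multiplied by min(1, Λ), which is bounded by 1 in the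
  -- first term and by Λ in the second.
  have hpt : ∀ Y, Δ * Λ Y ≤ (ENNReal.ofReal |T Y - d₀| + ENNReal.ofReal |T Y - d₁| * Λ Y)
      + Δ * ENNReal.ofReal (1 / 4) * Λ Y ^ 2 := fun Y => by
    have htri : Δ ≤ ENNReal.ofReal |T Y - d₀| + ENNReal.ofReal |T Y - d₁| := by
      rw [← ENNReal.ofReal_add (abs_nonneg _) (abs_nonneg _)]
      refine ENNReal.ofReal_le_ofReal ?_
      rw [abs_sub_comm (T Y) d₁, add_comm]
      exact abs_sub_le d₁ (T Y) d₀
    calc Δ * Λ Y ≤ Δ * (min 1 (Λ Y) + ENNReal.ofReal (1 / 4) * Λ Y ^ 2) := by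
          gcongr
          exact le_min_one_add_sq _
      _ = Δ * min 1 (Λ Y) + Δ * ENNReal.ofReal (1 / 4) * Λ Y ^ 2 := by ring
      _ ≤ (ENNReal.ofReal |T Y - d₀| + ENNReal.ofReal |T Y - d₁|) * min 1 (Λ Y)
          + Δ * ENNReal.ofReal (1 / 4) * Λ Y ^ 2 := by gcongr
      _ ≤ _ := by
          gcongr
          rw [add_mul]
          gcongr
          · exact mul_le_of_le_one_right' (min_le_left _ _)
          · exact min_le_right _ _
  have hTd : ∀ d, Measurable fun Y => ENNReal.ofReal |T Y - d| := fun d => by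
    have : Measurable fun Y => T Y - d := hT.sub_const d
    exact this.abs.ennreal_ofReal
  have hR1 : ∫⁻ Y, ENNReal.ofReal |T Y - d₁| ∂(Measure.pi fun _ => μ.withDensity l)
      = ∫⁻ Y, ENNReal.ofReal |T Y - d₁| * Λ Y ∂P := by
    rw [pi_withDensity μ hl n, lintegral_withDensity_eq_lintegral_mul _ hΛm (hTd _)]
    exact lintegral_congr fun Y => mul_comm _ _
  rw [hR1]
  set R := ∫⁻ Y, ENNReal.ofReal |T Y - d₀| ∂P + ∫⁻ Y, ENNReal.ofReal |T Y - d₁| * Λ Y ∂P with hR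
  have hmain : Δ ≤ R + ENNReal.ofReal (3 / 4) * Δ := by
    calc Δ = ∫⁻ Y, Δ * Λ Y ∂P := by rw [lintegral_const_mul _ hΛm, hΛ1, mul_one]
      _ ≤ ∫⁻ Y, ((ENNReal.ofReal |T Y - d₀| + ENNReal.ofReal |T Y - d₁| * Λ Y)
          + Δ * ENNReal.ofReal (1 / 4) * Λ Y ^ 2) ∂P := lintegral_mono hpt
      _ = R + Δ * ENNReal.ofReal (1 / 4) * ∫⁻ Y, Λ Y ^ 2 ∂P := by
          rw [lintegral_add_right _ ((hΛm.pow_const 2).const_mul _), lintegral_add_left (hTd _),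
            lintegral_const_mul _ (hΛm.pow_const 2)]
      _ ≤ R + Δ * ENNReal.ofReal (1 / 4) * ENNReal.ofReal 3 := by gcongr
      _ = _ := by
          rw [mul_assoc, ← ENNReal.ofReal_mul (by norm_num), mul_comm Δ]
          norm_num
  have hsplit : Δ = ENNReal.ofReal (|d₁ - d₀| / 4) + ENNReal.ofReal (3 / 4) * Δ := by
    rw [hΔ, ← ENNReal.ofReal_mul (by norm_num), ← ENNReal.ofReal_add (by positivity) (by positivity)]
    congr 1
    ring
  rw [hsplit] at hmain
  nth_rw 2 [← hsplit] at hmain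
  exact (ENNReal.add_le_add_iff_right (by finiteness)).1 hmain

/-! ### Density of the observations and its lower bound. -/

/-- The density `x ↦ ∫ g(y) f(x - y) dy` of an observation. -/
def convDensity (g f : ℝ → ℝ) (x : ℝ) : ℝ := ∫ y, g y * f (x - y)

theorem integrable_mul_comp_sub {g f : ℝ → ℝ} (hg : IsDensity g) (hf : IsDensity f) {B : ℝ}
    (hB : ∀ x, f x ≤ B) (x : ℝ) : Integrable fun y => g y * f (x - y) :=
  hg.integrable.mul_bdd (c := B)
    (Measurable.aestronglyMeasurable (hf.measurable.comp (measurable_const.sub measurable_id)))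
    (Eventually.of_forall fun y => by rw [Real.norm_of_nonneg (hf.nonneg _)]; exact hB _)

theorem ofReal_convDensity {g f : ℝ → ℝ} (hg : IsDensity g) (hf : IsDensity f) {B : ℝ}
    (hB : ∀ x, f x ≤ B) (x : ℝ) : ENNReal.ofReal (convDensity g f x)
      = ∫⁻ y, ENNReal.ofReal (g y) * ENNReal.ofReal (f (-y + x)) := by
  rw [convDensity, ofReal_integral_eq_lintegral_ofReal (integrable_mul_comp_sub hg hf hB x)
    (Eventually.of_forall fun y => mul_nonneg (hg.nonneg _) (hf.nonneg _))]
  refine lintegral_congr fun y => ?_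
  rw [ENNReal.ofReal_mul (hg.nonneg y), neg_add_eq_sub]

theorem conv_eq_densityMeasure {g f : ℝ → ℝ} (hg : IsDensity g) (hf : IsDensity f) {B : ℝ}
    (hB : ∀ x, f x ≤ B) :
    (densityMeasure f).conv (densityMeasure g) = densityMeasure (convDensity g f) := by
  have h1 := hf.measurable
  have h2 := hg.measurable
  have := hf.isProbabilityMeasure
  have := hg.isProbabilityMeasure
  rw [Measure.conv_comm, densityMeasure, densityMeasure, densityMeasure,
    conv_withDensity_eq_lconvolution (by fun_prop) (by fun_prop)]
  congr 1
  funext x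
  rw [ofReal_convDensity hg hf hB, lconvolution_def]

theorem isDensity_convDensity {g f : ℝ → ℝ} (hg : IsDensity g) (hf : IsDensity f) {B : ℝ}
    (hB : ∀ x, f x ≤ B) : IsDensity (convDensity g f) := by
  have hm : Measurable (convDensity g f) := by
    have h1 := hf.measurable
    have h2 := hg.measurable
    refine (StronglyMeasurable.integral_prod_right (f := fun x y => g y * f (x - y)) ?_).measurable
    refine Measurable.stronglyMeasurable ?_
    unfold Function.uncurry
    fun_prop
  have h0 : ∀ x, 0 ≤ convDensity g f x := fun x =>
    integral_nonneg fun y => mul_nonneg (hg.nonneg _) (hf.nonneg _)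
  have hl : ∫⁻ x, ENNReal.ofReal (convDensity g f x) = 1 := by
    have := hf.isProbabilityMeasure
    have := hg.isProbabilityMeasure
    have h : ((densityMeasure f).conv (densityMeasure g)) Set.univ = 1 := measure_univ
    rwa [conv_eq_densityMeasure hg hf hB, densityMeasure, withDensity_apply _ MeasurableSet.univ,
      Measure.restrict_univ] at h
  have hi : Integrable (convDensity g f) := by
    refine ⟨hm.aestronglyMeasurable, ?_⟩
    rw [hasFiniteIntegral_iff_ofReal (Eventually.of_forall h0), hl]
    exact ENNReal.one_lt_top
  refine ⟨hm, h0, hi, ?_⟩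
  have h := ofReal_integral_eq_lintegral_ofReal hi (Eventually.of_forall h0)
  rw [hl, ENNReal.ofReal_eq_one] at h
  exact h

theorem convDensity_le {g f : ℝ → ℝ} (hg : IsDensity g) (hf : IsDensity f) {B : ℝ}
    (hB : ∀ x, f x ≤ B) (x : ℝ) : convDensity g f x ≤ B := by
  calc convDensity g f x ≤ ∫ y, g y * B :=
        integral_mono (integrable_mul_comp_sub hg hf hB x) (hg.integrable.mul_const B)
          fun y => mul_le_mul_of_nonneg_left (hB _) (hg.nonneg y)
    _ = B := by rw [integral_mul_const, hg.integral_eq_one, one_mul]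

theorem cf_convDensity {g f : ℝ → ℝ} (hg : IsDensity g) (hf : IsDensity f) {B : ℝ}
    (hB : ∀ x, f x ≤ B) (u : ℝ) : cf (convDensity g f) u = cf f u * cf g u := by
  have := hf.isProbabilityMeasure
  have := hg.isProbabilityMeasure
  rw [cf, ← conv_eq_densityMeasure hg hf hB]
  exact charFun_conv u

theorem memLp_convDensity {g f : ℝ → ℝ} (hg : IsDensity g) (hf : IsDensity f) {B : ℝ}
    (hB : ∀ x, f x ≤ B) : MemLp (convDensity g f) 2 :=
  memLp_two_of_bounded (isDensity_convDensity hg hf hB).integrable (C := B) fun x => by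
    rw [abs_of_nonneg ((isDensity_convDensity hg hf hB).nonneg x)]
    exact convDensity_le hg hf hB x

/-- The 80 is 4 · 20, from π ≤ 4 and (|wx| + π)² ≤ 20(1 + x²). -/
theorem le_scaledBase {w : ℝ} (hw : 0 < w) (hw1 : w ≤ 1) (x : ℝ) :
    w / 80 * (1 + x ^ 2)⁻¹ ≤ scaledBase w x := by
  have h1 := le_sq_mul_baseDensity (w * x)
  have h2 : (|w * x| + Real.pi) ^ 2 ≤ 20 * (1 + x ^ 2) := by
    have h3 : |w * x| ≤ |x| := by
      rw [abs_mul, abs_of_pos hw]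
      exact mul_le_of_le_one_left (abs_nonneg x) hw1
    have h4 : Real.pi ^ 2 ≤ 10 := by nlinarith [Real.pi_lt_d2, Real.pi_pos]
    calc (|w * x| + Real.pi) ^ 2 ≤ (|x| + Real.pi) ^ 2 := by
          have := Real.pi_pos
          gcongr
      _ ≤ 2 * |x| ^ 2 + 2 * Real.pi ^ 2 := by nlinarith [sq_nonneg (|x| - Real.pi)]
      _ ≤ _ := by rw [sq_abs]; nlinarith [sq_nonneg x]
  have h5 : 1 / 4 ≤ 1 / Real.pi := one_div_le_one_div_of_le Real.pi_pos Real.pi_le_four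
  have h6 : 1 / 4 ≤ 20 * (1 + x ^ 2) * baseDensity (w * x) :=
    h5.trans (h1.trans (mul_le_mul_of_nonneg_right h2 (baseDensity_nonneg _)))
  have h7 : 0 < 1 + x ^ 2 := by positivity
  unfold scaledBase
  rw [← div_eq_mul_inv, div_div, div_le_iff₀ (by positivity)]
  nlinarith

theorem integral_inv_one_add_sq_pos {g : ℝ → ℝ} (hg : IsDensity g) :
    0 < ∫ y, g y * (1 + y ^ 2)⁻¹ := by
  have hnn : 0 ≤ fun y => g y * (1 + y ^ 2)⁻¹ := fun y => mul_nonneg (hg.nonneg y) (by positivity)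
  have hi : Integrable fun y => g y * (1 + y ^ 2)⁻¹ := by
    refine hg.integrable.mul_bdd (c := 1) (Measurable.aestronglyMeasurable (by fun_prop))
      (Eventually.of_forall fun y => ?_)
    rw [Real.norm_of_nonneg (by positivity)]
    exact inv_le_one_of_one_le₀ (by nlinarith [sq_nonneg y])
  rw [integral_pos_iff_support_of_nonneg hnn hi]
  have hsupp : Function.support (fun y => g y * (1 + y ^ 2)⁻¹) = Function.support g := by
    ext y
    have : (1 + y ^ 2 : ℝ) ≠ 0 := by positivity
    simp [this]
  rw [hsupp, ← integral_pos_iff_support_of_nonneg hg.nonneg hg.integrable, hg.integral_eq_one]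
  exact one_pos

/-- Convolution preserves x⁻² tails from below, because 1 + (x-y)² ≤ 2(1+x²)(1+y²); no assumption on
the tails of g is needed, and κ is uniform in w. -/
theorem exists_le_convDensity_scaledBase {g : ℝ → ℝ} (hg : IsDensity g) :
    ∃ κ, 0 < κ ∧ ∀ w, 0 < w → w ≤ 1 → ∀ x,
      κ * w * (1 + x ^ 2)⁻¹ ≤ convDensity g (scaledBase w) x := by
  refine ⟨(∫ y, g y * (1 + y ^ 2)⁻¹) / 160,
    div_pos (integral_inv_one_add_sq_pos hg) (by norm_num), fun w hw hw1 x => ?_⟩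
  -- A nonintegrable function would have integral 0 by convention, contradicting positivity.
  have hi : Integrable fun y => g y * (1 + y ^ 2)⁻¹ := by
    by_contra hcon
    exact (integral_inv_one_add_sq_pos hg).ne' (integral_undef hcon)
  calc _ = ∫ y, w / 160 * (1 + x ^ 2)⁻¹ * (g y * (1 + y ^ 2)⁻¹) := by
        rw [integral_const_mul]
        ring
    _ ≤ _ := by
        refine integral_mono (hi.const_mul _) (integrable_mul_comp_sub hg (isDensity_scaledBase hw)
          (scaledBase_le hw) x) fun y => ?_
        have h1 := le_scaledBase hw hw1 (x - y)
        have h2 : (2 * ((1 + x ^ 2) * (1 + y ^ 2)))⁻¹ ≤ (1 + (x - y) ^ 2)⁻¹ := by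
          apply inv_anti₀ (by positivity)
          nlinarith [sq_nonneg (x + y), sq_nonneg (x * y)]
        calc w / 160 * (1 + x ^ 2)⁻¹ * (g y * (1 + y ^ 2)⁻¹)
            = g y * (w / 80 * (2 * ((1 + x ^ 2) * (1 + y ^ 2)))⁻¹) := by
              rw [mul_inv, mul_inv]
              ring
          _ ≤ g y * (w / 80 * (1 + (x - y) ^ 2)⁻¹) := by
              have := hg.nonneg y
              gcongr
          _ ≤ _ := mul_le_mul_of_nonneg_left h1 (hg.nonneg y)

/-! ### Weighted L² bounds from the Fourier transform. -/

theorem lintegral_sq_le_of_ft {G : ℝ → ℂ} (h1 : Integrable G) (h2 : MemLp G 2) {D b : ℝ}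
    (hD : ∀ u, ‖ft G u‖ ≤ (Set.Icc (-b) b).indicator (fun _ => D) u) :
    ∫⁻ x, ENNReal.ofReal (‖G x‖ ^ 2) ≤ ENNReal.ofReal (D ^ 2 * (2 * b)) := by
  have h2i : Integrable fun x => ‖G x‖ ^ 2 :=
    (memLp_two_iff_integrable_sq_norm h1.aestronglyMeasurable).1 h2
  have hpl := lintegral_norm_ft_sq h1 h2
  rw [← ofReal_integral_eq_lintegral_ofReal h2i (Eventually.of_forall fun x => by positivity)]
  calc ENNReal.ofReal (∫ x, ‖G x‖ ^ 2) ≤ ENNReal.ofReal (2 * Real.pi * ∫ x, ‖G x‖ ^ 2) := by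
        refine ENNReal.ofReal_le_ofReal (le_mul_of_one_le_left
          (integral_nonneg fun x => by positivity) ?_)
        linarith [Real.pi_gt_three]
    _ = ∫⁻ u, ENNReal.ofReal (‖ft G u‖ ^ 2) := hpl.symm
    _ ≤ ∫⁻ u, (Set.Icc (-b) b).indicator (fun _ => ENNReal.ofReal (D ^ 2)) u := by
        refine lintegral_mono fun u => ?_
        have := hD u
        by_cases hu : u ∈ Set.Icc (-b) b
        · rw [Set.indicator_of_mem hu] at this ⊢
          gcongr
        · rw [Set.indicator_of_notMem hu] at this ⊢
          rw [le_antisymm this (norm_nonneg _)]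
          simp
    _ = _ := by
        rw [lintegral_indicator measurableSet_Icc, setLIntegral_const, Real.volume_Icc,
          ← ENNReal.ofReal_mul (by positivity)]
        congr 2
        ring

/-- Multiplication by x is the limit of multiplication by (exp(iδx) - 1)/δ, which becomes a
difference quotient of the transform. Plancherel for each δ and Fatou's lemma give the bound,
without assuming that xG is integrable or that the transform is differentiable. -/
theorem lintegral_sq_mul_sq_le_of_ft {G : ℝ → ℂ} (h1 : Integrable G) (h2 : MemLp G 2) {D b d : ℝ}
    (hd : 0 < d)
    (hD : ∀ δ, 0 < δ → δ < d → ∀ u,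
      ‖ft G (u + δ) - ft G u‖ ≤ (Set.Icc (-b) b).indicator (fun _ => D * δ) u) :
    ∫⁻ x, ENNReal.ofReal (x ^ 2 * ‖G x‖ ^ 2) ≤ ENNReal.ofReal (D ^ 2 * (2 * b)) := by
  -- The shift by 2 makes every step strictly smaller than d, the first one included.
  set δ : ℕ → ℝ := fun k => d / (k + 2) with hδ
  have hδ0 : ∀ k, 0 < δ k := fun k => by positivity
  have hδd : ∀ k, δ k < d := fun k => by
    rw [hδ, div_lt_iff₀ (by positivity)]
    nlinarith [Nat.cast_nonneg (α := ℝ) k]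
  have hδlim : Tendsto δ atTop (𝓝[≠] 0) := by
    refine tendsto_nhdsWithin_iff.2 ⟨?_, Eventually.of_forall fun k => (hδ0 k).ne'⟩
    exact tendsto_const_nhds.div_atTop (tendsto_atTop_add_const_right _ _ tendsto_natCast_atTop_atTop)
  set H : ℕ → ℝ → ℂ := fun k x =>
    (δ k : ℂ)⁻¹ * (Complex.exp (x * δ k * Complex.I) * G x + (-1) * G x) with hH
  have hexpi : ∀ k, Integrable fun x : ℝ => Complex.exp (x * δ k * Complex.I) * G x := fun k =>
    integrable_exp_mul h1 (δ k)
  have hexp2 : ∀ k, MemLp (fun x : ℝ => Complex.exp (x * δ k * Complex.I) * G x) 2 := fun k => by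
    refine h2.of_le (hexpi k).aestronglyMeasurable (Eventually.of_forall fun x => ?_)
    rw [norm_mul, ← Complex.ofReal_mul, Complex.norm_exp_ofReal_mul_I, one_mul]
  have hH1 : ∀ k, Integrable (H k) := fun k => ((hexpi k).add (h1.const_mul _)).const_mul _
  have hH2 : ∀ k, MemLp (H k) 2 := fun k => ((hexp2 k).add (h2.const_mul _)).const_mul _
  have hHft : ∀ k u, ft (H k) u = (δ k : ℂ)⁻¹ * (ft G (u + δ k) - ft G u) := fun k u => by
    rw [hH, ft_const_mul, ft_add (hexpi k) (h1.const_mul _), ft_mul_exp, ft_const_mul]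
    ring
  have hbound : ∀ k, ∫⁻ x, ENNReal.ofReal (‖H k x‖ ^ 2) ≤ ENNReal.ofReal (D ^ 2 * (2 * b)) :=
    fun k => by
      refine lintegral_sq_le_of_ft (hH1 k) (hH2 k) fun u => ?_
      have := hD (δ k) (hδ0 k) (hδd k) u
      rw [hHft, norm_mul, norm_inv, Complex.norm_real, Real.norm_of_nonneg (hδ0 k).le,
        inv_mul_le_iff₀ (hδ0 k)]
      refine this.trans_eq ?_
      by_cases hu : u ∈ Set.Icc (-b) b
      · rw [Set.indicator_of_mem hu, Set.indicator_of_mem hu, mul_comm]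
      · rw [Set.indicator_of_notMem hu, Set.indicator_of_notMem hu, mul_zero]
  have hlim : ∀ x, Tendsto (fun k => ENNReal.ofReal (‖H k x‖ ^ 2)) atTop
      (𝓝 (ENNReal.ofReal (x ^ 2 * ‖G x‖ ^ 2))) := fun x => by
    have hder : HasDerivAt (fun t : ℝ => Complex.exp (x * t * Complex.I)) (x * Complex.I) 0 := by
      have h3 : HasDerivAt (fun t : ℝ => (x : ℂ) * (t : ℂ) * Complex.I) (x * Complex.I) 0 := by
        have := ((Complex.ofRealCLM.hasDerivAt (x := (0 : ℝ))).const_mul (x : ℂ)).mul_const Complex.I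
        simpa using this
      simpa using h3.cexp
    have h4 := hder.tendsto_slope_zero.comp hδlim
    have h5 : Tendsto (fun k => H k x) atTop (𝓝 (x * Complex.I * G x)) := by
      refine (h4.mul_const (G x)).congr fun k => ?_
      simp only [Function.comp, hH, zero_add, Complex.ofReal_zero, mul_zero, zero_mul,
        Complex.exp_zero, Complex.real_smul]
      push_cast
      ring
    have h6 : ‖(x : ℂ) * Complex.I * G x‖ ^ 2 = x ^ 2 * ‖G x‖ ^ 2 := by
      rw [norm_mul, norm_mul, Complex.norm_I, mul_one, Complex.norm_real, mul_pow, Real.norm_eq_abs,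
        sq_abs]
    rw [← h6]
    exact ENNReal.tendsto_ofReal (h5.norm.pow 2)
  calc ∫⁻ x, ENNReal.ofReal (x ^ 2 * ‖G x‖ ^ 2)
      = ∫⁻ x, liminf (fun k => ENNReal.ofReal (‖H k x‖ ^ 2)) atTop :=
        lintegral_congr fun x => (hlim x).liminf_eq.symm
    _ ≤ liminf (fun k => ∫⁻ x, ENNReal.ofReal (‖H k x‖ ^ 2)) atTop :=
        lintegral_liminf_le' fun k => ((hH1 k).aestronglyMeasurable.norm.aemeasurable.pow_const
          2).ennreal_ofReal
    _ ≤ _ := by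
        refine liminf_le_of_frequently_le' (Eventually.of_forall hbound).frequently

/-! ### The χ² divergence between the two hypotheses. -/

/-- The perturbation of the characteristic function caused by the modulation. -/
def modulationBump (w a N u : ℝ) : ℂ :=
  a / 2 * (cf (scaledBase w) (u + N) + cf (scaledBase w) (u - N))

theorem modulationBump_eq_zero {w a N u : ℝ} (hw : 0 < w) (hN : 0 ≤ N)
    (hu : |u| ≤ N - w ∨ N + w ≤ |u|) : modulationBump w a N u = 0 := by
  have h : w ≤ |u + N| ∧ w ≤ |u - N| := by
    rcases hu with h | h
    · obtain ⟨h1, h2⟩ := abs_le.1 h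
      exact ⟨le_abs.2 (Or.inl (by linarith)), le_abs.2 (Or.inr (by linarith))⟩
    · rcases le_abs.1 h with h | h
      · exact ⟨le_abs.2 (Or.inl (by linarith)), le_abs.2 (Or.inl (by linarith))⟩
      · exact ⟨le_abs.2 (Or.inr (by linarith)), le_abs.2 (Or.inr (by linarith))⟩
  rw [modulationBump, cf_scaledBase_eq_zero hw h.1, cf_scaledBase_eq_zero hw h.2]
  simp

theorem norm_modulationBump_le {w : ℝ} (hw : 0 < w) (a N u : ℝ) :
    ‖modulationBump w a N u‖ ≤ |a| := by
  have h1 := (isDensity_scaledBase hw).norm_cf_le_one (u + N)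
  have h2 := (isDensity_scaledBase hw).norm_cf_le_one (u - N)
  rw [modulationBump, norm_mul, norm_div, Complex.norm_real, Complex.norm_ofNat, Real.norm_eq_abs]
  calc _ ≤ |a| / 2 * (1 + 1) := by
        gcongr
        exact (norm_add_le _ _).trans (add_le_add h1 h2)
    _ = |a| := by ring

theorem norm_modulationBump_sub_le {w : ℝ} (hw : 0 < w) (a N u v : ℝ) :
    ‖modulationBump w a N u - modulationBump w a N v‖ ≤ |a| * (5 / w) * |u - v| := by
  have h1 := norm_cf_scaledBase_sub_le hw (u + N) (v + N)
  have h2 := norm_cf_scaledBase_sub_le hw (u - N) (v - N)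
  rw [add_sub_add_right_eq_sub] at h1
  rw [sub_sub_sub_cancel_right] at h2
  have e : modulationBump w a N u - modulationBump w a N v = a / 2 *
      ((cf (scaledBase w) (u + N) - cf (scaledBase w) (v + N))
        + (cf (scaledBase w) (u - N) - cf (scaledBase w) (v - N))) := by
    unfold modulationBump
    ring
  rw [e, norm_mul, norm_div, Complex.norm_real, Complex.norm_ofNat, Real.norm_eq_abs]
  calc _ ≤ |a| / 2 * (5 / w * |u - v| + 5 / w * |u - v|) := by
        gcongr
        exact (norm_add_le _ _).trans (add_le_add h1 h2)
    _ = _ := by ring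

section Band

variable {g : ℝ → ℝ} {w a m e : ℝ}

theorem norm_bump_mul_cf_le (hw : 0 < w) (hm : 0 < m) (he : 0 ≤ e)
    (hg0 : ∀ v, m ≤ |v| → |v| ≤ m + 4 * w → ‖cf g v‖ ≤ e) (u : ℝ) :
    ‖modulationBump w a (m + 2 * w) u * cf g u‖
      ≤ (Set.Icc (-(m + 4 * w)) (m + 4 * w)).indicator (fun _ => |a| * e) u := by
  by_cases hu : m + w < |u| ∧ |u| < m + 3 * w
  · have hmem : u ∈ Set.Icc (-(m + 4 * w)) (m + 4 * w) := abs_le.1 (by linarith [hu.2])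
    rw [Set.indicator_of_mem hmem, norm_mul]
    exact mul_le_mul (norm_modulationBump_le hw _ _ _) (hg0 u (by linarith [hu.1])
      (by linarith [hu.2])) (norm_nonneg _) (abs_nonneg _)
  · rw [modulationBump_eq_zero hw (by linarith), zero_mul, norm_zero]
    · exact Set.indicator_nonneg (fun _ _ => by positivity) _
    · rw [not_and_or, not_lt, not_lt] at hu
      exact hu.imp (fun h => by linarith) fun h => by linarith

/-- The bump lives in m + w < |v| < m + 3w. If [u, u + δ] meets this region it stays within m ≤ |v|
≤ m + 4w, where the product rule for increments applies; otherwise both terms vanish. The margin w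
on each side is why δ < w. -/
theorem norm_bump_mul_cf_sub_le (hw : 0 < w) (hm : 0 < m) (he : 0 ≤ e)
    (hgd : Differentiable ℝ (cf g))
    (hg0 : ∀ v, m ≤ |v| → |v| ≤ m + 4 * w → ‖cf g v‖ ≤ e)
    (hg1 : ∀ v, m ≤ |v| → |v| ≤ m + 4 * w → ‖deriv (cf g) v‖ ≤ e) {δ : ℝ} (hδ : 0 < δ)
    (hδw : δ < w) (u : ℝ) :
    ‖modulationBump w a (m + 2 * w) (u + δ) * cf g (u + δ)
        - modulationBump w a (m + 2 * w) u * cf g u‖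
      ≤ (Set.Icc (-(m + 4 * w)) (m + 4 * w)).indicator (fun _ => |a| * e * (5 / w + 1) * δ) u := by
  set B := modulationBump w a (m + 2 * w) with hB
  have hB0 : ∀ v, ¬ (m + w < |v| ∧ |v| < m + 3 * w) → B v = 0 := fun v hv => by
    refine modulationBump_eq_zero hw (by linarith) ?_
    rw [not_and_or, not_lt, not_lt] at hv
    exact hv.imp (fun h => by linarith) fun h => by linarith
  have hclose : ∀ v ∈ Set.Icc u (u + δ), ∀ v' ∈ Set.Icc u (u + δ), |v'| ≤ |v| + w := by
    intro v hv v' hv'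
    have h1 : |v' - v| ≤ w := abs_le.2 ⟨by linarith [hv.1, hv.2, hv'.1, hv'.2],
      by linarith [hv.1, hv.2, hv'.1, hv'.2]⟩
    have h2 := abs_sub_abs_le_abs_sub v' v
    linarith
  have hu : u ∈ Set.Icc u (u + δ) := ⟨le_rfl, by linarith⟩
  have huδ : u + δ ∈ Set.Icc u (u + δ) := ⟨by linarith, le_rfl⟩
  have hband : ∀ v ∈ Set.Icc u (u + δ), (m + w < |v| ∧ |v| < m + 3 * w) →
      ∀ v' ∈ Set.Icc u (u + δ), m ≤ |v'| ∧ |v'| ≤ m + 4 * w := fun v hv hv0 v' hv' =>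
    ⟨by linarith [hclose v' hv' v hv, hv0.1], by linarith [hclose v hv v' hv', hv0.2]⟩
  have hnn : 0 ≤ |a| * e * (5 / w + 1) * δ := by positivity
  by_cases hex : ∃ v ∈ Set.Icc u (u + δ), m + w < |v| ∧ |v| < m + 3 * w
  · obtain ⟨v, hv, hv0⟩ := hex
    have hall := hband v hv hv0
    have hmem : u ∈ Set.Icc (-(m + 4 * w)) (m + 4 * w) := abs_le.1 (hall u hu).2
    rw [Set.indicator_of_mem hmem]
    have h1 : ‖(B (u + δ) - B u) * cf g (u + δ)‖ ≤ |a| * (5 / w) * δ * e := by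
      rw [norm_mul]
      have := norm_modulationBump_sub_le hw a (m + 2 * w) (u + δ) u
      rw [add_sub_cancel_left, abs_of_pos hδ] at this
      exact mul_le_mul this (hg0 _ (hall _ huδ).1 (hall _ huδ).2) (norm_nonneg _) (by positivity)
    have h2 : ‖B u * (cf g (u + δ) - cf g u)‖ ≤ |a| * (e * δ) := by
      rw [norm_mul]
      have := (convex_Icc u (u + δ)).norm_image_sub_le_of_norm_deriv_le
        (fun x _ => hgd x) (fun x hx => hg1 x (hall x hx).1 (hall x hx).2) hu huδ
      rw [add_sub_cancel_left, Real.norm_of_nonneg hδ.le] at this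
      exact mul_le_mul (norm_modulationBump_le hw _ _ _) this (norm_nonneg _) (abs_nonneg _)
    have hsplit : B (u + δ) * cf g (u + δ) - B u * cf g u
        = (B (u + δ) - B u) * cf g (u + δ) + B u * (cf g (u + δ) - cf g u) := by ring
    rw [hsplit]
    refine ((norm_add_le _ _).trans (add_le_add h1 h2)).trans_eq ?_
    ring
  · have h1 : B u = 0 := hB0 u fun h => hex ⟨u, hu, h⟩
    have h2 : B (u + δ) = 0 := hB0 _ fun h => hex ⟨_, huδ, h⟩
    rw [h1, h2, zero_mul, zero_mul, sub_zero, norm_zero]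
    exact Set.indicator_nonneg (fun _ _ => hnn) _

/-- The transform of p₁ - p₀ is the bump times Φ^g. Its size controls the part with weight 1, its
increments the part with weight x². -/
theorem lintegral_weighted_convDensity_sub_le (hg : IsDensity g)
    (hgd : Differentiable ℝ (cf g)) (hw : 0 < w) (hw1 : w ≤ 1) (ha : |a| ≤ 1) (hm : 0 < m)
    (he : 0 ≤ e)
    (hg0 : ∀ v, m ≤ |v| → |v| ≤ m + 4 * w → ‖cf g v‖ ≤ e)
    (hg1 : ∀ v, m ≤ |v| → |v| ≤ m + 4 * w → ‖deriv (cf g) v‖ ≤ e) :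
    ∫⁻ x, ENNReal.ofReal ((1 + x ^ 2) *
        (convDensity g (modulatedBase w a (m + 2 * w)) x - convDensity g (scaledBase w) x) ^ 2)
      ≤ ENNReal.ofReal (144 * a ^ 2 * e ^ 2 * (m + 4) / w ^ 2) := by
  set f₀ := scaledBase w with hf₀
  set f₁ := modulatedBase w a (m + 2 * w) with hf₁
  have d0 : IsDensity f₀ := isDensity_scaledBase hw
  have d1 : IsDensity f₁ := isDensity_modulatedBase hw ha (by linarith)
  have b0 := scaledBase_le hw
  have b1 := modulatedBase_le hw ha (m + 2 * w)
  have c0 := isDensity_convDensity hg d0 b0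
  have c1 := isDensity_convDensity hg d1 b1
  set G : ℝ → ℂ := fun x => (convDensity g f₁ x : ℂ) + (-1) * (convDensity g f₀ x : ℂ) with hG
  have i0 : Integrable fun x => (convDensity g f₀ x : ℂ) := integrable_ofReal c0.integrable
  have i1 : Integrable fun x => (convDensity g f₁ x : ℂ) := integrable_ofReal c1.integrable
  have hG1 : Integrable G := i1.add (i0.const_mul _)
  have hG2 : MemLp G 2 := (memLp_ofReal (memLp_convDensity hg d1 b1)).add
    ((memLp_ofReal (memLp_convDensity hg d0 b0)).const_mul _)
  have hft : ∀ u, ft G u = modulationBump w a (m + 2 * w) u * cf g u := fun u => by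
    rw [hG, ft_add i1 (i0.const_mul _), ft_const_mul, ← c1.cf_eq_ft, ← c0.cf_eq_ft,
      cf_convDensity hg d1 b1, cf_convDensity hg d0 b0, hf₁, cf_modulatedBase hw ha (by linarith),
      modulationBump]
    ring
  have hGn : ∀ x, ‖G x‖ ^ 2 = (convDensity g f₁ x - convDensity g f₀ x) ^ 2 := fun x => by
    have : G x = ((convDensity g f₁ x - convDensity g f₀ x : ℝ) : ℂ) := by
      rw [hG]
      push_cast
      ring
    rw [this, Complex.norm_real, Real.norm_eq_abs, sq_abs]
  have hA := lintegral_sq_le_of_ft hG1 hG2 (D := |a| * e) (b := m + 4 * w) fun u => by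
    rw [hft]
    exact norm_bump_mul_cf_le hw hm he hg0 u
  have hB := lintegral_sq_mul_sq_le_of_ft hG1 hG2 (D := |a| * e * (5 / w + 1)) (b := m + 4 * w) hw
    fun δ hδ hδw u => by
      rw [hft, hft]
      exact norm_bump_mul_cf_sub_le hw hm he hgd hg0 hg1 hδ hδw u
  have hGm : AEMeasurable (fun x => ENNReal.ofReal (‖G x‖ ^ 2)) :=
    (hG1.aestronglyMeasurable.norm.aemeasurable.pow_const 2).ennreal_ofReal
  calc _ = ∫⁻ x, (ENNReal.ofReal (‖G x‖ ^ 2) + ENNReal.ofReal (x ^ 2 * ‖G x‖ ^ 2)) := by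
        refine lintegral_congr fun x => ?_
        rw [← ENNReal.ofReal_add (by positivity) (by positivity), ← hGn]
        congr 1
        ring
    _ = (∫⁻ x, ENNReal.ofReal (‖G x‖ ^ 2)) + ∫⁻ x, ENNReal.ofReal (x ^ 2 * ‖G x‖ ^ 2) :=
        lintegral_add_left' hGm _
    _ ≤ ENNReal.ofReal ((|a| * e) ^ 2 * (2 * (m + 4 * w)))
          + ENNReal.ofReal ((|a| * e * (5 / w + 1)) ^ 2 * (2 * (m + 4 * w))) := add_le_add hA hB
    _ ≤ _ := by
        rw [← ENNReal.ofReal_add (by positivity) (by positivity)]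
        refine ENNReal.ofReal_le_ofReal ?_
        have h1 : (1 : ℝ) ≤ 1 / w ^ 2 := by
          rw [le_div_iff₀ (by positivity)]
          nlinarith
        have h2 : 5 / w + 1 ≤ 6 / w := by
          rw [div_add_one hw.ne']
          gcongr
          linarith
        have h3 : (5 / w + 1) ^ 2 ≤ 36 * (1 / w ^ 2) := by
          calc _ ≤ (6 / w) ^ 2 := by gcongr
            _ = _ := by ring
        have h4 : m + 4 * w ≤ m + 4 := by linarith
        have h5 : 0 ≤ a ^ 2 * e ^ 2 := by positivity
        calc _ = a ^ 2 * e ^ 2 * (2 * (m + 4 * w)) * (1 + (5 / w + 1) ^ 2) := by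
              rw [mul_pow, mul_pow, mul_pow, sq_abs]
              ring
          _ ≤ a ^ 2 * e ^ 2 * (2 * (m + 4)) * (36 * (1 / w ^ 2) + 36 * (1 / w ^ 2)) := by
              gcongr
              linarith
          _ = _ := by ring

/-- Dividing by p₀ costs (1 + x²)/(κw), which reduces the χ² divergence to the weighted L² bound.
The separation is a²wQ/2 with Q = ∫ `baseDensity`²; Le Cam's bound divides it by 4 and passing from
a sum to a supremum by 2. -/
theorem lower_bound_of_mem {F : Set (ℝ → ℝ)} {κ φ : ℝ} {n : ℕ} (hg : IsDensity g)
    (hgd : Differentiable ℝ (cf g)) (hκ : 0 < κ)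
    (hκg : ∀ w, 0 < w → w ≤ 1 → ∀ x, κ * w * (1 + x ^ 2)⁻¹ ≤ convDensity g (scaledBase w) x)
    (hw : 0 < w) (hw1 : w ≤ 1) (ha : |a| ≤ 1) (hm : 0 < m) (he : 0 ≤ e)
    (hg0 : ∀ v, m ≤ |v| → |v| ≤ m + 4 * w → ‖cf g v‖ ≤ e)
    (hg1 : ∀ v, m ≤ |v| → |v| ≤ m + 4 * w → ‖deriv (cf g) v‖ ≤ e) (hn : 0 < n)
    (hχ : 144 * a ^ 2 * e ^ 2 * (m + 4) / (κ * w ^ 3) ≤ 1 / n) (hφ : 0 < φ)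
    (hF0 : scaledBase w ∈ F) (hF1 : modulatedBase w a (m + 2 * w) ∈ F)
    {T : (Fin n → ℝ) → ℝ} (hT : Measurable T) :
    ENNReal.ofReal (φ⁻¹ * (a ^ 2 * w * quadFunctional baseDensity / 16)) ≤ maxRisk F g φ n T := by
  set f₀ := scaledBase w with hf₀
  set f₁ := modulatedBase w a (m + 2 * w) with hf₁
  have d0 : IsDensity f₀ := isDensity_scaledBase hw
  have d1 : IsDensity f₁ := isDensity_modulatedBase hw ha (by linarith)
  have b0 := scaledBase_le hw
  have b1 := modulatedBase_le hw ha (m + 2 * w)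
  have c0 := isDensity_convDensity hg d0 b0
  have c1 := isDensity_convDensity hg d1 b1
  set p₀ := convDensity g f₀ with hp₀
  set p₁ := convDensity g f₁ with hp₁
  have hp0pos : ∀ x, 0 < p₀ x := fun x => lt_of_lt_of_le (by positivity) (hκg w hw hw1 x)
  set l : ℝ → ℝ≥0∞ := fun x => ENNReal.ofReal (p₁ x / p₀ x) with hl
  have hm0 := c0.measurable
  have hm1 := c1.measurable
  have hlm : Measurable l := (hm1.div hm0).ennreal_ofReal
  have hl1 : (densityMeasure p₀).withDensity l = densityMeasure p₁ := by
    rw [densityMeasure, ← withDensity_mul _ (by fun_prop) hlm, densityMeasure]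
    congr 1
    funext x
    rw [Pi.mul_apply, ← ENNReal.ofReal_mul (hp0pos x).le, mul_div_cancel₀ _ (hp0pos x).ne']
  have hP0 := c0.isProbabilityMeasure
  have hP1 : IsProbabilityMeasure ((densityMeasure p₀).withDensity l) := by
    rw [hl1]
    exact c1.isProbabilityMeasure
  set J : ℝ → ℝ := fun x => (κ * w)⁻¹ * ((1 + x ^ 2) * (p₁ x - p₀ x) ^ 2) with hJ
  have hJ0 : ∀ x, 0 ≤ J x := fun x => by positivity
  have hJm : Measurable J := by fun_prop
  have hJl : ∫⁻ x, ENNReal.ofReal (J x) ≤ ENNReal.ofReal (1 / n) := by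
    have hmul : ∀ x, ENNReal.ofReal (J x) = ENNReal.ofReal (κ * w)⁻¹ *
        ENNReal.ofReal ((1 + x ^ 2) * (p₁ x - p₀ x) ^ 2) := fun x =>
      ENNReal.ofReal_mul (by positivity)
    simp only [hmul]
    rw [lintegral_const_mul' _ _ ENNReal.ofReal_ne_top]
    refine (mul_le_mul_right (lintegral_weighted_convDensity_sub_le hg hgd hw hw1 ha hm he hg0 hg1)
      _).trans ?_
    rw [← ENNReal.ofReal_mul (by positivity)]
    refine ENNReal.ofReal_le_ofReal (le_trans (le_of_eq ?_) hχ)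
    field_simp
  have hJi : Integrable J := by
    refine ⟨hJm.aestronglyMeasurable, ?_⟩
    rw [hasFiniteIntegral_iff_ofReal (Eventually.of_forall hJ0)]
    exact hJl.trans_lt ENNReal.ofReal_lt_top
  have hn0 : (0 : ℝ) < n := by exact_mod_cast hn
  have hJint : ∫ x, J x ≤ 1 / n := by
    rw [← ofReal_integral_eq_lintegral_ofReal hJi (Eventually.of_forall hJ0)] at hJl
    exact (ENNReal.ofReal_le_ofReal_iff (by positivity)).1 hJl
  have hl2 : ∫⁻ y, l y ^ 2 ∂(densityMeasure p₀) ≤ ENNReal.ofReal (1 + 1 / n) := by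
    rw [densityMeasure, lintegral_withDensity_eq_lintegral_mul _ (by fun_prop) (hlm.pow_const 2)]
    -- This form integrates directly: p₁ has mass 1, p₁ - p₀ mass 0, and J mass at most 1/n.
    have hpt : ∀ x, p₁ x ^ 2 / p₀ x ≤ p₁ x + (p₁ x - p₀ x) + J x := fun x => by
      have hp := hp0pos x
      have e1 : p₁ x ^ 2 / p₀ x = p₁ x + (p₁ x - p₀ x) + (p₁ x - p₀ x) ^ 2 / p₀ x := by
        field_simp
        ring
      rw [e1]
      gcongr
      calc (p₁ x - p₀ x) ^ 2 / p₀ x ≤ (p₁ x - p₀ x) ^ 2 / (κ * w * (1 + x ^ 2)⁻¹) := by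
            gcongr
            exact hκg w hw hw1 x
        _ = J x := by
            rw [hJ]
            field_simp
    have hi : Integrable fun x => p₁ x + (p₁ x - p₀ x) + J x :=
      (c1.integrable.add (c1.integrable.sub c0.integrable)).add hJi
    calc _ = ∫⁻ x, ENNReal.ofReal (p₁ x ^ 2 / p₀ x) := by
          refine lintegral_congr fun x => ?_
          have hp := hp0pos x
          rw [Pi.mul_apply, hl, ← ENNReal.ofReal_pow (div_nonneg (c1.nonneg x) hp.le),
            ← ENNReal.ofReal_mul hp.le]
          congr 1
          field_simp
      _ ≤ ∫⁻ x, ENNReal.ofReal (p₁ x + (p₁ x - p₀ x) + J x) :=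
          lintegral_mono fun x => ENNReal.ofReal_le_ofReal (hpt x)
      _ = ENNReal.ofReal (∫ x, (p₁ x + (p₁ x - p₀ x) + J x)) := by
          rw [ofReal_integral_eq_lintegral_ofReal hi (Eventually.of_forall fun x =>
            le_trans (div_nonneg (sq_nonneg _) (hp0pos x).le) (hpt x))]
      _ ≤ _ := by
          refine ENNReal.ofReal_le_ofReal ?_
          have i1 : Integrable fun x => p₁ x - p₀ x := c1.integrable.sub c0.integrable
          have i2 : Integrable fun x => p₁ x + (p₁ x - p₀ x) := c1.integrable.add i1
          rw [integral_add i2 hJi, integral_add c1.integrable i1,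
            integral_sub c1.integrable c0.integrable, c1.integral_eq_one, c0.integral_eq_one]
          linarith
  have key := two_point_bound (densityMeasure p₀) hlm hn hl2 hT (quadFunctional f₀)
    (quadFunctional f₁)
  rw [hl1, hp₀, hp₁, ← conv_eq_densityMeasure hg d0 b0, ← conv_eq_densityMeasure hg d1 b1] at key
  have hΔ : |quadFunctional f₁ - quadFunctional f₀| / 4 = a ^ 2 * w * quadFunctional baseDensity / 8 := by
    rw [hf₁, quadFunctional_modulatedBase hw ha (by linarith), hf₀, add_sub_cancel_left,
      quadFunctional_scaledBase hw]
    have := quadFunctional_baseDensity_pos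
    rw [abs_of_nonneg (by positivity)]
    ring
  rw [hΔ] at key
  have r0 : ENNReal.ofReal φ⁻¹ * ∫⁻ Y, ENNReal.ofReal |T Y - quadFunctional f₀| ∂(sampleLaw f₀ g n)
      ≤ maxRisk F g φ n T := le_iSup₂_of_le f₀ hF0 le_rfl
  have r1 : ENNReal.ofReal φ⁻¹ * ∫⁻ Y, ENNReal.ofReal |T Y - quadFunctional f₁| ∂(sampleLaw f₁ g n)
      ≤ maxRisk F g φ n T := le_iSup₂_of_le f₁ hF1 le_rfl
  have hsum : ENNReal.ofReal φ⁻¹ * ENNReal.ofReal (a ^ 2 * w * quadFunctional baseDensity / 8)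
      ≤ maxRisk F g φ n T + maxRisk F g φ n T := by
    refine (mul_le_mul_right key _).trans ?_
    rw [mul_add]
    exact add_le_add r0 r1
  have hq := quadFunctional_baseDensity_pos
  rw [← ENNReal.ofReal_mul (by positivity), ← two_mul] at hsum
  have h2 : ENNReal.ofReal (φ⁻¹ * (a ^ 2 * w * quadFunctional baseDensity / 8))
      = 2 * ENNReal.ofReal (φ⁻¹ * (a ^ 2 * w * quadFunctional baseDensity / 16)) := by
    rw [← ENNReal.ofReal_ofNat, ← ENNReal.ofReal_mul (by norm_num)]
    congr 1
    ring
  rw [h2] at hsum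
  exact (ENNReal.mul_le_mul_iff_right two_ne_zero ENNReal.ofNat_ne_top).1 hsum

end Band

/-! ### The lower bound for a general weight. -/

/-- Both moduli are largest, up to a power, at the inner edge of the band. The range 5m covers m +
4w when w ≤ 1 ≤ m, and lets |v|^A be replaced by a power of m. -/
theorem exists_band_bound {g : ℝ → ℝ} {γ s : ℝ} (hγ : 0 < γ) (hs : 0 < s)
    (hg : IsExponentialNoise g γ s) (hE : AssumptionE g γ s) :
    ∃ C k m₀ : ℝ, 0 < C ∧ ∀ m, m₀ ≤ m → 1 ≤ m → ∀ v, m ≤ |v| → |v| ≤ 5 * m →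
      ‖cf g v‖ ≤ C * m ^ k * Real.exp (-γ * m ^ s) ∧
      ‖deriv (cf g) v‖ ≤ C * m ^ k * Real.exp (-γ * m ^ s) := by
  obtain ⟨C₀, hC₀, h0⟩ := hg.exists_norm_cf_le hs
  obtain ⟨-, A, C₁, M, h1⟩ := hE
  refine ⟨max C₀ (|C₁| * 5 ^ |A|), |A|, M, lt_max_of_lt_left hC₀, fun m hmM hm1 v hv1 hv2 => ?_⟩
  have hm0 : 0 < m := by linarith
  have hexp : Real.exp (-γ * |v| ^ s) ≤ Real.exp (-γ * m ^ s) := by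
    rw [Real.exp_le_exp]
    have : m ^ s ≤ |v| ^ s := Real.rpow_le_rpow hm0.le hv1 hs.le
    nlinarith
  have hmk : 1 ≤ m ^ |A| := Real.one_le_rpow hm1 (abs_nonneg _)
  constructor
  · calc ‖cf g v‖ ≤ C₀ * 1 * Real.exp (-γ * |v| ^ s) := by rw [mul_one]; exact h0 v
      _ ≤ _ := by
        gcongr
        exact le_max_left _ _
  · have hvA : |v| ^ A ≤ 5 ^ |A| * m ^ |A| := by
      rw [← Real.mul_rpow (by norm_num) hm0.le]
      exact (Real.rpow_le_rpow_of_exponent_le (hm1.trans hv1) (le_abs_self A)).trans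
        (Real.rpow_le_rpow (abs_nonneg _) hv2 (abs_nonneg _))
    calc ‖deriv (cf g) v‖ ≤ C₁ * (|v| ^ A * Real.exp (-γ * |v| ^ s)) := h1 v (hmM.trans hv1)
      _ ≤ |C₁| * ((5 ^ |A| * m ^ |A|) * Real.exp (-γ * m ^ s)) := by
        gcongr
        exact le_abs_self _
      _ = |C₁| * 5 ^ |A| * m ^ |A| * Real.exp (-γ * m ^ s) := by ring
      _ ≤ _ := by
        gcongr
        exact le_max_right _ _

theorem ofReal_norm_cf_shift_le {ρ : ℝ → ℝ} (hρ0 : ∀ u, 0 ≤ ρ u)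
    (hmono : ∀ u v, |u| ≤ |v| → ρ u ≤ ρ v) {w : ℝ} (hw : 0 < w) (c u : ℝ) :
    ENNReal.ofReal (‖cf (scaledBase w) (u + c)‖ ^ 2 * ρ u)
      ≤ (Set.Icc (-c - w) (-c + w)).indicator (fun _ => ENNReal.ofReal (ρ (|c| + w))) u := by
  by_cases hu : u ∈ Set.Icc (-c - w) (-c + w)
  · rw [Set.indicator_of_mem hu]
    refine ENNReal.ofReal_le_ofReal ?_
    have h1 : ‖cf (scaledBase w) (u + c)‖ ^ 2 ≤ 1 :=
      pow_le_one₀ (norm_nonneg _) ((isDensity_scaledBase hw).norm_cf_le_one _)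
    have h2 : |u| ≤ |c| + w := by
      have h3 : |u + c| ≤ w := abs_le.2 ⟨by linarith [hu.1], by linarith [hu.2]⟩
      have h4 := abs_add_le (u + c) (-c)
      rw [add_neg_cancel_right, abs_neg] at h4
      linarith
    have h5 : ρ u ≤ ρ (|c| + w) := hmono _ _ (h2.trans (le_abs_self _))
    nlinarith [hρ0 u]
  · rw [Set.indicator_of_notMem hu, cf_scaledBase_eq_zero hw]
    · simp
    · by_contra hcon
      rw [not_le, abs_lt] at hcon
      exact hu ⟨by linarith, by linarith⟩

theorem lintegral_modulatedBase_weight_le {ρ : ℝ → ℝ} (hρ0 : ∀ u, 0 ≤ ρ u)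
    (hmono : ∀ u v, |u| ≤ |v| → ρ u ≤ ρ v) {w a N : ℝ} (hw : 0 < w) (ha : |a| ≤ 1)
    (hN : 2 * w ≤ N) :
    ∫⁻ u, ENNReal.ofReal (‖cf (modulatedBase w a N) u‖ ^ 2 * ρ u)
      ≤ ENNReal.ofReal (2 * w * ρ w + a ^ 2 * w * ρ (N + w)) := by
  have hN0 : 0 < N := by linarith
  have hint : ∀ c, ∫⁻ u, (Set.Icc (-c - w) (-c + w)).indicator
      (fun _ => ENNReal.ofReal (ρ (|c| + w))) u = ENNReal.ofReal (ρ (|c| + w) * (2 * w)) := fun c => by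
    rw [lintegral_indicator measurableSet_Icc, setLIntegral_const, Real.volume_Icc,
      ← ENNReal.ofReal_mul (hρ0 _)]
    congr 2
    ring
  have hmeas : ∀ c, Measurable fun u => (Set.Icc (-c - w) (-c + w)).indicator
      (fun _ => ENNReal.ofReal (ρ (|c| + w))) u := fun c => measurable_const.indicator measurableSet_Icc
  calc _ ≤ ∫⁻ u, ((Set.Icc (-0 - w) (-0 + w)).indicator
          (fun _ => ENNReal.ofReal (ρ (|0| + w))) u + ENNReal.ofReal (a ^ 2 / 4) *
        ((Set.Icc (-N - w) (-N + w)).indicator (fun _ => ENNReal.ofReal (ρ (|N| + w))) u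
        + (Set.Icc (-(-N) - w) (-(-N) + w)).indicator
          (fun _ => ENNReal.ofReal (ρ (|-N| + w))) u)) := by
        refine lintegral_mono fun u => ?_
        have h0 := ofReal_norm_cf_shift_le hρ0 hmono hw 0 u
        have h1 := ofReal_norm_cf_shift_le hρ0 hmono hw N u
        have h2 := ofReal_norm_cf_shift_le hρ0 hmono hw (-N) u
        rw [add_zero] at h0
        rw [← sub_eq_add_neg] at h2
        refine le_trans (le_of_eq ?_)
          (add_le_add h0 (mul_le_mul_right (add_le_add h1 h2) (ENNReal.ofReal (a ^ 2 / 4))))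
        have hρu := hρ0 u
        rw [← ENNReal.ofReal_add (by positivity) (by positivity),
          ← ENNReal.ofReal_mul (by positivity), ← ENNReal.ofReal_add (by positivity) (by positivity),
          norm_cf_modulatedBase_sq hw ha hN]
        congr 1
        ring
    _ = ENNReal.ofReal (ρ (|0| + w) * (2 * w)) + ENNReal.ofReal (a ^ 2 / 4) *
        (ENNReal.ofReal (ρ (|N| + w) * (2 * w)) + ENNReal.ofReal (ρ (|-N| + w) * (2 * w))) := by
        rw [lintegral_add_left (hmeas 0), lintegral_const_mul' _ _ ENNReal.ofReal_ne_top,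
          lintegral_add_left (hmeas N), hint, hint, hint]
    _ = _ := by
        have h1 := hρ0 (N + w)
        have h2 := hρ0 w
        rw [abs_zero, zero_add, abs_neg, abs_of_pos hN0, ← ENNReal.ofReal_add (by positivity)
          (by positivity), ← ENNReal.ofReal_mul (by positivity), ← ENNReal.ofReal_add (by positivity)
          (by positivity)]
        congr 1
        ring

theorem modulatedBase_zero (w N : ℝ) : modulatedBase w 0 N = scaledBase w := by
  funext x
  simp [modulatedBase]

/-- The bumps are placed at m + 2w with w of order m^(-q). The exponent q lets the band shrink so
that ρ varies by a bounded factor across it (`hφ`); `hρlim` makes the required amplitude at most 1,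
and `hχ` makes the χ² divergence at most 1/n. -/
theorem exists_liminf_lower_bound {g : ℝ → ℝ} {γ s : ℝ} (hγ : 0 < γ) (hs : 0 < s)
    (hg : IsExponentialNoise g γ s) (hE : AssumptionE g γ s) {F : Set (ℝ → ℝ)} {ρ : ℝ → ℝ} {L : ℝ}
    (hL : 0 < L) (hρ0 : ∀ u, 0 ≤ ρ u) (hmono : ∀ u v, |u| ≤ |v| → ρ u ≤ ρ v)
    (hF : ∀ f, IsDensity f → MemLp f 2 → ContDiff ℝ ∞ f →
      ∫⁻ u, ENNReal.ofReal (‖cf f u‖ ^ 2 * ρ u) ≤ ENNReal.ofReal (2 * Real.pi * L) → f ∈ F)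
    {q : ℝ} (hq : 0 ≤ q) (hρlim : Tendsto (fun x : ℝ => x ^ (-q) * ρ x) atTop atTop)
    {φ m : ℕ → ℝ} (hm : Tendsto m atTop atTop)
    (hχ : ∀ C K : ℝ, ∀ᶠ n : ℕ in atTop,
      n * (C * m n ^ K * Real.exp (-2 * γ * m n ^ s)) ≤ ρ (m n))
    (hφ : ∃ C, 0 < C ∧ ∀ᶠ n : ℕ in atTop, 0 < φ n ∧ φ n * ρ (m n + 3 * m n ^ (-q)) ≤ C) :
    ∃ c : ℝ, 0 < c ∧ ENNReal.ofReal c ≤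
      liminf (fun n => ⨅ (T : (Fin n → ℝ) → ℝ) (_ : Measurable T), maxRisk F g (φ n) n T) atTop := by
  obtain ⟨C, k, m₀, hC, hband⟩ := exists_band_bound hγ hs hg hE
  obtain ⟨κ, hκ, hκg⟩ := exists_le_convDensity_scaledBase hg.density
  obtain ⟨Cφ, hCφ, hφ⟩ := hφ
  have hgd : Differentiable ℝ (cf g) := hE.1.differentiable one_ne_zero
  have hpiL : 0 < Real.pi * L := by positivity
  -- This spends half of the budget 2πL on the central part of the characteristic function; the
  -- bumps get the other half.
  set w₀ := min 1 (Real.pi * L / (2 * (ρ 1 + 1))) with hw₀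
  have hρ1 := hρ0 1
  have hw₀0 : 0 < w₀ := by positivity
  have hw₀1 : w₀ ≤ 1 := min_le_left _ _
  have hw₀ρ : 2 * w₀ * ρ 1 ≤ Real.pi * L := by
    have h1 : w₀ ≤ Real.pi * L / (2 * (ρ 1 + 1)) := min_le_right _ _
    rw [le_div_iff₀ (by positivity)] at h1
    nlinarith
  have hQ := quadFunctional_baseDensity_pos
  refine ⟨Real.pi * L * quadFunctional baseDensity / (16 * Cφ), by positivity, ?_⟩
  refine le_liminf_of_le (by isBoundedDefault) ?_
  filter_upwards [hφ, hm.eventually_ge_atTop 1, hm.eventually_ge_atTop m₀,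
    hm.eventually (hρlim.eventually_ge_atTop (Real.pi * L / w₀)), eventually_gt_atTop 0,
    hχ (720 * (Real.pi * L) * C ^ 2 / (κ * w₀ ^ 4)) (2 * k + 1 + 4 * q)] with n h1 h2 h3 h4 hn h5
  obtain ⟨hφ0, hφ1⟩ := h1
  set M := m n with hM
  have hM0 : 0 < M := by linarith
  have hMq : M ^ (-q) ≤ 1 := Real.rpow_le_one_of_one_le_of_nonpos h2 (by linarith)
  have hMq0 : 0 < M ^ (-q) := by positivity
  set w := w₀ * M ^ (-q) with hw
  have hw0 : 0 < w := by positivity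
  have hww₀ : w ≤ w₀ := mul_le_of_le_one_right hw₀0.le hMq
  have hw1 : w ≤ 1 := hww₀.trans hw₀1
  have hwq : w ≤ M ^ (-q) := mul_le_of_le_one_left hMq0.le hw₀1
  set R := ρ (M + 3 * w) with hR
  have hmono' : ∀ {x y : ℝ}, 0 ≤ x → x ≤ y → ρ x ≤ ρ y := fun hx hxy =>
    hmono _ _ (by rwa [abs_of_nonneg hx, abs_of_nonneg (hx.trans hxy)])
  have hMR : ρ M ≤ R := hmono' hM0.le (by linarith)
  have hwρ : Real.pi * L ≤ w * ρ M := by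
    rw [div_le_iff₀ hw₀0] at h4
    calc _ ≤ M ^ (-q) * ρ M * w₀ := h4
      _ = _ := by rw [hw]; ring
  have hρM : 0 < ρ M := pos_of_mul_pos_right (hpiL.trans_le hwρ) hw0.le
  have hR0 : 0 < R := hρM.trans_le hMR
  -- The largest amplitude allowed by the half budget: a²wR = πL.
  set a := √(Real.pi * L / (w * R)) with ha
  have ha2 : a ^ 2 = Real.pi * L / (w * R) := Real.sq_sqrt (by positivity)
  have ha1 : |a| ≤ 1 := by
    rw [abs_of_nonneg (Real.sqrt_nonneg _), Real.sqrt_le_iff, one_pow, div_le_one (by positivity)]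
    exact ⟨zero_le_one, hwρ.trans (by gcongr)⟩
  have haw : a ^ 2 * w = Real.pi * L / R := by
    rw [ha2]
    field_simp
  have hmass : ∀ b, |b| ≤ 1 → b ^ 2 ≤ a ^ 2 →
      ∫⁻ u, ENNReal.ofReal (‖cf (modulatedBase w b (M + 2 * w)) u‖ ^ 2 * ρ u)
        ≤ ENNReal.ofReal (2 * Real.pi * L) := fun b hb hba => by
    refine (lintegral_modulatedBase_weight_le hρ0 hmono hw0 hb (by linarith)).trans
      (ENNReal.ofReal_le_ofReal ?_)
    rw [show M + 2 * w + w = M + 3 * w by ring, ← hR]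
    have e1 : 2 * w * ρ w ≤ Real.pi * L := by
      refine le_trans ?_ hw₀ρ
      have := hρ0 w
      have := hmono' hw0.le hw1
      gcongr
    have e2 : b ^ 2 * w * R ≤ Real.pi * L := by
      calc _ ≤ a ^ 2 * w * R := by gcongr
        _ = _ := by rw [haw]; field_simp
    linarith
  have hF1 : modulatedBase w a (M + 2 * w) ∈ F :=
    hF _ (isDensity_modulatedBase hw0 ha1 (by linarith)) (memLp_modulatedBase hw0 ha1 _)
      (contDiff_modulatedBase _ _ _) (hmass a ha1 le_rfl)
  have hF0 : scaledBase w ∈ F := by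
    refine hF _ (isDensity_scaledBase hw0) (memLp_scaledBase hw0) (contDiff_scaledBase w) ?_
    have := hmass 0 (by simp) (by rw [zero_pow two_ne_zero]; exact sq_nonneg a)
    rwa [modulatedBase_zero] at this
  set e := C * M ^ k * Real.exp (-γ * M ^ s) with he
  have he0 : 0 ≤ e := by positivity
  have hn0 : (0 : ℝ) < n := by exact_mod_cast hn
  have hchi : 144 * a ^ 2 * e ^ 2 * (M + 4) / (κ * w ^ 3) ≤ 1 / n := by
    have he2 : e ^ 2 = C ^ 2 * M ^ (2 * k) * Real.exp (-2 * γ * M ^ s) := by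
      rw [he, mul_pow, mul_pow, ← Real.rpow_natCast (M ^ k), ← Real.rpow_mul hM0.le,
        ← Real.exp_nat_mul]
      push_cast
      ring_nf
    -- The powers come from e² (2k), from M + 4 ≤ 5M (1) and from w⁻⁴ (4q), of which w⁻³ is in the
    -- χ² bound and w⁻¹ in a².
    have hMpow : M ^ (2 * k + 1 + 4 * q) = M ^ (2 * k) * M / (M ^ (-q)) ^ 4 := by
      rw [Real.rpow_add hM0, Real.rpow_add hM0, Real.rpow_one, ← Real.rpow_natCast (M ^ (-q)),
        ← Real.rpow_mul hM0.le, show -q * (4 : ℕ) = -(4 * q) by push_cast; ring,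
        Real.rpow_neg hM0.le, div_inv_eq_mul]
    rw [le_div_iff₀ hn0]
    calc 144 * a ^ 2 * e ^ 2 * (M + 4) / (κ * w ^ 3) * n
        ≤ 144 * (Real.pi * L / (w * ρ M)) * e ^ 2 * (5 * M) / (κ * w ^ 3) * n := by
          rw [ha2]
          gcongr
          linarith
      _ = n * (720 * (Real.pi * L) * C ^ 2 / (κ * w₀ ^ 4) * M ^ (2 * k + 1 + 4 * q)
            * Real.exp (-2 * γ * M ^ s)) / ρ M := by
          rw [he2, hMpow, hw]
          field_simp
          ring
      _ ≤ 1 := (div_le_one hρM).2 h5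
  have hbd : ∀ v, M ≤ |v| → |v| ≤ M + 4 * w → ‖cf g v‖ ≤ e ∧ ‖deriv (cf g) v‖ ≤ e :=
    fun v hv1 hv2 => hband M h3 h2 v hv1 (by linarith)
  refine le_iInf₂ fun T hT => le_trans (ENNReal.ofReal_le_ofReal ?_)
    (lower_bound_of_mem hg.density hgd hκ hκg hw0 hw1 ha1 hM0 he0 (fun v h h' => (hbd v h h').1)
      (fun v h h' => (hbd v h h').2) hn hchi hφ0 hF0 hF1 hT)
  rw [haw]
  have hφR : φ n * R ≤ Cφ := by
    refine le_trans ?_ hφ1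
    gcongr
    exact hmono' (by positivity) (by linarith)
  calc Real.pi * L * quadFunctional baseDensity / (16 * Cφ)
      ≤ Real.pi * L * quadFunctional baseDensity / (16 * (φ n * R)) := by gcongr
    _ = _ := by field_simp

/-! ### Lower bound over Sobolev classes. -/

/-- A C¹ function is Lipschitz on balls, hence Hölder of any exponent at most 1 on bounded sets. -/
theorem isHolderClass_of_contDiff {f : ℝ → ℝ} (hf : ContDiff ℝ ∞ f) (β : ℝ) : IsHolderClass β f := by
  refine ⟨hf.of_le (by exact_mod_cast le_top), fun K hK => ?_⟩
  obtain ⟨R, hR⟩ := hK.isBounded.subset_closedBall 0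
  have hdiff : ContDiff ℝ 1 (iteratedDeriv ⌊β⌋₊ f) := by
    rw [iteratedDeriv_eq_iterate]
    exact ContDiff.iterate_deriv' 1 ⌊β⌋₊ (hf.of_le (by exact_mod_cast le_top))
  obtain ⟨C, hC⟩ := hdiff.contDiffOn.exists_lipschitzOnWith one_ne_zero
    (convex_closedBall (0 : ℝ) R) (isCompact_closedBall 0 R)
  have hfr : β - ⌊β⌋₊ ≤ 1 := by
    have := Nat.lt_floor_add_one β
    linarith
  exact HolderOnWith.exists_holderOnWith_of_le ⟨C, (hC.mono hR).holderOnWith⟩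
    (by rw [Real.toNNReal_le_iff_le_coe]; exact hfr) hK.isBounded

theorem liminf_lower_bound_sobolev {g : ℝ → ℝ} {γ s : ℝ} (hγ : 0 < γ) (hs : 0 < s)
    (hg : IsExponentialNoise g γ s) (hE : AssumptionE g γ s) {β L : ℝ} (hβ : 0 < β) (hL : 0 < L) :
    ∃ c : ℝ, 0 < c ∧ ENNReal.ofReal c ≤
      liminf (fun n => ⨅ (T : (Fin n → ℝ) → ℝ) (_ : Measurable T),
        maxRisk (sobolevClass β L) g (sobolevRate β L γ s n) n T) atTop := by
  -- With γm^s = log n, n exp(-2γm^s) = 1/n beats every power of m, and m^(-2β) still has the order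
  -- of the rate. A polynomial weight needs no shrinking band, so q = 0.
  set m : ℕ → ℝ := fun n => (Real.log n / γ) ^ (1 / s) with hmdef
  have hm : Tendsto m atTop atTop :=
    (tendsto_rpow_atTop (by positivity)).comp (tendsto_log_natCast.atTop_div_const hγ)
  have hms : ∀ᶠ n in atTop, γ * m n ^ s = Real.log n := by
    filter_upwards [tendsto_log_natCast.eventually_ge_atTop 0] with n hn
    rw [hmdef, ← Real.rpow_mul (by positivity), one_div_mul_cancel hs.ne', Real.rpow_one]
    field_simp
  refine exists_liminf_lower_bound hγ hs hg hE hL (F := sobolevClass β L) (ρ := fun u => |u| ^ (2 * β))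
    (fun u => by positivity) (fun u v huv => by gcongr)
    (fun f h1 h2 h3 h4 => ⟨h1, h2, isHolderClass_of_contDiff h3 β, h4⟩) le_rfl ?_ hm ?_ ?_
  · simp only [neg_zero, Real.rpow_zero, one_mul]
    exact (tendsto_rpow_atTop (by positivity)).comp tendsto_abs_atTop_atTop
  · intro C K
    filter_upwards [hms, hm.eventually (eventually_rpow_le_exp_rpow (K + 1 - 2 * β) hγ hs),
      hm.eventually_ge_atTop C, hm.eventually_gt_atTop 0, eventually_gt_atTop 0] with n h1 h2 h3 h4 hn
    have hn0 : (0 : ℝ) < n := by exact_mod_cast hn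
    have hnexp : (n : ℝ) = Real.exp (γ * m n ^ s) := by rw [h1, Real.exp_log hn0]
    have hsplit : Real.exp (-2 * γ * m n ^ s)
        = (Real.exp (γ * m n ^ s))⁻¹ * (Real.exp (γ * m n ^ s))⁻¹ := by
      rw [← Real.exp_neg, ← Real.exp_add]
      ring_nf
    rw [abs_of_pos h4, hsplit, ← hnexp]
    rw [← hnexp, Real.rpow_sub h4, Real.rpow_add h4, Real.rpow_one, div_le_iff₀ (by positivity)] at h2
    calc (n : ℝ) * (C * m n ^ K * ((n : ℝ)⁻¹ * (n : ℝ)⁻¹))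
        = C * m n ^ K * (n : ℝ)⁻¹ := by field_simp
      _ ≤ m n ^ K * m n * (n : ℝ)⁻¹ := by rw [mul_comm C]; gcongr
      _ ≤ n * m n ^ (2 * β) * (n : ℝ)⁻¹ := by gcongr
      _ = _ := by field_simp
  · refine ⟨L * 2 ^ (2 * β / s) * 4 ^ (2 * β), by positivity, ?_⟩
    filter_upwards [hms, hm.eventually_ge_atTop 1, tendsto_log_natCast.eventually_gt_atTop 0]
      with n h1 h2 h3
    have hm0 : 0 < m n := by linarith
    refine ⟨by rw [sobolevRate]; positivity, ?_⟩
    have hrate : sobolevRate β L γ s n = L * (2 ^ (2 * β / s) * (m n ^ (2 * β))⁻¹) := by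
      rw [sobolevRate, ← h1, show γ * m n ^ s / (2 * γ) = m n ^ s / 2 by field_simp,
        Real.div_rpow (by positivity) (by norm_num), ← Real.rpow_mul hm0.le,
        show s * (-2 * β / s) = -(2 * β) by field_simp, show -2 * β / s = -(2 * β / s) by ring,
        Real.rpow_neg hm0.le, Real.rpow_neg (by norm_num), div_inv_eq_mul]
      ring
    have hle : |m n + 3 * m n ^ (-(0 : ℝ))| ^ (2 * β) ≤ 4 ^ (2 * β) * m n ^ (2 * β) := by
      rw [neg_zero, Real.rpow_zero, mul_one, abs_of_pos (by linarith),
        ← Real.mul_rpow (by norm_num) hm0.le]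
      gcongr
      linarith
    rw [hrate]
    calc _ ≤ L * (2 ^ (2 * β / s) * (m n ^ (2 * β))⁻¹) * (4 ^ (2 * β) * m n ^ (2 * β)) := by gcongr
      _ = _ := by field_simp

/-! ### Lower bound over supersmooth classes. -/

/-- Justifies q = r: a shift of m by 3m^(-r) changes m^r by a bounded amount, hence exp(2αm^r) by a
bounded factor. -/
theorem add_rpow_neg_rpow_le {m r : ℝ} (hm : 1 ≤ m) (hr : 0 < r) :
    (m + 3 * m ^ (-r)) ^ r ≤ m ^ r + 3 * r * Real.exp (3 * r) := by
  have hm0 : 0 < m := by linarith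
  set x := m ^ (-r) / m with hx
  have hx0 : 0 ≤ x := by positivity
  have hr1 : m ^ (-r) ≤ 1 := Real.rpow_le_one_of_one_le_of_nonpos hm (by linarith)
  have hx1 : x ≤ 1 := (div_le_one hm0).2 (hr1.trans hm)
  have hmx : m ^ r * x ≤ 1 := by
    rw [hx, Real.rpow_neg hm0.le, ← mul_div_assoc, mul_inv_cancel₀ (by positivity)]
    exact (div_le_one hm0).2 hm
  have hexp : Real.exp (3 * r * x) ≤ 1 + 3 * r * x * Real.exp (3 * r) := by
    have h1 := Real.add_one_le_exp (-(3 * r * x))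
    have h2 : Real.exp (3 * r * x) ≤ Real.exp (3 * r) := by
      rw [Real.exp_le_exp]
      nlinarith
    have h3 : Real.exp (-(3 * r * x)) * Real.exp (3 * r * x) = 1 := by
      rw [← Real.exp_add, neg_add_cancel, Real.exp_zero]
    have h4 : 0 ≤ 3 * r * x := by positivity
    nlinarith [Real.exp_pos (3 * r * x)]
  calc (m + 3 * m ^ (-r)) ^ r = (m * (1 + 3 * x)) ^ r := by
        congr 1
        rw [hx]
        field_simp
    _ = m ^ r * (1 + 3 * x) ^ r := Real.mul_rpow hm0.le (by positivity)
    _ ≤ m ^ r * Real.exp (3 * x) ^ r := by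
        gcongr
        linarith [Real.add_one_le_exp (3 * x)]
    _ = m ^ r * Real.exp (3 * r * x) := by
        rw [← Real.exp_mul]
        ring_nf
    _ ≤ m ^ r * (1 + 3 * r * x * Real.exp (3 * r)) := by gcongr
    _ = m ^ r + 3 * r * Real.exp (3 * r) * (m ^ r * x) := by ring
    _ ≤ _ := by
        have : 0 ≤ 3 * r * Real.exp (3 * r) := by positivity
        nlinarith

/-- Bernoulli's inequality with exponent s/r ≥ 1. Raising μ^r by 1 raises μ^s by at least a multiple
of μ^(s-r). -/
theorem le_rpow_add_one_rpow {μ r s : ℝ} (hμ : 0 < μ) (hr : 0 < r) (hrs : r < s) :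
    μ ^ s + s / r * μ ^ (s - r) ≤ (μ ^ r + 1) ^ (s / r) := by
  have hμr : 0 < μ ^ r := by positivity
  have h1 := one_add_mul_self_le_rpow_one_add (s := (μ ^ r)⁻¹) (p := s / r)
    (by linarith [inv_pos.2 hμr]) ((one_le_div hr).2 hrs.le)
  have h2 : μ ^ r + 1 = μ ^ r * (1 + (μ ^ r)⁻¹) := by field_simp
  rw [h2, Real.mul_rpow hμr.le (by positivity), ← Real.rpow_mul hμ.le, mul_div_cancel₀ _ hr.ne',
    Real.rpow_sub hμ]
  calc _ = μ ^ s * (1 + s / r * (μ ^ r)⁻¹) := by ring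
    _ ≤ _ := by gcongr

theorem tendsto_rpow_neg_mul_exp_rpow {α r : ℝ} (hα : 0 < α) (hr : 0 < r) :
    Tendsto (fun x : ℝ => x ^ (-r) * Real.exp (2 * α * |x| ^ r)) atTop atTop := by
  refine tendsto_atTop_mono' atTop ?_ tendsto_id
  filter_upwards [eventually_rpow_le_exp_rpow (r + 1) (c := 2 * α) (by positivity) hr,
    eventually_gt_atTop 0] with x h1 h2
  rw [abs_of_pos h2]
  rw [Real.rpow_add h2, Real.rpow_one] at h1
  calc id x = x ^ (-r) * (x ^ r * x) := by
        rw [Real.rpow_neg h2.le, id]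
        field_simp
    _ ≤ _ := by gcongr

/-- The equation gives log n ≤ 4(α + γ)μ^s ≤ μ^(s+1) for μ = 1/h large, so (log log n)² is O((log
μ)²). -/
theorem eventually_log_le_mul_log_inv_bandwidth {α r γ s : ℝ} (hα : 0 < α) (hr : 0 < r) (hγ : 0 < γ)
    (hrs : r < s) {h : ℕ → ℝ} (hh : ∀ᶠ n : ℕ in atTop, SolvesBandwidthEq α r γ s n (h n)) :
    ∀ᶠ n : ℕ in atTop, Real.log (Real.log n) ≤ (s + 1) * Real.log (h n)⁻¹ := by
  have hμ := tendsto_inv_bandwidth hα hr hγ (hr.trans hrs) hh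
  filter_upwards [hh, eventually_half_log_le, tendsto_log_natCast.eventually_gt_atTop 0,
    hμ.eventually_ge_atTop 1, hμ.eventually_ge_atTop (4 * (α + γ))] with n h1 h2 h3 h4 h5
  obtain ⟨-, heq⟩ := solvesBandwidthEq_iff.1 h1
  set μ := (h n)⁻¹
  have hμ0 : 0 < μ := by linarith
  have h6 : μ ^ r ≤ μ ^ s := Real.rpow_le_rpow_of_exponent_le h4 hrs.le
  have h7 : Real.log n ≤ μ ^ (s + 1) := by
    rw [bandwidthExponent] at heq
    have : α * μ ^ r ≤ α * μ ^ s := by gcongr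
    calc Real.log n ≤ 4 * (α + γ) * μ ^ s := by linarith
      _ ≤ μ * μ ^ s := by gcongr
      _ = _ := by rw [Real.rpow_add hμ0, Real.rpow_one, mul_comm]
  rw [← Real.log_rpow hμ0]
  exact Real.log_le_log h3 h7

theorem liminf_lower_bound_supersmooth {g : ℝ → ℝ} {γ s : ℝ} (hγ : 0 < γ)
    (hg : IsExponentialNoise g γ s) (hE : AssumptionE g γ s) {α r L : ℝ} (hα : 0 < α) (hr : 0 < r)
    (hL : 0 < L) (hrs : r < s) {h : ℕ → ℝ}
    (hh : ∀ᶠ n : ℕ in atTop, SolvesBandwidthEq α r γ s n (h n)) :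
    ∃ c : ℝ, 0 < c ∧ ENNReal.ofReal c ≤
      liminf (fun n => ⨅ (T : (Fin n → ℝ) → ℝ) (_ : Measurable T),
        maxRisk (supersmoothClass α r L) g (supersmoothRate α r L (h n)) n T) atTop := by
  have hs : 0 < s := hr.trans hrs
  have hμ := tendsto_inv_bandwidth hα hr hγ hs hh
  -- Since m^r = h⁻ʳ + 1, the weight at m is only e^(2α) times its value at 1/h, so the rate is
  -- kept.
  set m : ℕ → ℝ := fun n => ((h n)⁻¹ ^ r + 1) ^ (1 / r) with hmdef
  have hm : Tendsto m atTop atTop := (tendsto_rpow_atTop (by positivity)).comp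
    (tendsto_atTop_add_const_right _ _ ((tendsto_rpow_atTop hr).comp hμ))
  have hmr : ∀ᶠ n in atTop, m n ^ r = (h n)⁻¹ ^ r + 1 := by
    filter_upwards [hμ.eventually_ge_atTop 0] with n hn
    rw [hmdef, ← Real.rpow_mul (by positivity), one_div_mul_cancel hr.ne', Real.rpow_one]
  refine exists_liminf_lower_bound hγ hs hg hE hL (F := supersmoothClass α r L)
    (ρ := fun u => Real.exp (2 * α * |u| ^ r))
    (fun u => (Real.exp_pos _).le) (fun u v huv => by gcongr)
    (fun f h1 h2 h3 h4 => ⟨h1, h2, h3, h4⟩) hr.le (tendsto_rpow_neg_mul_exp_rpow hα hr) hm ?_ ?_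
  · intro C K
    have hsr : 0 < s - r := sub_pos.2 hrs
    -- D(log μ)² dominates (log log n)², through the factor (s+1)², and the exponent of the
    -- polynomial factor; it must be beaten by the gain 2γ(s/r)μ^(s-r).
    set D := (s + 1) ^ 2 + 2 * (|K| + 1) with hD
    have hD0 : 0 < D := by positivity
    have hlog2 := (tendsto_rpow_atTop hsr).eventually
      (eventually_log_sq_le ((s - r) ^ 2 * (2 * γ * (s / r)) / D) (by positivity))
    filter_upwards [hmr, hh, hm.eventually_ge_atTop C, hm.eventually_ge_atTop 1,
      hμ.eventually_ge_atTop 1, hμ.eventually_ge_atTop (2 ^ (1 / r)),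
      (Real.tendsto_log_atTop.comp hμ).eventually_ge_atTop 1, hμ.eventually hlog2,
      eventually_log_le_mul_log_inv_bandwidth hα hr hγ hrs hh,
      (Real.tendsto_log_atTop.comp tendsto_log_natCast).eventually_ge_atTop 0,
      eventually_gt_atTop 0] with n h1 h2 h3 h4 h5 h6 h7 h8 h9 h10 hn
    have hn0 : (0 : ℝ) < n := by exact_mod_cast hn
    have hm0 : 0 < m n := by linarith
    obtain ⟨-, heq⟩ := solvesBandwidthEq_iff.1 h2
    rw [Function.comp_apply] at h7 h10
    set μ := (h n)⁻¹ with hμdef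
    have hμ0 : 0 < μ := by linarith
    have hms : μ ^ s + s / r * μ ^ (s - r) ≤ m n ^ s := by
      refine (le_rpow_add_one_rpow hμ0 hr hrs).trans_eq ?_
      rw [← h1, ← Real.rpow_mul hm0.le, mul_div_cancel₀ _ hr.ne']
    have hlogm : Real.log (m n) ≤ 2 * Real.log μ := by
      have : m n ≤ μ ^ (2 : ℝ) := by
        calc m n = (μ ^ r + 1) ^ (1 / r) := rfl
          _ ≤ (2 * μ ^ r) ^ (1 / r) := by
            gcongr
            linarith [Real.one_le_rpow h5 hr.le]
          _ = 2 ^ (1 / r) * μ := by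
            rw [Real.mul_rpow (by norm_num) (by positivity), ← Real.rpow_mul hμ0.le,
              mul_one_div_cancel hr.ne', Real.rpow_one]
          _ ≤ μ * μ := by gcongr
          _ = _ := by rw [Real.rpow_two, sq]
      rw [← Real.log_rpow hμ0]
      exact Real.log_le_log hm0 this
    have hpoly : C * m n ^ K ≤ Real.exp ((|K| + 1) * (2 * Real.log μ)) := by
      calc C * m n ^ K ≤ m n * m n ^ |K| := by
            gcongr
            exact le_abs_self K
        _ = Real.exp (Real.log (m n) * (|K| + 1)) := by
            rw [← Real.rpow_def_of_pos hm0, Real.rpow_add hm0, Real.rpow_one, mul_comm]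
        _ ≤ _ := by
            rw [mul_comm]
            gcongr
    have hsq : Real.log (Real.log n) ^ 2 + (|K| + 1) * (2 * Real.log μ)
        ≤ 2 * γ * (s / r * μ ^ (s - r)) := by
      have e1 : Real.log (Real.log n) ^ 2 ≤ ((s + 1) * Real.log μ) ^ 2 := by gcongr
      have e2 : (|K| + 1) * (2 * Real.log μ) ≤ 2 * (|K| + 1) * Real.log μ ^ 2 := by
        have : 0 ≤ |K| + 1 := by positivity
        nlinarith [mul_nonneg this (mul_nonneg (by linarith : 0 ≤ Real.log μ) (sub_nonneg.2 h7))]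
      have e3 : D * Real.log μ ^ 2 ≤ 2 * γ * (s / r) * μ ^ (s - r) := by
        rw [Real.log_rpow hμ0, mul_pow, div_mul_eq_mul_div, le_div_iff₀ hD0, mul_assoc, mul_assoc] at h8
        have := le_of_mul_le_mul_left h8 (by positivity)
        linarith
      rw [hD] at e3
      linarith
    rw [bandwidthExponent] at heq
    rw [abs_of_pos hm0, h1]
    calc n * (C * m n ^ K * Real.exp (-2 * γ * m n ^ s))
        ≤ Real.exp (Real.log n) * (Real.exp ((|K| + 1) * (2 * Real.log μ))
            * Real.exp (-2 * γ * m n ^ s)) := by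
          rw [Real.exp_log hn0]
          gcongr
      _ ≤ _ := by
          rw [← Real.exp_add, ← Real.exp_add, Real.exp_le_exp]
          have e1 := mul_le_mul_of_nonneg_left hms (by positivity : 0 ≤ 2 * γ)
          linarith
  · refine ⟨L * Real.exp (2 * α * (1 + 3 * r * Real.exp (3 * r))), by positivity, ?_⟩
    filter_upwards [hmr, hm.eventually_ge_atTop 1, hh] with n h1 h2 h3
    have hm0 : 0 < m n := by linarith
    refine ⟨by rw [supersmoothRate]; positivity, ?_⟩
    rw [abs_of_pos (by positivity), supersmoothRate, mul_assoc, ← Real.exp_add,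
      show -2 * α / h n ^ r = -2 * α * (h n)⁻¹ ^ r by rw [Real.inv_rpow h3.1.le, div_eq_mul_inv]]
    gcongr
    have := mul_le_mul_of_nonneg_left (add_rpow_neg_rpow_le h2 hr) (by positivity : 0 ≤ 2 * α)
    rw [h1] at this
    linarith

end Deconvolution

end

theorem theorem4 (g : ℝ → ℝ) (γ s : ℝ) (hγ : 0 < γ) (hs : 0 < s)
    (hg : Deconvolution.IsExponentialNoise g γ s) :
    (∀ β L : ℝ, 0 < β → 0 < L →
      Deconvolution.AttainsRate (Deconvolution.sobolevClass β L) g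
          (fun n => Deconvolution.estimator g (Deconvolution.sobolevBandwidth β γ s n) n)
          (Deconvolution.sobolevRate β L γ s) ∧
        (Deconvolution.AssumptionE g γ s →
          Deconvolution.IsMinimaxRate (Deconvolution.sobolevClass β L) g
            (Deconvolution.sobolevRate β L γ s))) ∧
    (∀ α r L : ℝ, 0 < α → 0 < r → 0 < L → (r < s ∨ (r = s ∧ α ≤ γ)) →
      (∀ᶠ n : ℕ in Filter.atTop, ∃! h : ℝ, Deconvolution.SolvesBandwidthEq α r γ s n h) ∧
      ∀ h : ℕ → ℝ, (∀ᶠ n : ℕ in Filter.atTop,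
          Deconvolution.SolvesBandwidthEq α r γ s n (h n)) →
        Deconvolution.AttainsRate (Deconvolution.supersmoothClass α r L) g
            (fun n => Deconvolution.estimator g (h n) n)
            (fun n => Deconvolution.supersmoothRate α r L (h n)) ∧
          (r < s → Deconvolution.AssumptionE g γ s →
            Deconvolution.IsMinimaxRate (Deconvolution.supersmoothClass α r L) g
              (fun n => Deconvolution.supersmoothRate α r L (h n)))) := by
  refine ⟨fun β L hβ hL => ?_, fun α r L hα hr hL hrs => ?_⟩
  · have hatt := Deconvolution.attainsRate_sobolev hγ hs hg hβ hL
    exact ⟨hatt, fun hE => ⟨⟨_, hatt⟩, Deconvolution.liminf_lower_bound_sobolev hγ hs hg hE hβ hL⟩⟩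
  · refine ⟨Deconvolution.eventually_existsUnique_bandwidth hα hr hγ hs, fun h hh => ?_⟩
    have hatt := Deconvolution.attainsRate_supersmooth hγ hs hg hα hr hL hrs hh
    exact ⟨hatt, fun hlt hE => ⟨⟨_, hatt⟩,
      Deconvolution.liminf_lower_bound_supersmooth hγ hg hE hα hr hL hlt hh⟩⟩
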